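/- **Setting.** Let $d\ge 1$, let $\Omega\subset\mathbb R^d$ be a bounded polyhedral domain, and let $\mathbb M$ be a field of symmetric $d\times d$ matrices that is $C^1$ on a neighbourhood of $\overline\Omega$ and satisfies $\underline m I\le \mathbb M(x)\le\overline m I$ for $x\in\Omega$, with constants $0<\underline m\le\overline m$. Let $\hat K$ be an equilateral simplex with $|\hat K|=1$. Consider simplicial meshes $\mathcal T_h$ of $\Omega$ with $N$ elements and $N_v$ vertices $x_1,\dots,x_{N_v}$ and a fixed connectivity, where $N\ge 2$ if $d=1$; a mesh is *nonsingular* if its elements are nondegenerate simplices that do not overlap and that cover $\overline\Omega$. For an element $K$ let $F_K'$ be the Jacobian matrix of the affine map $\hat K\to K$, $\mathbb M_K$ the average of $\mathbb M$ over $K$, and $a_{K,\mathbb M}$ the minimum altitude of $K$ in the metric $\mathbb M_K$. Let $p>1$, $4p>d$, and $$I_h(\mathcal T_h)=\sum_{K\in\mathcal T_h}|K|\det(\mathbb M_K)^{1/2}\Big\|(F_K')^{-1}\mathbb M_K^{-1}(F_K')^{-T}-\gamma_h I\Big\|_F^{2p},\qquad \gamma_h=\Big(\frac{\sigma_h}{N}\Big)^{-2/d},$$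 where $\sigma_h=\sum_{K}|K|\det(\mathbb M_K)^{1/2}$, or where $\sigma_h$ is replaced by a positive constant that does not depend on the mesh. Let $\tau>0$, and let the $P_i$ be positive continuous functions on the set of nonsingular meshes. Let $\mathcal T_h(t)$, $t\ge 0$, be a trajectory of the semi-discrete MMPDE $$\frac{dx_i}{dt}=-\frac{P_i}{\tau}\,\Pi_i\Big(\frac{\partial I_h}{\partial x_i}\Big)^T,\qquad i=1,\dots,N_v,\quad t>0,$$ continuous on $[0,\infty)$, whose initial mesh is nonsingular and face-to-face. Here $\Pi_i$ is the orthogonal projection onto a linear space $V_i$ of admissible velocities: $V_i=\mathbb R^d$ if $x_i(0)\in\Omega$; if $x_i(0)\in\partial\Omega$, then $V_i$ is any space parallel to every facet of the initial mesh that lies on $\partial\Omega$ and contains $x_i(0)$ (so boundary vertices slide along the boundary or are fixed, and corners are fixed). **Claim.** $\mathcal T_h(t)$ is a nonsingular mesh of $\Omega$ for all $t\ge 0$, and (a) $I_h(\mathcal T_h(t))$ converges to a real number $L$ as $t\to\infty$. (b) The trajectory has limit meshes, i.e. meshes $\mathcal T_h^*$ with $\mathcal T_h(t_n)\to\mathcal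 T_h^*$ for some $t_n\to\infty$. Every limit mesh is a nonsingular mesh of $\Omega$, and all its elements $K$ satisfy $$a_{K,\mathbb M}\ge C_1\,\overline m^{-\frac{d}{2(4p-d)}}N^{-\frac{4p}{d(4p-d)}},\qquad |K|\ge C_2\,\overline m^{-\frac{d^2}{2(4p-d)}-\frac d2}N^{-\frac{4p}{4p-d}},$$ where $$C_1=\left(\frac{2^{6p}\,(d!)^{4p/d}\,\alpha}{d^{4p}(d+1)^{4p-\frac{2p}{d}}\big(\beta|\Omega|+I_h(\mathcal T_h(0))\big)}\right)^{\frac1{4p-d}},\quad C_2=\frac{C_1^d}{d!},\quad \beta=\underline m^{d/2}(\gamma_h^2d)^p$$ (with the $\gamma_h$ of the limit mesh) and $\alpha=2^{1-2p}\,\underline m^{d/2}d^{-p}$. If $\sqrt d\,\overline m\ge 1$, the bounds hold also with $\alpha=2^{1-2p}\,\underline m^{d/2}\,\overline m^{-2p}d^{-2p}$. (c) Every limit mesh is a critical point of $I_h$: $I_h$ is differentiable there and $\Pi_i(\partial I_h/\partial x_i)^T=0$ for all $i$ (for vertices with $x_i(0)\in\Omega$ this says $\partial I_h/\partial x_i=0$).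 -/

import Mathlib

open MeasureTheory Filter Topology
open scoped Nat

noncomputable section

namespace MovingMesh

/-- Bounded polyhedral domain of `ℝ^d`: open, connected, bounded, with boundary contained in
finitely many hyperplanes. -/
structure IsPolyhedralDomain {d : ℕ} (Ω : Set (EuclideanSpace ℝ (Fin d))) : Prop where
  isOpen : IsOpen Ω
  isConnected : IsConnected Ω
  isBounded : Bornology.IsBounded Ω
  frontier_subset : ∃ H : Finset (AffineSubspace ℝ (EuclideanSpace ℝ (Fin d))),
    (∀ h ∈ H, Module.finrank ℝ h.direction + 1 = d) ∧
      frontier Ω ⊆ ⋃ h ∈ H, (h : Set (EuclideanSpace ℝ (Fin d)))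

/-- `M` is a `C¹` field of symmetric matrices (defined near the closure of `Ω`) with
`m I ≤ M ≤ mbar I` on `Ω`. -/
structure IsMetricTensor {d : ℕ} (Ω : Set (EuclideanSpace ℝ (Fin d))) (m mbar : ℝ)
    (M : EuclideanSpace ℝ (Fin d) → Matrix (Fin d) (Fin d) ℝ) : Prop where
  smooth : ∀ y ∈ closure Ω, ∀ a b, ContDiffAt ℝ 1 (fun z => M z a b) y
  symm : ∀ y ∈ Ω, (M y).IsSymm
  lower : ∀ y ∈ Ω, (M y - m • (1 : Matrix (Fin d) (Fin d) ℝ)).PosSemidef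
  upper : ∀ y ∈ Ω, (mbar • (1 : Matrix (Fin d) (Fin d) ℝ) - M y).PosSemidef

/-! ### Simplices -/

/-- The simplex with vertices `y 0, …, y d`. -/
def simplex {d : ℕ} (y : Fin (d + 1) → EuclideanSpace ℝ (Fin d)) :
    Set (EuclideanSpace ℝ (Fin d)) :=
  convexHull ℝ (Set.range y)

/-- The facet of the simplex opposite to the vertex `y j`. -/
def facet {d : ℕ} (y : Fin (d + 1) → EuclideanSpace ℝ (Fin d)) (j : Fin (d + 1)) :
    Set (EuclideanSpace ℝ (Fin d)) :=
  convexHull ℝ (y '' {j}ᶜ)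

/-- The Euclidean volume of the simplex. -/
def vol {d : ℕ} (y : Fin (d + 1) → EuclideanSpace ℝ (Fin d)) : ℝ :=
  volume.real (simplex y)

/-- The edge matrix `[y 1 - y 0, …, y d - y 0]`. -/
def edgeMatrix {d : ℕ} (y : Fin (d + 1) → EuclideanSpace ℝ (Fin d)) :
    Matrix (Fin d) (Fin d) ℝ :=
  Matrix.of fun a j => y j.succ a - y 0 a

/-- The Jacobian matrix of the affine map that takes `ξ j` to `y j` for all `j`. -/
def jacobian {d : ℕ} (ξ y : Fin (d + 1) → EuclideanSpace ℝ (Fin d)) :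
    Matrix (Fin d) (Fin d) ℝ :=
  edgeMatrix y * (edgeMatrix ξ)⁻¹

/-- Equilateral simplex of unit volume. -/
def IsReferenceElement {d : ℕ} (ξ : Fin (d + 1) → EuclideanSpace ℝ (Fin d)) : Prop :=
  (∃ ℓ : ℝ, 0 < ℓ ∧ ∀ i j, i ≠ j → dist (ξ i) (ξ j) = ℓ) ∧ vol ξ = 1

/-- The average of `M` over the simplex. -/
def averageMetric {d : ℕ} (M : EuclideanSpace ℝ (Fin d) → Matrix (Fin d) (Fin d) ℝ)
    (y : Fin (d + 1) → EuclideanSpace ℝ (Fin d)) : Matrix (Fin d) (Fin d) ℝ :=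
  Matrix.of fun a b => ⨍ z in simplex y, M z a b

/-- Distance of two points in the constant metric `A`. -/
def metricDist {d : ℕ} (A : Matrix (Fin d) (Fin d) ℝ) (y z : EuclideanSpace ℝ (Fin d)) : ℝ :=
  √(∑ a, ∑ b, (y a - z a) * A a b * (y b - z b))

/-- Altitude of the simplex from the vertex `y j` in the constant metric `A`: the distance of `y j`
from the affine hull of the opposite facet. -/
def altitude {d : ℕ} (A : Matrix (Fin d) (Fin d) ℝ)
    (y : Fin (d + 1) → EuclideanSpace ℝ (Fin d)) (j : Fin (d + 1)) : ℝ :=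
  sInf ((fun z => metricDist A (y j) z) ''
    (affineSpan ℝ (y '' {j}ᶜ) : Set (EuclideanSpace ℝ (Fin d))))

/-- Minimum altitude of the simplex in the constant metric `A`. -/
def minAltitude {d : ℕ} (A : Matrix (Fin d) (Fin d) ℝ)
    (y : Fin (d + 1) → EuclideanSpace ℝ (Fin d)) : ℝ :=
  ⨅ j, altitude A y j

/-- Frobenius norm. -/
def frobenius {d : ℕ} (A : Matrix (Fin d) (Fin d) ℝ) : ℝ :=
  √(∑ a, ∑ b, A a b ^ 2)

/-! ### Meshes

A mesh with `N` elements and `Nv` vertices is given by its connectivity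
`conn : Fin N → Fin (d + 1) → Fin Nv` (the global index of the local vertices of each element),
which does not change in time, and the positions `x : Fin Nv → ℝ^d` of the vertices. -/

/-- The vertices of the element `K`. -/
def elementVertices {d N Nv : ℕ} (conn : Fin N → Fin (d + 1) → Fin Nv)
    (x : Fin Nv → EuclideanSpace ℝ (Fin d)) (K : Fin N) :
    Fin (d + 1) → EuclideanSpace ℝ (Fin d) :=
  fun j => x (conn K j)

/-- The positions `x` make up a nonsingular simplicial mesh of `Ω`: the elements are nondegenerate
simplices that do not overlap and cover the closure of `Ω`. -/
structure IsNonsingularMesh {d N Nv : ℕ} (Ω : Set (EuclideanSpace ℝ (Fin d)))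
    (conn : Fin N → Fin (d + 1) → Fin Nv) (x : Fin Nv → EuclideanSpace ℝ (Fin d)) : Prop where
  nondegenerate : ∀ K, AffineIndependent ℝ (elementVertices conn x K)
  nonoverlapping : ∀ K L, K ≠ L → Disjoint (interior (simplex (elementVertices conn x K)))
    (interior (simplex (elementVertices conn x L)))
  covers : ⋃ K, simplex (elementVertices conn x K) = closure Ω

/-- The mesh is face-to-face (any two elements meet in the common face spanned by their common
vertices), and every vertex belongs to an element. -/
structure IsConforming {d N Nv : ℕ} (conn : Fin N → Fin (d + 1) → Fin Nv)
    (x : Fin Nv → EuclideanSpace ℝ (Fin d)) : Prop where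
  inter_eq : ∀ K L, simplex (elementVertices conn x K) ∩ simplex (elementVertices conn x L) =
    convexHull ℝ (x '' (Set.range (conn K) ∩ Set.range (conn L)))
  vertex_mem : ∀ i, ∃ K j, conn K j = i

/-! ### The functional -/

/-- `σ_h`, the sum over the elements of `|K| det(M_K)^{1/2}`. -/
def sigma {d N Nv : ℕ} (conn : Fin N → Fin (d + 1) → Fin Nv)
    (M : EuclideanSpace ℝ (Fin d) → Matrix (Fin d) (Fin d) ℝ)
    (x : Fin Nv → EuclideanSpace ℝ (Fin d)) : ℝ :=
  ∑ K, vol (elementVertices conn x K) * √(averageMetric M (elementVertices conn x K)).det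

/-- `γ_h = (s / N)^{-2/d}`. -/
def gammaH (d N : ℕ) (s : ℝ) : ℝ := (s / N) ^ (-(2 : ℝ) / d)

/-- The meshing functional, the sum over the elements of
`|K| det(M_K)^{1/2} ‖(F_K')⁻¹ M_K⁻¹ (F_K')⁻ᵀ - (σ/N)^{-2/d} I‖_F^{2p}`. -/
def energy {d N Nv : ℕ} (ξ : Fin (d + 1) → EuclideanSpace ℝ (Fin d))
    (conn : Fin N → Fin (d + 1) → Fin Nv)
    (M : EuclideanSpace ℝ (Fin d) → Matrix (Fin d) (Fin d) ℝ) (p : ℝ)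
    (σ : (Fin Nv → EuclideanSpace ℝ (Fin d)) → ℝ)
    (x : Fin Nv → EuclideanSpace ℝ (Fin d)) : ℝ :=
  ∑ K, vol (elementVertices conn x K) * √(averageMetric M (elementVertices conn x K)).det *
    frobenius ((jacobian ξ (elementVertices conn x K))⁻¹ *
        (averageMetric M (elementVertices conn x K))⁻¹ *
        ((jacobian ξ (elementVertices conn x K))⁻¹).transpose -
      gammaH d N (σ x) • (1 : Matrix (Fin d) (Fin d) ℝ)) ^ (2 * p)

/-! ### The moving mesh equation -/

/-- The spaces `V i` of admissible velocities of the vertices: no restriction at vertices inside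
`Ω`, while a boundary vertex may only move along all the boundary facets that contain it (so that
corners are fixed). Fixing further boundary directions, or all boundary vertices, is allowed. -/
structure IsBoundaryRule {d N Nv : ℕ} (Ω : Set (EuclideanSpace ℝ (Fin d)))
    (conn : Fin N → Fin (d + 1) → Fin Nv) (x₀ : Fin Nv → EuclideanSpace ℝ (Fin d))
    (V : Fin Nv → Submodule ℝ (EuclideanSpace ℝ (Fin d))) : Prop where
  interior_free : ∀ i, x₀ i ∈ Ω → V i = ⊤
  boundary_tangent : ∀ K j, facet (elementVertices conn x₀ K) j ⊆ frontier Ω →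
    ∀ k, k ≠ j → V (conn K k) ≤ (affineSpan ℝ (facet (elementVertices conn x₀ K) j)).direction

/-- The part of the partial gradient `∂I/∂x_i` along the admissible directions `V i`; it is all of
`∂I/∂x_i` where `V i = ⊤`. -/
def admissibleGradient {d Nv : ℕ} (V : Fin Nv → Submodule ℝ (EuclideanSpace ℝ (Fin d)))
    (I : (Fin Nv → EuclideanSpace ℝ (Fin d)) → ℝ) (x : Fin Nv → EuclideanSpace ℝ (Fin d))
    (i : Fin Nv) : EuclideanSpace ℝ (Fin d) :=
  (V i).starProjection (gradient (fun y => I (Function.update x i y)) (x i))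

/-- `x` solves the semi-discrete moving mesh equation `x_i' = -(P_i / τ) ∂I/∂x_i` for `t > 0` and is
continuous up to `t = 0`. -/
structure IsMMPDETrajectory {d Nv : ℕ} (V : Fin Nv → Submodule ℝ (EuclideanSpace ℝ (Fin d)))
    (I : (Fin Nv → EuclideanSpace ℝ (Fin d)) → ℝ) (τ : ℝ)
    (P : Fin Nv → (Fin Nv → EuclideanSpace ℝ (Fin d)) → ℝ)
    (x : ℝ → Fin Nv → EuclideanSpace ℝ (Fin d)) : Prop where
  continuousOn : ContinuousOn x (Set.Ici 0)
  equation : ∀ t, 0 < t → ∀ i, HasDerivAt (fun s => x s i)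
    (-(P i (x t) / τ) • admissibleGradient V I (x t) i) t

/-- `x` is a critical point of `I` (with respect to admissible displacements of the vertices). -/
def IsCriticalMesh {d Nv : ℕ} (V : Fin Nv → Submodule ℝ (EuclideanSpace ℝ (Fin d)))
    (I : (Fin Nv → EuclideanSpace ℝ (Fin d)) → ℝ)
    (x : Fin Nv → EuclideanSpace ℝ (Fin d)) : Prop :=
  DifferentiableAt ℝ I x ∧ ∀ i, admissibleGradient V I x i = 0

/-- `xlim` is a limit mesh of the trajectory: `x (t n) → xlim` for some times `t n → ∞`. -/
def IsLimitMesh {d Nv : ℕ} (x : ℝ → Fin Nv → EuclideanSpace ℝ (Fin d))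
    (xlim : Fin Nv → EuclideanSpace ℝ (Fin d)) : Prop :=
  ∃ t : ℕ → ℝ, Tendsto t atTop atTop ∧ Tendsto (fun n => x (t n)) atTop (𝓝 xlim)

/-! ### The lower bounds on altitudes and volumes -/

/-- The coercivity constant in `G ≥ α ‖J‖_F^{4p} - β`. -/
def alphaJ (d : ℕ) (p m mbar : ℝ) : ℝ :=
  2 ^ (1 - 2 * p) * m ^ ((d : ℝ) / 2) / (mbar ^ (2 * p) * (d : ℝ) ^ (2 * p))

/-- The coercivity constant in `G ≥ α tr(J M⁻¹ Jᵀ)^{2p} - β`. -/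
def alphaM (d : ℕ) (p m : ℝ) : ℝ :=
  2 ^ (1 - 2 * p) * m ^ ((d : ℝ) / 2) / (d : ℝ) ^ p

/-- The constant `β = m^{d/2} (γ² d)^p`. -/
def betaC (d : ℕ) (p m γ : ℝ) : ℝ :=
  m ^ ((d : ℝ) / 2) * (γ ^ 2 * d) ^ p

/-- The constant `C₁`, where `B = β |Ω| + I_h(T_h(0))`. -/
def constC₁ (d : ℕ) (p α B : ℝ) : ℝ :=
  (2 ^ (6 * p) * (d ! : ℝ) ^ (4 * p / d) * α /
    ((d : ℝ) ^ (4 * p) * ((d : ℝ) + 1) ^ (4 * p - 2 * p / d) * B)) ^ (1 / (4 * p - d))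

/-- The constant `C₂ = C₁^d / d!`. -/
def constC₂ (d : ℕ) (p α B : ℝ) : ℝ := constC₁ d p α B ^ d / (d ! : ℝ)

/-- The lower bounds on the minimum altitudes (in the metrics `M_K`) and volumes of the elements of
the mesh `x`, with `C₁` and `C₂` computed from the constants `α` and `B`. -/
def SatisfiesBounds {d N Nv : ℕ} (conn : Fin N → Fin (d + 1) → Fin Nv)
    (M : EuclideanSpace ℝ (Fin d) → Matrix (Fin d) (Fin d) ℝ) (p mbar α B : ℝ)
    (x : Fin Nv → EuclideanSpace ℝ (Fin d)) : Prop :=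
  ∀ K,
    constC₁ d p α B * mbar ^ (-(d : ℝ) / (2 * (4 * p - d))) *
        (N : ℝ) ^ (-(4 * p) / (d * (4 * p - d))) ≤
      minAltitude (averageMetric M (elementVertices conn x K)) (elementVertices conn x K) ∧
    constC₂ d p α B * mbar ^ (-(d : ℝ) ^ 2 / (2 * (4 * p - d)) - (d : ℝ) / 2) *
        (N : ℝ) ^ (-(4 * p) / (4 * p - d)) ≤
      vol (elementVertices conn x K)

end MovingMesh

end

/-! The moving mesh equation is a projected gradient flow, so the functional decreases as long as
the mesh stays nonsingular. It remains to see that elements cannot degenerate, and that elements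
with unchanged orientation really form a mesh of `Ω`.

Degeneration is excluded by coercivity. Let S = (F')⁻¹ M_K⁻¹ (F')⁻ᵀ. A bound on the functional
bounds |K| (tr S)^(2p), whereas the mean inequality for the eigenvalues of S gives |K|² det(M_K) (tr
S / d)^d ≥ 1. Since 4p > d, eliminating |K| bounds tr S from above, and thereby |K| and the
altitudes from below (`element_bounds`). The altitudes enter because tr S is, up to a constant, the
sum of the squared gradients of the barycentric coordinates in the metric, and the lengths of these
gradients are the inverse altitudes (`trace_elementMatrix`, `le_minAltitude`).

The mesh property is a degree argument (`isNonsingularMesh_of_orient`). Signed indicator functions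
of simplices satisfy a cocycle identity (`ae_signedIndicator_eq_sum`). When a vertex moves, the
signed covering number of the mesh therefore changes by cones over the facets that contain the
vertex. Over a facet not on the boundary the cones of the two adjacent elements cancel; over a
boundary facet the cone is flat, because the vertices slide in the hyperplane of the facet. So the
signed covering number stays 1 on `Ω` and 0 outside the closure, almost everywhere. If no element is
inverted, it is the ordinary covering number, which gives both disjoint interiors and covering.

Together: before the first time at which an element loses its orientation, all meshes are
nonsingular and have bounded functional, so their volumes are bounded below, and the bound persists
at that time, a contradiction (`IsMMPDETrajectory.orient_mul_pos`). Hence the trajectory stays in a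
compact set of nonsingular meshes, on which the functional is C¹. The functional converges, being
nonnegative and decreasing; limit meshes exist and inherit the bounds. If the dissipation were
positive at a limit mesh, the functional would drop by a fixed amount at arbitrarily late times
(`IsMMPDETrajectory.dissipation_eq_zero`). -/

noncomputable section

namespace MovingMesh

/-- The vertex matrix of a simplex in homogeneous coordinates; its rows are `(1, y j)`. -/
def homMatrix {d : ℕ} (y : Fin (d + 1) → EuclideanSpace ℝ (Fin d)) :
    Matrix (Fin (d + 1)) (Fin (d + 1)) ℝ :=
  Matrix.of fun j => Fin.cons 1 (fun a => y j a)

/-- The oriented volume of the simplex, up to the factor `d!`. -/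
def orient {d : ℕ} (y : Fin (d + 1) → EuclideanSpace ℝ (Fin d)) : ℝ :=
  (homMatrix y).det

/-! ### Oriented volume and barycentric coordinates -/

section LinearAlgebra

variable {d : ℕ} (y : Fin (d + 1) → EuclideanSpace ℝ (Fin d))

theorem homMatrix_update (j : Fin (d + 1)) (q : EuclideanSpace ℝ (Fin d)) :
    homMatrix (Function.update y j q) =
      (homMatrix y).updateRow j (Fin.cons 1 (fun a => q a)) := by
  ext k a
  by_cases h : k = j
  · subst h; simp [homMatrix]
  · simp [homMatrix, h]

theorem orient_eq_det_edgeMatrix : orient y = (edgeMatrix y).det := by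
  let B : Matrix (Fin (d + 1)) (Fin (d + 1)) ℝ :=
    Matrix.of fun j => if j = 0 then Fin.cons 1 (fun a => y 0 a)
      else Fin.cons 0 (fun a => y j a - y 0 a)
  have h1 : orient y = B.det := by
    refine Matrix.det_eq_of_forall_row_eq_smul_add_const (fun j => if j = 0 then 0 else 1) 0
      (by simp) fun i j => ?_
    refine Fin.cases ?_ (fun a => ?_) j <;> by_cases hi : i = 0 <;> simp [B, homMatrix, hi]
  rw [h1, Matrix.det_succ_column_zero, Fin.sum_univ_succ, Finset.sum_eq_zero, ← Matrix.det_transpose]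
  · simp only [Fin.val_zero, pow_zero, one_mul, add_zero]
    have : B 0 0 = 1 := by simp [B]
    rw [this, one_mul]
    congr 1
  · intro i _
    simp [B]

theorem orient_comp_perm (π : Equiv.Perm (Fin (d + 1))) :
    orient (y ∘ π) = ((Equiv.Perm.sign π : ℤ) : ℝ) * orient y := by
  have : homMatrix (y ∘ π) = (homMatrix y).submatrix π id := by
    ext k a; simp [homMatrix]
  rw [orient, this, Matrix.det_permute]
  rfl

/-- The oriented volume as a linear function of the homogeneous coordinates of one vertex. -/
def orientLin (j : Fin (d + 1)) : (Fin (d + 1) → ℝ) →ₗ[ℝ] ℝ :=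
  (LinearMap.proj j).comp (Matrix.cramer (homMatrix y).transpose)

theorem orient_update (j : Fin (d + 1)) (q : EuclideanSpace ℝ (Fin d)) :
    orient (Function.update y j q) = orientLin y j (Fin.cons 1 (fun a => q a)) := by
  rw [orient, homMatrix_update, orientLin, LinearMap.comp_apply, LinearMap.proj_apply,
    Matrix.cramer_transpose_apply]

theorem cons_sum {ι : Type*} (s : Finset ι) (w : ι → ℝ)
    (f : ι → EuclideanSpace ℝ (Fin d)) :
    (Fin.cons (∑ i ∈ s, w i) (fun a => (∑ i ∈ s, w i • f i) a) : Fin (d + 1) → ℝ) =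
      ∑ i ∈ s, w i • (Fin.cons 1 (fun a => f i a) : Fin (d + 1) → ℝ) := by
  ext k
  refine Fin.cases ?_ (fun a => ?_) k <;> simp

/-- The oriented volume is affine in each vertex. -/
theorem orient_update_sum (j : Fin (d + 1)) {ι : Type*} (s : Finset ι) (w : ι → ℝ)
    (f : ι → EuclideanSpace ℝ (Fin d)) (hw : ∑ i ∈ s, w i = 1) :
    orient (Function.update y j (∑ i ∈ s, w i • f i)) =
      ∑ i ∈ s, w i * orient (Function.update y j (f i)) := by
  have h := cons_sum s w f
  rw [hw] at h
  rw [orient_update, h, map_sum]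
  simp [orient_update]

/-- Cramer's rule in homogeneous coordinates. -/
theorem orient_smul_cons (q : EuclideanSpace ℝ (Fin d)) :
    orient y • (Fin.cons 1 (fun a => q a) : Fin (d + 1) → ℝ) =
      ∑ j, orient (Function.update y j q) • (Fin.cons 1 (fun a => y j a) : Fin (d + 1) → ℝ) := by
  have h := Matrix.mulVec_cramer (homMatrix y).transpose (Fin.cons 1 (fun a => q a))
  rw [Matrix.det_transpose] at h
  rw [orient, ← h, Matrix.mulVec_transpose]
  ext k
  simp only [Matrix.vecMul, dotProduct, Finset.sum_apply, Pi.smul_apply, smul_eq_mul]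
  refine Finset.sum_congr rfl fun j _ => ?_
  rw [orient_update]
  rfl

theorem sum_orient_update (q : EuclideanSpace ℝ (Fin d)) :
    ∑ j, orient (Function.update y j q) = orient y := by
  have h := congrFun (orient_smul_cons y q) 0
  simpa using h.symm

theorem sum_orient_update_smul (q : EuclideanSpace ℝ (Fin d)) :
    ∑ j, orient (Function.update y j q) • y j = orient y • q := by
  ext a
  have h := congrFun (orient_smul_cons y q) a.succ
  simpa using h.symm

/-- A relation of Grassmann–Plücker type: apply the linear form `orientLin y j` to Cramer's rule for
`w`. -/
theorem orient_mul_orient_update (w : Fin (d + 1) → EuclideanSpace ℝ (Fin d)) (j : Fin (d + 1))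
    (q : EuclideanSpace ℝ (Fin d)) :
    orient w * orient (Function.update y j q) =
      ∑ k, orient (Function.update w k q) * orient (Function.update y j (w k)) := by
  have h := congrArg (orientLin y j) (orient_smul_cons w q)
  rw [map_smul, map_sum] at h
  simpa [orient_update] using h

variable {y} in
theorem orient_update_self_ne {j k : Fin (d + 1)} (h : k ≠ j) :
    orient (Function.update y j (y k)) = 0 := by
  refine Matrix.det_zero_of_row_eq h ?_
  ext a
  simp [homMatrix, h]

/-- Points on a common hyperplane span no volume. -/
theorem orient_eq_zero_of_forall {w : Fin (d + 1) → EuclideanSpace ℝ (Fin d)} {j : Fin (d + 1)}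
    (hy : orient y ≠ 0) (hw : ∀ k, orient (Function.update y j (w k)) = 0) : orient w = 0 := by
  -- With the point `y j` the second factor on the left is `orient y`, which is nonzero.
  have h := orient_mul_orient_update y w j (y j)
  rw [Function.update_eq_self, Finset.sum_eq_zero (fun k _ => by rw [hw k, mul_zero])] at h
  exact (mul_eq_zero.mp h).resolve_right hy

/-- A left null vector of `homMatrix y` is an affine dependence: column 0 says that the weights sum
to zero, the other columns that the weighted vertices do. -/
theorem affineIndependent_iff_orient_ne_zero : AffineIndependent ℝ y ↔ orient y ≠ 0 := by
  rw [affineIndependent_iff_of_fintype, ← not_iff_not, ne_eq, not_not, orient, ← Matrix.exists_vecMul_eq_zero_iff]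
  have key : ∀ w : Fin (d + 1) → ℝ, Matrix.vecMul w (homMatrix y) = 0 ↔
      ∑ i, w i = 0 ∧ ∑ i, w i • y i = 0 := by
    intro w
    have : Matrix.vecMul w (homMatrix y) =
        Fin.cons (∑ i, w i) (fun a => (∑ i, w i • y i) a) := by
      rw [cons_sum]
      ext k
      simp [Matrix.vecMul, dotProduct, homMatrix]
    rw [this]
    constructor
    · intro h
      refine ⟨by simpa using congrFun h 0, ?_⟩
      ext a
      simpa using congrFun h a.succ
    · rintro ⟨h1, h2⟩
      ext k
      refine Fin.cases ?_ (fun a => ?_) k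
      · simpa using h1
      · rw [h2]; simp
  constructor
  · intro h
    push Not at h
    obtain ⟨w, h1, h2, i, hi⟩ := h
    rw [Finset.weightedVSub_eq_linear_combination _ h1] at h2
    exact ⟨w, fun h => hi (by rw [h]; rfl), (key w).2 ⟨h1, h2⟩⟩
  · rintro ⟨w, h0, h⟩ hall
    obtain ⟨h1, h2⟩ := (key w).1 h
    refine h0 (funext fun i => hall w h1 ?_ i)
    rw [Finset.weightedVSub_eq_linear_combination _ h1, h2]

theorem mem_simplex_iff_exists {q : EuclideanSpace ℝ (Fin d)} :
    q ∈ simplex y ↔ ∃ w : Fin (d + 1) → ℝ, (∀ j, 0 ≤ w j) ∧ ∑ j, w j = 1 ∧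
      ∑ j, w j • y j = q := by
  rw [simplex, convexHull_range_eq_exists_affineCombination]
  constructor
  · rintro ⟨s, w, h0, h1, h2⟩
    classical
    refine ⟨fun j => if j ∈ s then w j else 0, fun j => ?_, ?_, ?_⟩
    · dsimp only; split_ifs with h
      exacts [h0 j h, le_rfl]
    · simpa using h1
    · rw [Finset.affineCombination_eq_linear_combination _ _ _ h1] at h2
      simpa [ite_smul] using h2
  · rintro ⟨w, h0, h1, h2⟩
    exact ⟨Finset.univ, w, fun j _ => h0 j, h1, by
      rw [Finset.affineCombination_eq_linear_combination _ _ _ h1, h2]⟩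

/-- Barycentric coordinates. -/
def bary (j : Fin (d + 1)) (q : EuclideanSpace ℝ (Fin d)) : ℝ :=
  orient (Function.update y j q) / orient y

variable {y}

theorem sum_bary (hy : orient y ≠ 0) (q : EuclideanSpace ℝ (Fin d)) : ∑ j, bary y j q = 1 := by
  simp only [bary]
  rw [← Finset.sum_div, sum_orient_update, div_self hy]

theorem sum_bary_smul (hy : orient y ≠ 0) (q : EuclideanSpace ℝ (Fin d)) :
    ∑ j, bary y j q • y j = q := by
  have h := congrArg (fun z => (orient y)⁻¹ • z) (sum_orient_update_smul y q)
  simp only [Finset.smul_sum, smul_smul, inv_mul_cancel₀ hy, one_smul] at h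
  rw [← h]
  refine Finset.sum_congr rfl fun j _ => ?_
  rw [bary, div_eq_inv_mul]
  congr 2
  rw [h]

/-- Affinity in the vertex `j` expands the numerator into terms that, except for k = j, have a
repeated vertex. -/
theorem bary_sum (hy : orient y ≠ 0) {w : Fin (d + 1) → ℝ} (hw : ∑ j, w j = 1)
    (j : Fin (d + 1)) : bary y j (∑ k, w k • y k) = w j := by
  rw [bary, orient_update_sum _ _ _ _ _ hw, Finset.sum_eq_single j, Function.update_eq_self,
    mul_div_assoc, div_self hy, mul_one]
  · intro k _ hk
    rw [orient_update_self_ne hk, mul_zero]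
  · simp

theorem bary_affine (j : Fin (d + 1)) (q r : EuclideanSpace ℝ (Fin d)) (t : ℝ) :
    bary y j ((1 - t) • q + t • r) = (1 - t) * bary y j q + t * bary y j r := by
  have h := orient_update_sum y j (Finset.univ : Finset (Fin 2)) ![1 - t, t] ![q, r] (by simp)
  simp only [Fin.sum_univ_two, Matrix.cons_val_zero, Matrix.cons_val_one] at h
  rw [bary, h, bary, bary]
  ring

theorem mem_simplex_iff (hy : orient y ≠ 0) {q : EuclideanSpace ℝ (Fin d)} :
    q ∈ simplex y ↔ ∀ j, 0 ≤ bary y j q := by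
  rw [mem_simplex_iff_exists]
  constructor
  · rintro ⟨w, h0, h1, rfl⟩ j
    rw [bary_sum hy h1]
    exact h0 j
  · intro h
    exact ⟨fun j => bary y j q, h, sum_bary hy q, sum_bary_smul hy q⟩

theorem continuous_orient : Continuous (fun y : Fin (d + 1) → EuclideanSpace ℝ (Fin d) =>
    orient y) := by
  refine Continuous.matrix_det ?_
  refine continuous_matrix fun j k => ?_
  refine Fin.cases ?_ (fun a => ?_) k
  · simpa [homMatrix] using continuous_const
  · simp only [homMatrix, Matrix.of_apply, Fin.cons_succ]
    fun_prop

theorem continuous_bary (j : Fin (d + 1)) : Continuous (bary y j) := by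
  unfold bary
  refine Continuous.div_const (continuous_orient.comp ?_) _
  exact continuous_const.update j continuous_id

theorem mem_interior_simplex (hy : orient y ≠ 0) {q : EuclideanSpace ℝ (Fin d)}
    (hq : ∀ j, 0 < bary y j q) : q ∈ interior (simplex y) := by
  rw [mem_interior]
  refine ⟨⋂ j, {q | 0 < bary y j q}, fun r hr => ?_, ?_, ?_⟩
  · rw [mem_simplex_iff hy]
    exact fun j => (Set.mem_iInter.1 hr j).le
  · exact isOpen_iInter_of_finite fun j => isOpen_lt continuous_const (continuous_bary j)
  · exact Set.mem_iInter.2 hq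

theorem convex_simplex (y : Fin (d + 1) → EuclideanSpace ℝ (Fin d)) : Convex ℝ (simplex y) :=
  convex_convexHull ℝ _

theorem isCompact_simplex (y : Fin (d + 1) → EuclideanSpace ℝ (Fin d)) : IsCompact (simplex y) :=
  (Set.finite_range y).isCompact_convexHull ℝ

theorem simplex_comp_perm (y : Fin (d + 1) → EuclideanSpace ℝ (Fin d))
    (π : Equiv.Perm (Fin (d + 1))) : simplex (y ∘ π) = simplex y := by
  rw [simplex, simplex, π.surjective.range_comp]

theorem vertex_mem_simplex (y : Fin (d + 1) → EuclideanSpace ℝ (Fin d)) (j : Fin (d + 1)) :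
    y j ∈ simplex y :=
  subset_convexHull ℝ _ ⟨j, rfl⟩

theorem interior_simplex_nonempty (hy : orient y ≠ 0) : (interior (simplex y)).Nonempty := by
  refine ⟨∑ k, ((d + 1 : ℕ) : ℝ)⁻¹ • y k, mem_interior_simplex hy fun j => ?_⟩
  rw [bary_sum hy]
  · positivity
  · rw [Finset.sum_const, Finset.card_univ, Fintype.card_fin, nsmul_eq_mul, mul_inv_cancel₀]
    positivity

theorem orient_update_eq_zero_of_mem_affineSpan {j : Fin (d + 1)} {q : EuclideanSpace ℝ (Fin d)}
    (hq : q ∈ affineSpan ℝ (y '' {j}ᶜ)) : orient (Function.update y j q) = 0 := by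
  classical
  rw [Set.image_eq_range] at hq
  obtain ⟨w, hw, rfl⟩ := eq_affineCombination_of_mem_affineSpan_of_fintype hq
  rw [Finset.affineCombination_eq_linear_combination _ _ _ hw, orient_update_sum _ _ _ _ _ hw]
  refine Finset.sum_eq_zero fun k _ => ?_
  rw [orient_update_self_ne k.2, mul_zero]

end LinearAlgebra

/-! ### Entries and exits of a ray in the nonnegative orthant -/

section LineCount

variable {ι : Type*} [Fintype ι]

open Classical in
-- The feasible s ≥ 0 form an interval, bounded above because some ζ j is positive. Its upper end is
-- the smallest ratio β j / ζ j with ζ j > 0, and by `hgen` a single index attains it: the sum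
-- counts exits.
theorem sum_pos_feasible {β ζ : ι → ℝ} (hpos : ∃ j, 0 < ζ j)
    (hgen : ∀ j k, j ≠ k → ζ j ≠ 0 → β j / ζ j * ζ k ≠ β k) :
    ∑ j, (if 0 < ζ j ∧ 0 ≤ β j / ζ j ∧ ∀ k, β j / ζ j * ζ k ≤ β k then (1 : ℝ) else 0) =
      if ∃ s, 0 ≤ s ∧ ∀ k, s * ζ k ≤ β k then 1 else 0 := by
  split_ifs with h
  · obtain ⟨s, hs, hk⟩ := h
    obtain ⟨j₀, hj₀⟩ := hpos
    obtain ⟨i, hi, hmin⟩ := Finset.exists_min_image (Finset.univ.filter fun j => 0 < ζ j)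
      (fun j => β j / ζ j) ⟨j₀, by simpa using hj₀⟩
    simp only [Finset.mem_filter, Finset.mem_univ, true_and] at hi hmin
    have hsi : s ≤ β i / ζ i := (le_div_iff₀ hi).2 (hk i)
    rw [Finset.sum_eq_single i]
    · refine if_pos ⟨hi, hs.trans hsi, fun k => ?_⟩
      rcases lt_or_ge 0 (ζ k) with hζ | hζ
      · exact (le_div_iff₀ hζ).1 (hmin k hζ)
      · exact (mul_le_mul_of_nonpos_right hsi hζ).trans (hk k)
    · rintro j - hj
      refine if_neg ?_
      rintro ⟨hζ, -, hall⟩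
      refine hgen j i hj hζ.ne' (le_antisymm (hall i) ?_)
      exact (div_le_iff₀ hi).1 (hmin j hζ)
    · simp
  · refine Finset.sum_eq_zero fun j _ => if_neg ?_
    rintro ⟨-, h1, h2⟩
    exact h ⟨_, h1, h2⟩

open Classical in
-- The counterpart for entries. If s = 0 is infeasible, the lower end of the interval is the largest
-- ratio with ζ j < 0, attained once. If s = 0 is feasible, these ratios are negative, as no β j
-- vanishes, and nothing is counted.
theorem sum_neg_feasible {β ζ : ι → ℝ} (h0 : ∀ j, β j ≠ 0)
    (hgen : ∀ j k, j ≠ k → ζ j ≠ 0 → β j / ζ j * ζ k ≠ β k) :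
    ∑ j, (if ζ j < 0 ∧ 0 ≤ β j / ζ j ∧ ∀ k, β j / ζ j * ζ k ≤ β k then (1 : ℝ) else 0) =
      if (∃ s, 0 ≤ s ∧ ∀ k, s * ζ k ≤ β k) ∧ ¬ ∀ k, 0 ≤ β k then 1 else 0 := by
  split_ifs with h
  · obtain ⟨⟨s, hs, hk⟩, hneg⟩ := h
    push Not at hneg
    obtain ⟨k₀, hk₀⟩ := hneg
    have hζ₀ : ζ k₀ < 0 := by
      by_contra hc
      have := mul_nonneg hs (not_lt.1 hc)
      linarith [hk k₀]
    obtain ⟨i, hi, hmax⟩ := Finset.exists_max_image (Finset.univ.filter fun j => ζ j < 0)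
      (fun j => β j / ζ j) ⟨k₀, by simpa using hζ₀⟩
    simp only [Finset.mem_filter, Finset.mem_univ, true_and] at hi hmax
    have hsi : β i / ζ i ≤ s := (div_le_iff_of_neg hi).2 (hk i)
    rw [Finset.sum_eq_single i]
    · refine if_pos ⟨hi, ?_, fun k => ?_⟩
      · exact (div_nonneg_of_nonpos hk₀.le hζ₀.le).trans (hmax k₀ hζ₀)
      rcases lt_or_ge (ζ k) 0 with hζ | hζ
      · exact (div_le_iff_of_neg hζ).1 (hmax k hζ)
      · exact (mul_le_mul_of_nonneg_right hsi hζ).trans (hk k)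
    · rintro j - hj
      refine if_neg ?_
      rintro ⟨hζ, -, hall⟩
      refine hgen j i hj hζ.ne (le_antisymm (hall i) ?_)
      exact (le_div_iff_of_neg hi).1 (hmax j hζ)
    · simp
  · refine Finset.sum_eq_zero fun j _ => if_neg ?_
    rintro ⟨hζ, h1, h2⟩
    refine h ⟨⟨_, h1, h2⟩, fun hall => ?_⟩
    have : β j / ζ j < 0 := div_neg_of_pos_of_neg (lt_of_le_of_ne (hall j) (h0 j).symm) hζ
    linarith

open Classical in
/-- Along the ray `β - s ζ`, `s ≥ 0`, the nonnegative orthant is entered and left equally often,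
unless the ray starts in it. -/
theorem line_count {β ζ : ι → ℝ} (hpos : ∃ j, 0 < ζ j) (h0 : ∀ j, β j ≠ 0)
    (hgen : ∀ j k, j ≠ k → ζ j ≠ 0 → β j / ζ j * ζ k ≠ β k) :
    ∑ j, (SignType.sign (ζ j) : ℝ) *
      (if 0 ≤ β j / ζ j ∧ ∀ k, β j / ζ j * ζ k ≤ β k then (1 : ℝ) else 0) =
      if ∀ k, 0 ≤ β k then 1 else 0 := by
  have hsplit : ∀ j, (SignType.sign (ζ j) : ℝ) *
      (if 0 ≤ β j / ζ j ∧ ∀ k, β j / ζ j * ζ k ≤ β k then (1 : ℝ) else 0) =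
      (if 0 < ζ j ∧ 0 ≤ β j / ζ j ∧ ∀ k, β j / ζ j * ζ k ≤ β k then (1 : ℝ) else 0) -
      (if ζ j < 0 ∧ 0 ≤ β j / ζ j ∧ ∀ k, β j / ζ j * ζ k ≤ β k then (1 : ℝ) else 0) := by
    intro j
    rcases lt_trichotomy (ζ j) 0 with h | h | h
    · simp only [sign_neg h, h, not_lt.2 h.le, true_and, false_and, if_false]
      split_ifs <;> simp
    · simp [h]
    · simp only [sign_pos h, h, not_lt.2 h.le, true_and, false_and, if_false]
      simp
  rw [Finset.sum_congr rfl fun j _ => hsplit j, Finset.sum_sub_distrib, sum_pos_feasible hpos hgen,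
    sum_neg_feasible h0 hgen]
  by_cases hβ : ∀ k, 0 ≤ β k
  · have : ∃ s, 0 ≤ s ∧ ∀ k, s * ζ k ≤ β k := ⟨0, le_rfl, by simpa using hβ⟩
    simp only [this, hβ, not_true, and_false, if_true, if_false, implies_true]
    simp
  · by_cases hs : ∃ s, 0 ≤ s ∧ ∀ k, s * ζ k ≤ β k <;> simp only [hs, hβ] <;> simp

end LineCount

/-! ### Cocycle identity of signed indicator functions -/

section Cocycle

variable {d : ℕ}

/-- The indicator function of a simplex with the sign of its orientation. -/
def signedIndicator (y : Fin (d + 1) → EuclideanSpace ℝ (Fin d)) (q : EuclideanSpace ℝ (Fin d)) :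
    ℝ :=
  (SignType.sign (orient y) : ℝ) * (simplex y).indicator 1 q

theorem signedIndicator_of_orient_eq_zero {y : Fin (d + 1) → EuclideanSpace ℝ (Fin d)}
    (hy : orient y = 0) (q : EuclideanSpace ℝ (Fin d)) : signedIndicator y q = 0 := by
  simp [signedIndicator, hy]

theorem sign_permSign (π : Equiv.Perm (Fin (d + 1))) :
    (SignType.sign (((Equiv.Perm.sign π : ℤ) : ℝ)) : ℝ) = ((Equiv.Perm.sign π : ℤ) : ℝ) := by
  rcases Int.units_eq_one_or (Equiv.Perm.sign π) with h | h <;> simp [h]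

theorem signedIndicator_comp_perm (y : Fin (d + 1) → EuclideanSpace ℝ (Fin d))
    (π : Equiv.Perm (Fin (d + 1))) (q : EuclideanSpace ℝ (Fin d)) :
    signedIndicator (y ∘ π) q = ((Equiv.Perm.sign π : ℤ) : ℝ) * signedIndicator y q := by
  rw [signedIndicator, simplex_comp_perm, orient_comp_perm, sign_mul, SignType.coe_mul,
    sign_permSign, mul_assoc, signedIndicator]

/-- The exceptional points form an affine subspace, since `orient` is affine in the replaced vertex,
and it is proper because it misses `y j`. -/
theorem ae_orient_update_ne_zero {y : Fin (d + 1) → EuclideanSpace ℝ (Fin d)} (hy : orient y ≠ 0)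
    (j : Fin (d + 1)) : ∀ᵐ q : EuclideanSpace ℝ (Fin d), orient (Function.update y j q) ≠ 0 := by
  let A : AffineSubspace ℝ (EuclideanSpace ℝ (Fin d)) :=
    { carrier := {q | orient (Function.update y j q) = 0}
      smul_vsub_vadd_mem' := by
        intro c p₁ p₂ p₃ h₁ h₂ h₃
        have h := orient_update_sum y j (Finset.univ : Finset (Fin 3)) ![c, -c, 1] ![p₁, p₂, p₃]
          (by simp [Fin.sum_univ_three])
        simp only [Fin.sum_univ_three] at h
        simp only [Set.mem_ofPred_eq] at h₁ h₂ h₃ ⊢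
        have e : c • (p₁ -ᵥ p₂) +ᵥ p₃ = c • p₁ + (-c) • p₂ + (1 : ℝ) • p₃ := by
          simp [sub_eq_add_neg]
        rw [e]
        refine h.trans ?_
        simp [h₁, h₂, h₃] }
  have hA : A ≠ ⊤ := by
    intro h
    have : y j ∈ A := h ▸ AffineSubspace.mem_top _ _ _
    exact hy (by simpa using (show orient (Function.update y j (y j)) = 0 from this))
  have := Measure.addHaar_affineSubspace (volume : Measure (EuclideanSpace ℝ (Fin d))) A hA
  rw [ae_iff]
  refine measure_mono_null (fun q hq => ?_) this
  exact not_not.1 hq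

/-- With s the ratio of the j-th coordinates, s z absorbs the whole weight of q on `y j`, so q is s
z plus a combination of the other vertices. Barycentric coordinates are unique. -/
theorem bary_update {y : Fin (d + 1) → EuclideanSpace ℝ (Fin d)} (hy : orient y ≠ 0)
    {j : Fin (d + 1)} {z : EuclideanSpace ℝ (Fin d)} (hz : orient (Function.update y j z) ≠ 0)
    (q : EuclideanSpace ℝ (Fin d)) (k : Fin (d + 1)) :
    bary (Function.update y j z) k q =
      Function.update (fun k => bary y k q - bary y j q / bary y j z * bary y k z) j
        (bary y j q / bary y j z) k := by
  have hζ : bary y j z ≠ 0 := div_ne_zero hz hy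
  set s := bary y j q / bary y j z with hs
  set v : Fin (d + 1) → ℝ := fun k => bary y k q - s * bary y k z with hv
  have hvj : v j = 0 := by simp only [hv, hs]; field_simp; ring
  have h1 : ∑ k, Function.update v j s k = 1 := by
    rw [Finset.sum_update_of_mem (Finset.mem_univ j), Finset.sdiff_singleton_eq_erase]
    have : ∑ k, v k = 1 - s := by
      simp only [hv, Finset.sum_sub_distrib, ← Finset.mul_sum, sum_bary hy, mul_one]
    rw [← Finset.sum_erase_add _ _ (Finset.mem_univ j), hvj] at this
    linarith
  have h2 : ∑ k, Function.update v j s k • Function.update y j z k = q := by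
    have : ∑ k, v k • y k = q - s • z := by
      simp only [hv, sub_smul, Finset.sum_sub_distrib, mul_smul, ← Finset.smul_sum,
        sum_bary_smul hy]
    rw [← Finset.sum_erase_add _ _ (Finset.mem_univ j), hvj, zero_smul, add_zero] at this
    rw [← Finset.sum_erase_add _ _ (Finset.mem_univ j), Function.update_self, Function.update_self,
      Finset.sum_congr rfl (g := fun k => v k • y k), this, sub_add_cancel]
    intro k hk
    rw [Function.update_of_ne (Finset.ne_of_mem_erase hk),
      Function.update_of_ne (Finset.ne_of_mem_erase hk)]
  rw [← bary_sum hz h1 k, h2]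

/-- Let β and ζ be the coordinates of q and z. By `bary_update`, q lies in the simplex with z in
place of `y j` iff s = β j / ζ j is nonnegative and β - s ζ has no negative entry. The orientation
of that simplex relative to y is the sign of ζ j, so the right side counts exits minus entries of
the ray β - s ζ, as in `line_count`. -/
theorem ae_signedIndicator_of_orient_ne_zero {y : Fin (d + 1) → EuclideanSpace ℝ (Fin d)}
    (hy : orient y ≠ 0) (z : EuclideanSpace ℝ (Fin d)) :
    ∀ᵐ q, signedIndicator y q = ∑ j, signedIndicator (Function.update y j z) q := by
  have hg : ∀ᵐ q : EuclideanSpace ℝ (Fin d), ∀ j k, orient (Function.update y j z) ≠ 0 →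
      orient (Function.update (Function.update y j z) k q) ≠ 0 := by
    rw [ae_all_iff]; intro j
    rw [ae_all_iff]; intro k
    by_cases h : orient (Function.update y j z) = 0
    · simp [h]
    · simpa [h] using ae_orient_update_ne_zero h k
  have hg0 : ∀ᵐ q : EuclideanSpace ℝ (Fin d), ∀ j, orient (Function.update y j q) ≠ 0 :=
    ae_all_iff.2 fun j => ae_orient_update_ne_zero hy j
  filter_upwards [hg, hg0] with q hq hq0
  classical
  have hl := line_count (β := fun j => bary y j q) (ζ := fun j => bary y j z) ?_
    (fun j => div_ne_zero (hq0 j) hy) ?_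
  · have hsum : ∀ j, signedIndicator (Function.update y j z) q =
        (SignType.sign (orient y) : ℝ) * ((SignType.sign (bary y j z) : ℝ) *
      (if 0 ≤ bary y j q / bary y j z ∧
        ∀ k, bary y j q / bary y j z * bary y k z ≤ bary y k q then (1 : ℝ) else 0)) := by
      intro j
      by_cases hz : orient (Function.update y j z) = 0
      · rw [signedIndicator_of_orient_eq_zero hz, bary, hz]
        simp
      have hs : SignType.sign (orient (Function.update y j z)) =
          SignType.sign (orient y) * SignType.sign (bary y j z) := by
        rw [← sign_mul, bary, mul_div_cancel₀ _ hy]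
      rw [signedIndicator, hs, SignType.coe_mul, mul_assoc, Set.indicator_apply]
      congr 3
      rw [mem_simplex_iff hz, eq_iff_iff]
      have hζ : bary y j z ≠ 0 := div_ne_zero hz hy
      constructor
      · intro h
        refine ⟨by simpa [bary_update hy hz] using h j, fun k => ?_⟩
        by_cases hk : k = j
        · subst hk; rw [div_mul_cancel₀ _ hζ]
        · simpa [bary_update hy hz, hk] using h k
      · rintro ⟨h1, h2⟩ k
        by_cases hk : k = j
        · subst hk; simpa [bary_update hy hz] using h1
        · simpa [bary_update hy hz, hk] using h2 k
    rw [Finset.sum_congr rfl fun j _ => hsum j, ← Finset.mul_sum, signedIndicator,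
      Set.indicator_apply]
    simp only [mem_simplex_iff hy]
    simp only [Pi.one_apply]
    congr 1
    convert hl.symm
  · by_contra hc
    push Not at hc
    have := Finset.sum_nonpos fun j (_ : j ∈ Finset.univ) => hc j
    rw [sum_bary hy] at this
    linarith
  -- Two coinciding ratios would put q on the hyperplane of a facet of a simplex with vertex z,
  -- which is a null event.
  · intro j k hjk hζ heq
    have hz : orient (Function.update y j z) ≠ 0 := fun h => hζ (by simp [bary, h])
    have h := div_ne_zero (hq j k hz) hz
    have h' := bary_update hy hz q k
    rw [Function.update_of_ne (Ne.symm hjk)] at h'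
    rw [← bary, h'] at h
    exact h (sub_eq_zero.2 heq.symm)

/-- The cocycle identity of signed indicator functions. -/
theorem ae_signedIndicator_eq_sum (y : Fin (d + 1) → EuclideanSpace ℝ (Fin d))
    (z : EuclideanSpace ℝ (Fin d)) :
    ∀ᵐ q, signedIndicator y q = ∑ j, signedIndicator (Function.update y j z) q := by
  by_cases hy : orient y = 0
  swap
  · exact ae_signedIndicator_of_orient_ne_zero hy z
  by_cases hall : ∀ j, orient (Function.update y j z) = 0
  · refine Eventually.of_forall fun q => ?_
    rw [signedIndicator_of_orient_eq_zero hy, Finset.sum_eq_zero]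
    exact fun j _ => signedIndicator_of_orient_eq_zero (hall j) q
  push Not at hall
  obtain ⟨j, hj⟩ := hall
  -- Expand the nondegenerate simplex with z at `j` about the point `y j`. The j-th term is the
  -- degenerate y, and every other term is a term of the wanted sum up to a transposition, so that
  -- the wanted sum cancels.
  filter_upwards [ae_signedIndicator_of_orient_ne_zero hj (y j)] with q hq
  rw [← Finset.add_sum_erase _ _ (Finset.mem_univ j), hq,
    ← Finset.add_sum_erase _ _ (Finset.mem_univ j), Function.update_idem, Function.update_eq_self,
    signedIndicator_of_orient_eq_zero hy, zero_add, ← Finset.sum_add_distrib,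
    Finset.sum_eq_zero]
  intro k hk
  have hkj := Finset.ne_of_mem_erase hk
  have : Function.update (Function.update y j z) k (y j) =
      Function.update y k z ∘ Equiv.swap j k := by
    ext1 i
    by_cases hi : i = j
    · subst hi; simp [hkj.symm]
    by_cases hik : i = k
    · subst hik; simp [hkj.symm]
    simp [hi, hik, Equiv.swap_apply_of_ne_of_ne hi hik]
  rw [this, signedIndicator_comp_perm, Equiv.Perm.sign_swap hkj.symm]
  simp

end Cocycle

/-! ### Simplices on the same side of a facet -/

section Facets

variable {d : ℕ}

/-- Weights of the barycentre of the facet opposite to the vertex `j`. -/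
def facetWeight (d : ℕ) (j : Fin (d + 1)) : Fin (d + 1) → ℝ :=
  Function.update (fun _ => (d : ℝ)⁻¹) j 0

theorem sum_facetWeight (hd : 1 ≤ d) (j : Fin (d + 1)) : ∑ k, facetWeight d j k = 1 := by
  rw [facetWeight, Finset.sum_update_of_mem (Finset.mem_univ j), Finset.sdiff_singleton_eq_erase,
    Finset.sum_const, Finset.card_erase_of_mem (Finset.mem_univ j), Finset.card_univ,
    Fintype.card_fin, nsmul_eq_mul, Nat.add_sub_cancel, zero_add, mul_inv_cancel₀]
  positivity

theorem facetWeight_pos (hd : 1 ≤ d) {j k : Fin (d + 1)} (h : k ≠ j) : 0 < facetWeight d j k := by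
  rw [facetWeight, Function.update_of_ne h]
  positivity

theorem facetWeight_self (j : Fin (d + 1)) : facetWeight d j j = 0 := by
  simp [facetWeight]

/-- Two simplices that lie on the same side of a common facet overlap. -/
theorem interiors_meet_of_same_side (hd : 1 ≤ d) {y : Fin (d + 1) → EuclideanSpace ℝ (Fin d)}
    {j : Fin (d + 1)} {w : EuclideanSpace ℝ (Fin d)}
    (h : 0 < orient (Function.update y j w) * orient y) :
    (interior (simplex y) ∩ interior (simplex (Function.update y j w))).Nonempty := by
  have hy : orient y ≠ 0 := right_ne_zero_of_mul h.ne'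
  have hw : orient (Function.update y j w) ≠ 0 := left_ne_zero_of_mul h.ne'
  -- The barycentre of the common facet has the same positive coordinates off `j` in both simplices.
  -- A small step from it towards `y j` keeps these positive and makes the j-th coordinate positive
  -- in both, by the sign hypothesis.
  set r := ∑ k, facetWeight d j k • y k with hr
  have hr' : r = ∑ k, facetWeight d j k • Function.update y j w k := by
    refine Finset.sum_congr rfl fun k _ => ?_
    by_cases hk : k = j
    · subst hk; simp [facetWeight_self]
    · simp [hk]
  have hb : ∀ k, bary y k r = facetWeight d j k := fun k => bary_sum hy (sum_facetWeight hd j) k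
  have hb' : ∀ k, bary (Function.update y j w) k r = facetWeight d j k := fun k => by
    rw [hr']; exact bary_sum hw (sum_facetWeight hd j) k
  have hcont : Continuous fun t : ℝ => (1 - t) • r + t • y j := by fun_prop
  have hev : ∀ᶠ t : ℝ in 𝓝[>] 0, ∀ k, k ≠ j →
      0 < bary y k ((1 - t) • r + t • y j) ∧
      0 < bary (Function.update y j w) k ((1 - t) • r + t • y j) := by
    refine nhdsWithin_le_nhds (eventually_all.2 fun k => ?_)
    by_cases hk : k = j
    · simp [hk]
    · simp only [hk, ne_eq, not_false_eq_true, true_implies]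
      refine Filter.Eventually.and ?_ ?_
      · refine ((continuous_bary k).comp hcont).continuousAt.eventually_const_lt ?_
        simpa [hb] using facetWeight_pos hd hk
      · refine ((continuous_bary k).comp hcont).continuousAt.eventually_const_lt ?_
        simpa [hb'] using facetWeight_pos hd hk
  obtain ⟨t, ht, htpos⟩ := (hev.and self_mem_nhdsWithin).exists
  have htpos : 0 < t := htpos
  refine ⟨(1 - t) • r + t • y j, mem_interior_simplex hy fun k => ?_,
    mem_interior_simplex hw fun k => ?_⟩
  · by_cases hk : k = j
    · subst hk
      rw [bary_affine, hb, facetWeight_self, bary, Function.update_eq_self, div_self hy]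
      simpa using htpos
    · exact (ht k hk).1
  · by_cases hk : k = j
    · subst hk
      rw [bary_affine, hb', facetWeight_self, bary, Function.update_idem, Function.update_eq_self]
      have : 0 < orient y / orient (Function.update y k w) := by
        rw [← mul_div_mul_left _ _ hw, ← pow_two (orient (Function.update y k w))]
        positivity
      rw [mul_zero, zero_add]
      positivity
    · exact (ht k hk).2

theorem facet_subset_simplex (y : Fin (d + 1) → EuclideanSpace ℝ (Fin d)) (j : Fin (d + 1)) :
    facet y j ⊆ simplex y :=
  convexHull_mono (Set.image_subset_range _ _)

theorem bary_eq_zero_of_mem_facet {y : Fin (d + 1) → EuclideanSpace ℝ (Fin d)} {j : Fin (d + 1)}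
    {q : EuclideanSpace ℝ (Fin d)} (hq : q ∈ facet y j) : bary y j q = 0 := by
  rw [bary, orient_update_eq_zero_of_mem_affineSpan (convexHull_subset_affineSpan _ hq), zero_div]

end Facets

/-! ### Neighbouring elements of a conforming mesh -/

section Neighbors

variable {d N Nv : ℕ}

/-- The elements `K` and `L` share the facet of `K` opposite to its vertex `j`; the permutation `π`
matches the local numbering of the shared vertices. -/
def IsNeighbor (conn : Fin N → Fin (d + 1) → Fin Nv) (K : Fin N) (j : Fin (d + 1)) (L : Fin N)
    (π : Equiv.Perm (Fin (d + 1))) : Prop :=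
  K ≠ L ∧ ∀ k, k ≠ j → conn L (π k) = conn K k

variable {Ω : Set (EuclideanSpace ℝ (Fin d))} {conn : Fin N → Fin (d + 1) → Fin Nv}
  {x : Fin Nv → EuclideanSpace ℝ (Fin d)}

theorem IsNonsingularMesh.orient_ne_zero (hx : IsNonsingularMesh Ω conn x) (K : Fin N) :
    orient (elementVertices conn x K) ≠ 0 :=
  (affineIndependent_iff_orient_ne_zero _).1 (hx.nondegenerate K)

theorem IsNonsingularMesh.conn_injective (hx : IsNonsingularMesh Ω conn x) (K : Fin N) :
    Function.Injective (conn K) := fun a b h =>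
  (hx.nondegenerate K).injective (by simp only [elementVertices, h])

theorem IsNonsingularMesh.simplex_subset (hx : IsNonsingularMesh Ω conn x) (K : Fin N) :
    simplex (elementVertices conn x K) ⊆ closure Ω :=
  hx.covers ▸ Set.subset_iUnion (fun K => simplex (elementVertices conn x K)) K

theorem IsNeighbor.symm {K L : Fin N} {j : Fin (d + 1)} {π : Equiv.Perm (Fin (d + 1))}
    (h : IsNeighbor conn K j L π) : IsNeighbor conn L (π j) K π⁻¹ := by
  refine ⟨h.1.symm, fun k hk => ?_⟩
  have := h.2 (π⁻¹ k) (fun h' => hk (by rw [← h']; simp))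
  rw [← this]
  simp

theorem IsNeighbor.elementVertices_comp {K L : Fin N} {j : Fin (d + 1)}
    {π : Equiv.Perm (Fin (d + 1))} (h : IsNeighbor conn K j L π)
    (x : Fin Nv → EuclideanSpace ℝ (Fin d)) :
    elementVertices conn x L ∘ π =
      Function.update (elementVertices conn x K) j (x (conn L (π j))) := by
  ext1 k
  by_cases hk : k = j
  · subst hk; simp [elementVertices]
  · simp [elementVertices, hk, h.2 k hk]

theorem IsNeighbor.update_comp {K L : Fin N} {j : Fin (d + 1)}
    {π : Equiv.Perm (Fin (d + 1))} (h : IsNeighbor conn K j L π)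
    (x : Fin Nv → EuclideanSpace ℝ (Fin d)) (b : EuclideanSpace ℝ (Fin d)) :
    Function.update (elementVertices conn x L) (π j) b ∘ π =
      Function.update (elementVertices conn x K) j b := by
  ext1 k
  by_cases hk : k = j
  · subst hk; simp
  · simp [elementVertices, hk, h.2 k hk]

theorem IsNeighbor.facet_eq {K L : Fin N} {j : Fin (d + 1)}
    {π : Equiv.Perm (Fin (d + 1))} (h : IsNeighbor conn K j L π)
    (x : Fin Nv → EuclideanSpace ℝ (Fin d)) :
    facet (elementVertices conn x L) (π j) = facet (elementVertices conn x K) j := by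
  rw [facet, facet]
  congr 1
  ext q
  constructor
  · rintro ⟨k, hk, rfl⟩
    refine ⟨π⁻¹ k, fun h' => hk ?_, ?_⟩
    · rw [Set.mem_singleton_iff] at h' ⊢
      rw [← h']; simp
    · have := h.2 (π⁻¹ k) (fun h' => hk (by
        rw [Set.mem_singleton_iff, ← h']; simp))
      simp only [elementVertices]
      rw [← this]
      simp
  · rintro ⟨k, hk, rfl⟩
    exact ⟨π k, fun h' => hk (π.injective h'), by simp [elementVertices, h.2 k hk]⟩

/-- Neighbouring elements lie on opposite sides of their common facet. -/
theorem IsNeighbor.opposite_sides (hd : 1 ≤ d) (hx : IsNonsingularMesh Ω conn x) {K L : Fin N}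
    {j : Fin (d + 1)} {π : Equiv.Perm (Fin (d + 1))} (h : IsNeighbor conn K j L π) :
    orient (elementVertices conn x L ∘ π) * orient (elementVertices conn x K) < 0 := by
  have hL : orient (elementVertices conn x L ∘ π) ≠ 0 := by
    rw [orient_comp_perm]
    refine mul_ne_zero ?_ (hx.orient_ne_zero L)
    rcases Int.units_eq_one_or (Equiv.Perm.sign π) with h | h <;> simp [h]
  refine lt_of_le_of_ne (not_lt.1 fun hpos => ?_) (mul_ne_zero hL (hx.orient_ne_zero K))
  rw [h.elementVertices_comp] at hpos
  obtain ⟨q, hq1, hq2⟩ := interiors_meet_of_same_side hd hpos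
  rw [← h.elementVertices_comp, simplex_comp_perm] at hq2
  exact Set.disjoint_left.1 (hx.nonoverlapping K L h.1) hq1 hq2

/-- Two different neighbours across one facet would both lie opposite to `K`, hence on the same
side, and overlap. The local index of the free vertex is then determined because an element has
distinct vertices. -/
theorem IsNeighbor.unique (hd : 1 ≤ d) (hx : IsNonsingularMesh Ω conn x) {K L L' : Fin N}
    {j : Fin (d + 1)} {π π' : Equiv.Perm (Fin (d + 1))} (h : IsNeighbor conn K j L π)
    (h' : IsNeighbor conn K j L' π') : L = L' ∧ π j = π' j := by
  have hL : L = L' := by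
    by_contra hne
    have h1 := h.opposite_sides hd hx
    have h2 := h'.opposite_sides hd hx
    have hpos : 0 < orient (elementVertices conn x L' ∘ π') *
        orient (elementVertices conn x L ∘ π) := by
      have h3 := mul_pos_of_neg_of_neg h2 h1
      have h4 : 0 < orient (elementVertices conn x K) ^ 2 := by
        have := hx.orient_ne_zero K; positivity
      nlinarith
    have he : elementVertices conn x L' ∘ π' =
        Function.update (elementVertices conn x L ∘ π) j (x (conn L' (π' j))) := by
      rw [h.elementVertices_comp, Function.update_idem, h'.elementVertices_comp]
    rw [he] at hpos
    obtain ⟨q, hq1, hq2⟩ := interiors_meet_of_same_side hd hpos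
    rw [← he, simplex_comp_perm] at hq2
    rw [simplex_comp_perm] at hq1
    exact Set.disjoint_left.1 (hx.nonoverlapping L L' hne) hq1 hq2
  subst hL
  refine ⟨rfl, ?_⟩
  by_contra hne
  obtain ⟨k, hk⟩ := π.surjective (π' j)
  have hkj : k ≠ j := fun e => hne (by rw [← hk, e])
  have h3 := hx.conn_injective L ((h.2 k hkj).trans (h'.2 k hkj).symm)
  exact hkj (π'.injective (h3 ▸ hk))

/-- A facet of a conforming mesh that does not lie on the boundary has a neighbour. -/
theorem exists_isNeighbor (hd : 1 ≤ d) (hΩ : IsOpen Ω) (hx : IsNonsingularMesh Ω conn x)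
    (hc : IsConforming conn x) {K : Fin N} {j : Fin (d + 1)}
    (hf : ¬ facet (elementVertices conn x K) j ⊆ frontier Ω) :
    ∃ L π, IsNeighbor conn K j L π := by
  set y := elementVertices conn x K with hy
  have hy0 : orient y ≠ 0 := hx.orient_ne_zero K
  obtain ⟨r, hr, hrf⟩ := Set.not_subset.1 hf
  have hrΩ : r ∈ Ω := by
    rw [hΩ.frontier_eq] at hrf
    by_contra h
    exact hrf ⟨hx.simplex_subset K (facet_subset_simplex y j hr), h⟩
  have hr0 := (mem_simplex_iff hy0).1 (facet_subset_simplex y j hr)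
  have hrj : bary y j r = 0 := bary_eq_zero_of_mem_facet hr
  set c := ∑ k, facetWeight d j k • y k with hcdef
  have hcb : ∀ k, bary y k c = facetWeight d j k := fun k => bary_sum hy0 (sum_facetWeight hd j) k
  -- Pushed slightly towards the barycentre of the facet, `r` stays in `Ω` and enters the relative
  -- interior of the facet.
  obtain ⟨r', hr'Ω, hr'j, hr'pos⟩ : ∃ r' ∈ Ω, bary y j r' = 0 ∧ ∀ k, k ≠ j → 0 < bary y k r' := by
    have hcont : Continuous fun t : ℝ => (1 - t) • r + t • c := by fun_prop
    have h1 : ∀ᶠ t : ℝ in 𝓝[>] 0, (1 - t) • r + t • c ∈ Ω :=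
      nhdsWithin_le_nhds (hcont.continuousAt.eventually_mem (hΩ.mem_nhds (by simpa using hrΩ)))
    have h2 : ∀ᶠ t : ℝ in 𝓝[>] 0, t ∈ Set.Ioo (0 : ℝ) 1 := Ioo_mem_nhdsGT one_pos
    obtain ⟨t, ht1, ht0, ht2⟩ := (h1.and h2).exists
    refine ⟨_, ht1, ?_, fun k hk => ?_⟩
    · rw [bary_affine, hrj, hcb, facetWeight_self]; simp
    · rw [bary_affine, hcb]
      have := mul_nonneg (sub_nonneg.2 ht2.le) (hr0 k)
      have := mul_pos ht0 (facetWeight_pos hd hk)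
      linarith
  have hcont : Continuous fun t : ℝ => (1 - t) • r' + t • y j := by fun_prop
  have hev : ∀ᶠ t : ℝ in 𝓝[<] 0, (1 - t) • r' + t • y j ∈ Ω :=
    nhdsWithin_le_nhds (hcont.continuousAt.eventually_mem (hΩ.mem_nhds (by simpa using hr'Ω)))
  -- For small t < 0 the points lie in `Ω` just beyond the facet, outside `K`. There are finitely
  -- many elements, so one of them contains such points for t arbitrarily close to 0, and `r'` in
  -- the limit.
  obtain ⟨L, hL⟩ : ∃ L, ∃ᶠ t : ℝ in 𝓝[<] 0,
      (1 - t) • r' + t • y j ∈ simplex (elementVertices conn x L) := by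
    by_contra hcon
    push Not at hcon
    have h1 : ∀ᶠ t : ℝ in 𝓝[<] 0, ∀ L,
        (1 - t) • r' + t • y j ∉ simplex (elementVertices conn x L) :=
      eventually_all.2 hcon
    obtain ⟨t, ht1, ht2⟩ := (h1.and hev).exists
    have := subset_closure ht2
    rw [← hx.covers] at this
    obtain ⟨L, hL⟩ := Set.mem_iUnion.1 this
    exact ht1 L hL
  have hr'L : r' ∈ simplex (elementVertices conn x L) := by
    refine (isCompact_simplex _).isClosed.mem_of_frequently_of_tendsto hL ?_
    have := (hcont.tendsto 0).mono_left (nhdsWithin_le_nhds (s := Set.Iio 0))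
    simpa using this
  have hKL : K ≠ L := by
    rintro rfl
    obtain ⟨t, ht1, ht2⟩ := (hL.and_eventually self_mem_nhdsWithin).exists
    have h := (mem_simplex_iff hy0).1 ht1 j
    rw [bary_affine, hr'j, bary, Function.update_eq_self, div_self hy0] at h
    have ht2 : t < 0 := ht2
    linarith
  have hr'K : r' ∈ simplex y := by
    rw [mem_simplex_iff hy0]
    intro k
    by_cases hk : k = j
    · rw [hk, hr'j]
    · exact (hr'pos k hk).le
  have hinter : r' ∈ convexHull ℝ (x '' (Set.range (conn K) ∩ Set.range (conn L))) :=
    hc.inter_eq K L ▸ ⟨hr'K, hr'L⟩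
  -- If `conn K k` were not a common vertex, conformity would put `r'` in the facet opposite to `k`,
  -- against its positive k-th coordinate.
  have hmem : ∀ k, k ≠ j → ∃ l, conn L l = conn K k := by
    intro k hk
    by_contra hcon
    push Not at hcon
    have hsub : x '' (Set.range (conn K) ∩ Set.range (conn L)) ⊆ y '' {k}ᶜ := by
      rintro _ ⟨i, ⟨⟨a, rfl⟩, b, hb⟩, rfl⟩
      refine ⟨a, fun hak => ?_, rfl⟩
      rw [Set.mem_singleton_iff] at hak
      exact hcon b (hak ▸ hb)
    exact (hr'pos k hk).ne' (bary_eq_zero_of_mem_facet (convexHull_mono hsub hinter))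
  choose! f hf using hmem
  -- The matching of the shared vertices is injective off `j` and extends to a permutation, which
  -- sends `j` to the remaining vertex of `L`.
  obtain ⟨g, hg⟩ := Finset.exists_equiv_extend_of_card_eq (t := (Finset.univ : Finset (Fin (d + 1))))
    (by simp) (s := Finset.univ.erase j) (f := f) (Finset.subset_univ _) (by
      intro a ha b hb hab
      have ha' : a ≠ j := by simpa using ha
      have hb' : b ≠ j := by simpa using hb
      exact hx.conn_injective K (by rw [← hf a ha', ← hf b hb', hab]))
  refine ⟨L, g.trans (Equiv.subtypeUnivEquiv (by simp)), hKL, fun k hk => ?_⟩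
  have := hg k (by simpa using hk)
  simp [this, hf k hk]

end Neighbors

/-! ### Invariance of the signed covering number -/

section Invariance

variable {d N Nv : ℕ} {Ω : Set (EuclideanSpace ℝ (Fin d))} {conn : Fin N → Fin (d + 1) → Fin Nv}
  {x₀ : Fin Nv → EuclideanSpace ℝ (Fin d)}

/-- The covering multiplicity of the points by the elements of the mesh `z`, counted with the
orientations relative to those in the mesh `x₀`. -/
def multiplicity (conn : Fin N → Fin (d + 1) → Fin Nv) (x₀ z : Fin Nv → EuclideanSpace ℝ (Fin d))
    (q : EuclideanSpace ℝ (Fin d)) : ℝ :=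
  ∑ K, (SignType.sign (orient (elementVertices conn x₀ K)) : ℝ) *
    signedIndicator (elementVertices conn z K) q

/-- Compatibly numbered neighbours have opposite orientations. In this form it cancels the two cones
over a shared facet. -/
theorem IsNeighbor.sign_eq (hd : 1 ≤ d) (hx : IsNonsingularMesh Ω conn x₀) {K L : Fin N}
    {j : Fin (d + 1)} {π : Equiv.Perm (Fin (d + 1))} (h : IsNeighbor conn K j L π) :
    (SignType.sign (orient (elementVertices conn x₀ K)) : ℝ) * ((Equiv.Perm.sign π : ℤ) : ℝ) +
      (SignType.sign (orient (elementVertices conn x₀ L)) : ℝ) = 0 := by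
  have h1 := h.opposite_sides hd hx
  rw [orient_comp_perm] at h1
  have hK := hx.orient_ne_zero K
  have hL := hx.orient_ne_zero L
  rcases Int.units_eq_one_or (Equiv.Perm.sign π) with hs | hs <;>
  rcases lt_or_gt_of_ne hK with hK | hK <;> rcases lt_or_gt_of_ne hL with hL | hL <;>
  simp only [hs, sign_neg, sign_pos, hK, hL] at h1 ⊢ <;> norm_num at h1 ⊢ <;>
  nlinarith

open Classical in
-- The cocycle identity with the new position `b` as cone point. Replacing the vertex `i` itself
-- gives the moved element; the other terms are the cones from `b` over the facets that contain `i`.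
theorem ae_signedIndicator_update (hx : IsNonsingularMesh Ω conn x₀) (K : Fin N)
    (z : Fin Nv → EuclideanSpace ℝ (Fin d)) (i : Fin Nv) (b : EuclideanSpace ℝ (Fin d)) :
    ∀ᵐ q, signedIndicator (elementVertices conn z K) q =
      signedIndicator (elementVertices conn (Function.update z i b) K) q +
        ∑ j, if ∃ k, k ≠ j ∧ conn K k = i then
          signedIndicator (Function.update (elementVertices conn z K) j b) q else 0 := by
  by_cases hi : ∃ k, conn K k = i
  · obtain ⟨k, hk⟩ := hi
    have he : elementVertices conn (Function.update z i b) K =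
        Function.update (elementVertices conn z K) k b := by
      ext1 l
      by_cases hl : l = k
      · subst hl; simp [elementVertices, hk]
      · have : conn K l ≠ i := fun h => hl (hx.conn_injective K (h.trans hk.symm))
        simp [elementVertices, this, hl]
    filter_upwards [ae_signedIndicator_eq_sum (elementVertices conn z K) b] with q hq
    rw [hq, ← Finset.add_sum_erase _ _ (Finset.mem_univ k), he,
      ← Finset.add_sum_erase _ (fun j => if ∃ k, k ≠ j ∧ conn K k = i then _ else _)
        (Finset.mem_univ k), if_neg, zero_add]
    · congr 1
      refine Finset.sum_congr rfl fun j hj => ?_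
      rw [if_pos ⟨k, (Finset.ne_of_mem_erase hj).symm, hk⟩]
    · rintro ⟨l, hl, hl'⟩
      exact hl (hx.conn_injective K (hl'.trans hk.symm))
  · refine Eventually.of_forall fun q => ?_
    have he : elementVertices conn (Function.update z i b) K = elementVertices conn z K := by
      ext1 l
      have : conn K l ≠ i := fun h => hi ⟨l, h⟩
      simp [elementVertices, this]
    rw [he, Finset.sum_eq_zero, add_zero]
    rintro j -
    exact if_neg fun ⟨k, _, hk⟩ => hi ⟨k, hk⟩

/-- Moving one vertex does not change the covering multiplicity if the vertex moves along the
boundary facets that contain it. -/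
theorem ae_multiplicity_update (hd : 1 ≤ d) (hΩ : IsOpen Ω) (hx : IsNonsingularMesh Ω conn x₀)
    (hc : IsConforming conn x₀) (z : Fin Nv → EuclideanSpace ℝ (Fin d)) (i : Fin Nv)
    (b : EuclideanSpace ℝ (Fin d))
    (hb : ∀ K j k, facet (elementVertices conn x₀ K) j ⊆ frontier Ω → k ≠ j → conn K k = i →
      orient (Function.update (elementVertices conn z K) j b) = 0) :
    ∀ᵐ q, multiplicity conn x₀ (Function.update z i b) q = multiplicity conn x₀ z q := by
  classical
  filter_upwards [ae_all_iff.2 fun K => ae_signedIndicator_update hx K z i b] with q hq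
  set f : Fin N × Fin (d + 1) → ℝ := fun a =>
    (SignType.sign (orient (elementVertices conn x₀ a.1)) : ℝ) *
      (if ∃ k, k ≠ a.2 ∧ conn a.1 k = i then
        signedIndicator (Function.update (elementVertices conn z a.1) a.2 b) q else 0) with hf
  -- The cones over a facet off the boundary cancel between its two elements, and over a boundary
  -- facet the cone is flat by `hb`.
  have hsum : ∑ a, f a = 0 := by
    set s := Finset.univ.filter fun a : Fin N × Fin (d + 1) =>
      ¬ facet (elementVertices conn x₀ a.1) a.2 ⊆ frontier Ω with hs
    rw [← Finset.sum_subset (Finset.subset_univ s)]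
    · choose L π hπ using fun a (ha : a ∈ s) =>
        exists_isNeighbor hd hΩ hx hc (Finset.mem_filter.1 ha).2
      have hmem : ∀ a ha, (L a ha, π a ha a.2) ∈ s := fun a ha => by
        rw [hs, Finset.mem_filter]
        refine ⟨Finset.mem_univ _, ?_⟩
        rw [(hπ a ha).facet_eq]
        exact (Finset.mem_filter.1 ha).2
      refine Finset.sum_involution (fun a ha => (L a ha, π a ha a.2)) ?_ ?_ hmem ?_
      · intro a ha
        have hiff : (∃ k, k ≠ a.2 ∧ conn a.1 k = i) ↔
            ∃ k, k ≠ π a ha a.2 ∧ conn (L a ha) k = i := by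
          constructor
          · rintro ⟨k, hk, rfl⟩
            exact ⟨π a ha k, fun h => hk ((π a ha).injective h), (hπ a ha).2 k hk⟩
          · rintro ⟨k, hk, rfl⟩
            refine ⟨(π a ha)⁻¹ k, fun h => hk ?_, (hπ a ha).symm.2 k hk⟩
            rw [← h]; simp
        simp only [hf]
        by_cases h : ∃ k, k ≠ a.2 ∧ conn a.1 k = i
        · rw [if_pos h, if_pos (hiff.1 h), ← (hπ a ha).update_comp, signedIndicator_comp_perm,
            ← mul_assoc, ← add_mul, (hπ a ha).sign_eq hd hx, zero_mul]
        · rw [if_neg h, if_neg (fun h' => h (hiff.2 h'))]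
          simp
      · intro a ha _ he
        exact (hπ a ha).1 (congrArg Prod.fst he).symm
      · intro a ha
        -- Passing to the neighbour is an involution because the neighbour across a facet is unique.
        have h1 := hπ _ (hmem a ha)
        have h2 := (hπ a ha).symm
        obtain ⟨h3, h4⟩ := h1.unique hd hx h2
        refine Prod.ext h3 (h4.trans ?_)
        simp
    · intro a _ ha
      have hfr : facet (elementVertices conn x₀ a.1) a.2 ⊆ frontier Ω := by
        by_contra h
        exact ha (Finset.mem_filter.2 ⟨Finset.mem_univ _, h⟩)
      simp only [hf]
      split_ifs with h
      · obtain ⟨k, hk, hki⟩ := h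
        rw [signedIndicator_of_orient_eq_zero (hb a.1 a.2 k hfr hk hki), mul_zero]
      · simp
  rw [Fintype.sum_prod_type] at hsum
  simp only [hf, ← Finset.mul_sum] at hsum
  symm
  rw [multiplicity, multiplicity, Finset.sum_congr rfl fun K _ => by rw [hq K, mul_add],
    Finset.sum_add_distrib, hsum, add_zero]

/-- The vertices are moved one at a time. The intermediate meshes may be tangled, which does no
harm: neighbours and reference signs come from `x₀` alone. -/
theorem ae_multiplicity_eq (hd : 1 ≤ d) (hΩ : IsOpen Ω) (hx : IsNonsingularMesh Ω conn x₀)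
    (hc : IsConforming conn x₀) {V : Fin Nv → Submodule ℝ (EuclideanSpace ℝ (Fin d))}
    (hV : IsBoundaryRule Ω conn x₀ V) {x₁ : Fin Nv → EuclideanSpace ℝ (Fin d)}
    (h₁ : ∀ i, x₁ i - x₀ i ∈ V i) :
    ∀ᵐ q, multiplicity conn x₀ x₁ q = multiplicity conn x₀ x₀ q := by
  classical
  have hpos : ∀ K j k, facet (elementVertices conn x₀ K) j ⊆ frontier Ω → k ≠ j →
      orient (Function.update (elementVertices conn x₀ K) j (x₁ (conn K k))) = 0 := by
    intro K j k hfr hk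
    have hdir := hV.boundary_tangent K j hfr k hk (h₁ (conn K k))
    rw [facet, affineSpan_convexHull] at hdir
    refine orient_update_eq_zero_of_mem_affineSpan ?_
    have hmem : x₀ (conn K k) ∈ affineSpan ℝ (elementVertices conn x₀ K '' {j}ᶜ) :=
      subset_affineSpan ℝ _ ⟨k, hk, rfl⟩
    have := AffineSubspace.vadd_mem_of_mem_direction hdir hmem
    simpa using this
  have key : ∀ F : Finset (Fin Nv),
      ∀ᵐ q, multiplicity conn x₀ (F.piecewise x₁ x₀) q = multiplicity conn x₀ x₀ q := by
    intro F
    induction F using Finset.induction_on with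
    | empty => simp
    | insert i F hi ih =>
      rw [Finset.piecewise_insert]
      have := ae_multiplicity_update hd hΩ hx hc (F.piecewise x₁ x₀) i (x₁ i) (by
        intro K j k hfr hk hki
        -- All vertices of the cone, moved or not, lie in the hyperplane of the boundary facet of
        -- `x₀`.
        refine orient_eq_zero_of_forall (elementVertices conn x₀ K) (j := j)
          (hx.orient_ne_zero K) fun l => ?_
        by_cases hl : l = j
        · subst hl
          rw [Function.update_self, ← hki]
          exact hpos K l k hfr hk
        · rw [Function.update_of_ne hl, elementVertices]
          by_cases hF : conn K l ∈ F
          · rw [Finset.piecewise_eq_of_mem _ _ _ hF]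
            exact hpos K j l hfr hl
          · rw [Finset.piecewise_eq_of_notMem _ _ _ hF]
            exact orient_update_self_ne (y := elementVertices conn x₀ K) hl)
      filter_upwards [ih, this] with q h1 h2
      rw [h2, h1]
  simpa using key Finset.univ

theorem multiplicity_eq_sum {x₁ : Fin Nv → EuclideanSpace ℝ (Fin d)}
    (hs : ∀ K, 0 < orient (elementVertices conn x₀ K) * orient (elementVertices conn x₁ K))
    (q : EuclideanSpace ℝ (Fin d)) :
    multiplicity conn x₀ x₁ q = ∑ K, (simplex (elementVertices conn x₁ K)).indicator 1 q := by
  refine Finset.sum_congr rfl fun K _ => ?_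
  rw [signedIndicator, ← mul_assoc, ← SignType.coe_mul, ← sign_mul, sign_pos (hs K)]
  simp

theorem ae_notMem_frontier_simplex (y : Fin (d + 1) → EuclideanSpace ℝ (Fin d)) :
    ∀ᵐ q, q ∉ frontier (simplex y) := by
  rw [ae_iff]
  simpa using (convex_simplex y).addHaar_frontier volume

theorem ae_sum_indicator_of_isNonsingularMesh (hx : IsNonsingularMesh Ω conn x₀) :
    ∀ᵐ q, ∑ K, (simplex (elementVertices conn x₀ K)).indicator (1 : EuclideanSpace ℝ (Fin d) → ℝ) q =
      (closure Ω).indicator 1 q := by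
  filter_upwards [ae_all_iff.2 fun K => ae_notMem_frontier_simplex (elementVertices conn x₀ K)]
    with q hq
  by_cases h : q ∈ closure Ω
  · rw [Set.indicator_of_mem h]
    rw [← hx.covers] at h
    obtain ⟨K, hK⟩ := Set.mem_iUnion.1 h
    have hint : ∀ L, q ∈ simplex (elementVertices conn x₀ L) →
        q ∈ interior (simplex (elementVertices conn x₀ L)) := fun L hL => by
      by_contra hc
      exact hq L ⟨subset_closure hL, hc⟩
    rw [Finset.sum_eq_single K, Set.indicator_of_mem hK]
    · intro L _ hL
      refine Set.indicator_of_notMem (fun hqL => ?_) _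
      exact Set.disjoint_left.1 (hx.nonoverlapping L K hL) (hint L hqL) (hint K hK)
    · simp
  · rw [Set.indicator_of_notMem h]
    exact Finset.sum_eq_zero fun K _ =>
      Set.indicator_of_notMem (fun hK => h (hx.simplex_subset K hK)) _

/-- Moving the vertices of a conforming mesh along the boundary rule without inverting elements
gives a nonsingular mesh. -/
theorem isNonsingularMesh_of_orient (hd : 1 ≤ d) (hΩ : IsOpen Ω)
    (hx : IsNonsingularMesh Ω conn x₀) (hc : IsConforming conn x₀)
    {V : Fin Nv → Submodule ℝ (EuclideanSpace ℝ (Fin d))} (hV : IsBoundaryRule Ω conn x₀ V)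
    {x₁ : Fin Nv → EuclideanSpace ℝ (Fin d)} (h₁ : ∀ i, x₁ i - x₀ i ∈ V i)
    (hs : ∀ K, 0 < orient (elementVertices conn x₀ K) * orient (elementVertices conn x₁ K)) :
    IsNonsingularMesh Ω conn x₁ := by
  have hne : ∀ K, orient (elementVertices conn x₁ K) ≠ 0 := fun K =>
    right_ne_zero_of_mul (hs K).ne'
  have hae : ∀ᵐ q, ∑ K, (simplex (elementVertices conn x₁ K)).indicator (1 : EuclideanSpace ℝ (Fin d) → ℝ) q =
      (closure Ω).indicator 1 q := by
    filter_upwards [ae_multiplicity_eq hd hΩ hx hc hV h₁,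
      ae_sum_indicator_of_isNonsingularMesh hx] with q hq1 hq2
    rw [← multiplicity_eq_sum hs, hq1, multiplicity_eq_sum (fun K => ?_), hq2]
    have := hx.orient_ne_zero K
    rw [← pow_two]
    positivity
  -- The points with the right covering number are dense, so every nonempty open set contains one;
  -- this upgrades the almost everywhere identity to statements on interiors and closures.
  have hdense := Measure.dense_of_ae hae
  refine ⟨fun K => (affineIndependent_iff_orient_ne_zero _).2 (hne K), fun K L hKL => ?_, ?_⟩
  · rw [Set.disjoint_iff_inter_eq_empty, ← Set.not_nonempty_iff_eq_empty]
    intro hnon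
    obtain ⟨q, ⟨hqK, hqL⟩, hq⟩ :=
      hdense.inter_open_nonempty _ (isOpen_interior.inter isOpen_interior) hnon
    have hq : ∑ K, (simplex (elementVertices conn x₁ K)).indicator (1 : EuclideanSpace ℝ (Fin d) → ℝ) q =
      (closure Ω).indicator 1 q := hq
    have hle : (closure Ω).indicator (1 : EuclideanSpace ℝ (Fin d) → ℝ) q ≤ 1 :=
      Set.indicator_le' (fun _ _ => le_rfl) (fun _ _ => zero_le_one) q
    have h2 : ∑ J ∈ {K, L}, (simplex (elementVertices conn x₁ J)).indicator (1 : EuclideanSpace ℝ (Fin d) → ℝ) q ≤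
        ∑ J, (simplex (elementVertices conn x₁ J)).indicator (1 : EuclideanSpace ℝ (Fin d) → ℝ) q :=
      Finset.sum_le_sum_of_subset_of_nonneg (Finset.subset_univ _)
        fun J _ _ => Set.indicator_nonneg (fun _ _ => zero_le_one) q
    rw [Finset.sum_pair hKL, Set.indicator_of_mem (interior_subset hqK),
      Set.indicator_of_mem (interior_subset hqL)] at h2
    simp only [Pi.one_apply] at h2
    linarith
  · refine Set.Subset.antisymm (Set.iUnion_subset fun K => ?_) ?_
    · have hcl : simplex (elementVertices conn x₁ K) ⊆
          closure (interior (simplex (elementVertices conn x₁ K))) := by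
        rw [(convex_simplex _).closure_interior_eq_closure_of_nonempty_interior
          (interior_simplex_nonempty (hne K))]
        exact subset_closure
      refine hcl.trans (closure_minimal ?_ isClosed_closure)
      refine (hdense.open_subset_closure_inter isOpen_interior).trans
        (closure_minimal ?_ isClosed_closure)
      rintro q ⟨hq1, hq2⟩
      by_contra hcon
      have hq2 : ∑ K, (simplex (elementVertices conn x₁ K)).indicator (1 : EuclideanSpace ℝ (Fin d) → ℝ) q =
        (closure Ω).indicator 1 q := hq2
      rw [Set.indicator_of_notMem hcon] at hq2
      have := (Finset.sum_eq_zero_iff_of_nonneg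
        (f := fun J => (simplex (elementVertices conn x₁ J)).indicator 1 q)
        (fun J _ => Set.indicator_nonneg (fun _ _ => zero_le_one) q)).1 hq2 K (Finset.mem_univ K)
      rw [Set.indicator_of_mem (interior_subset hq1)] at this
      simp at this
    · have hclosed : IsClosed (⋃ K, simplex (elementVertices conn x₁ K)) :=
        isClosed_iUnion_of_finite fun K => (isCompact_simplex _).isClosed
      refine closure_minimal ?_ hclosed
      refine (hdense.open_subset_closure_inter hΩ).trans (closure_minimal ?_ hclosed)
      rintro q ⟨hq1, hq2⟩
      have hq2 : ∑ K, (simplex (elementVertices conn x₁ K)).indicator (1 : EuclideanSpace ℝ (Fin d) → ℝ) q =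
        (closure Ω).indicator 1 q := hq2
      by_contra hcon
      rw [Set.indicator_of_mem (subset_closure hq1), Finset.sum_eq_zero] at hq2
      · simp at hq2
      · exact fun K _ => Set.indicator_of_notMem (fun h => hcon (Set.mem_iUnion.2 ⟨K, h⟩)) _

end Invariance

/-! ### Volume of the corner simplex -/

section CornerSimplex

/-- The corner simplex of size `r`. -/
def cornerSimplex (n : ℕ) (r : ℝ) : Set (Fin n → ℝ) := {s | (∀ k, 0 ≤ s k) ∧ ∑ k, s k ≤ r}

theorem isClosed_cornerSimplex (n : ℕ) (r : ℝ) : IsClosed (cornerSimplex n r) := by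
  rw [cornerSimplex, Set.ofPred_and]
  refine IsClosed.inter ?_ (isClosed_le (by fun_prop) continuous_const)
  rw [Set.ofPred_forall]
  exact isClosed_iInter fun k => isClosed_le continuous_const (by fun_prop)

/-- Cavalieri: the slice at first coordinate t is the corner simplex of size r - t in one dimension
less. -/
theorem volume_cornerSimplex (n : ℕ) : ∀ r : ℝ, 0 ≤ r →
    volume (cornerSimplex n r) = ENNReal.ofReal (r ^ n / n !) := by
  induction n with
  | zero =>
    intro r hr
    have : cornerSimplex 0 r = Set.univ := by
      ext s; simp [cornerSimplex, hr]
    rw [this, volume_pi, Measure.pi_univ]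
    simp
  | succ n ih =>
    intro r hr
    have hmp := (volume_preserving_piFinSuccAbove (fun _ : Fin (n + 1) => ℝ) 0).symm
    rw [← hmp.measure_preimage (isClosed_cornerSimplex _ _).measurableSet.nullMeasurableSet,
      Measure.volume_eq_prod, Measure.prod_apply
        (hmp.measurable (isClosed_cornerSimplex _ _).measurableSet)]
    have hslice : ∀ t : ℝ, volume (Prod.mk t ⁻¹' ((MeasurableEquiv.piFinSuccAbove
        (fun _ : Fin (n + 1) => ℝ) 0).symm ⁻¹' cornerSimplex (n + 1) r)) =
        (Set.Icc 0 r).indicator (fun t => ENNReal.ofReal ((r - t) ^ n / n !)) t := by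
      intro t
      by_cases ht : t ∈ Set.Icc 0 r
      · rw [Set.indicator_of_mem ht, ← ih (r - t) (sub_nonneg.2 ht.2)]
        congr 1
        ext s
        simp [cornerSimplex, MeasurableEquiv.piFinSuccAbove_symm_apply, Fin.forall_fin_succ,
          Fin.sum_univ_succ, ht.1, le_sub_iff_add_le']
      · rw [Set.indicator_of_notMem ht]
        convert measure_empty (μ := volume)
        ext s
        simp only [cornerSimplex, MeasurableEquiv.piFinSuccAbove_symm_apply, Set.mem_preimage,
          Set.mem_ofPred_eq, Fin.forall_fin_succ, Fin.sum_univ_succ, Set.mem_empty_iff_false,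
          iff_false]
        rintro ⟨⟨h1, h2⟩, h3⟩
        have := Finset.sum_nonneg fun k (_ : k ∈ Finset.univ) => h2 k
        exact ht ⟨by simpa using h1, by simp at h1 h3 this; linarith⟩
    rw [lintegral_congr hslice, lintegral_indicator measurableSet_Icc,
      ← ofReal_integral_eq_lintegral_ofReal]
    · congr 1
      rw [integral_Icc_eq_integral_Ioc, ← intervalIntegral.integral_of_le hr,
        intervalIntegral.integral_div,
        intervalIntegral.integral_comp_sub_left (fun t => t ^ n) r, integral_pow]
      rw [Nat.factorial_succ]
      push_cast
      simp
      field_simp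
    · exact Continuous.integrableOn_Icc (by fun_prop)
    · refine (ae_restrict_iff' measurableSet_Icc).2 (Eventually.of_forall fun t ht => ?_)
      have := sub_nonneg.2 ht.2
      positivity

end CornerSimplex

/-! ### Pullback to the standard simplex -/

section ChangeOfVariables

variable {d : ℕ}

/-- Barycentric coordinates in the standard simplex. -/
def stdBary (s : EuclideanSpace ℝ (Fin d)) : Fin (d + 1) → ℝ := Fin.cons (1 - ∑ k, s k) (fun k => s k)

/-- The standard simplex of `ℝ^d`. -/
def stdElement (d : ℕ) : Set (EuclideanSpace ℝ (Fin d)) := {s | ∀ k, 0 ≤ stdBary s k}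

/-- The affine map of the standard simplex onto the simplex with vertices `y`, as a linear function
of the vertices. -/
def elementMap (s : EuclideanSpace ℝ (Fin d)) :
    (Fin (d + 1) → EuclideanSpace ℝ (Fin d)) →L[ℝ] EuclideanSpace ℝ (Fin d) :=
  ∑ k, stdBary s k • ContinuousLinearMap.proj k

theorem elementMap_apply (s : EuclideanSpace ℝ (Fin d))
    (y : Fin (d + 1) → EuclideanSpace ℝ (Fin d)) :
    elementMap s y = ∑ k, stdBary s k • y k := by
  simp [elementMap]

theorem sum_stdBary (s : EuclideanSpace ℝ (Fin d)) : ∑ k, stdBary s k = 1 := by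
  simp [stdBary, Fin.sum_univ_succ]

theorem continuous_stdBary (k : Fin (d + 1)) :
    Continuous fun s : EuclideanSpace ℝ (Fin d) => stdBary s k := by
  refine Fin.cases ?_ (fun a => ?_) k
  · simp only [stdBary, Fin.cons_zero]; fun_prop
  · simp only [stdBary, Fin.cons_succ]; fun_prop

theorem continuous_elementMap : Continuous (elementMap (d := d)) := by
  unfold elementMap
  exact continuous_finsetSum _ fun k _ => (continuous_stdBary k).smul continuous_const

theorem stdElement_eq (d : ℕ) : stdElement d = WithLp.ofLp ⁻¹' cornerSimplex d 1 := by
  ext s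
  simp [stdElement, cornerSimplex, stdBary, Fin.forall_fin_succ, and_comm]

theorem isClosed_stdElement (d : ℕ) : IsClosed (stdElement d) := by
  rw [stdElement, Set.ofPred_forall]
  exact isClosed_iInter fun k => isClosed_le continuous_const (continuous_stdBary k)

theorem volume_stdElement (d : ℕ) : volume.real (stdElement d) = 1 / d ! := by
  rw [stdElement_eq, measureReal_def, (PiLp.volume_preserving_ofLp (Fin d)).measure_preimage
    (isClosed_cornerSimplex _ _).measurableSet.nullMeasurableSet,
    volume_cornerSimplex d 1 zero_le_one, one_pow, ENNReal.toReal_ofReal (by positivity)]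

theorem elementMap_image (y : Fin (d + 1) → EuclideanSpace ℝ (Fin d)) :
    (fun s => elementMap s y) '' stdElement d = simplex y := by
  ext q
  rw [mem_simplex_iff_exists]
  constructor
  · rintro ⟨s, hs, rfl⟩
    exact ⟨stdBary s, hs, sum_stdBary s, (elementMap_apply s y).symm⟩
  · rintro ⟨w, h0, h1, rfl⟩
    have : stdBary (WithLp.toLp 2 fun k : Fin d => w k.succ) = w := by
      ext k
      refine Fin.cases ?_ (fun a => ?_) k
      · rw [Fin.sum_univ_succ] at h1
        simp only [stdBary, Fin.cons_zero]
        linarith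
      · simp [stdBary]
    refine ⟨WithLp.toLp 2 fun k : Fin d => w k.succ, fun k => ?_, ?_⟩
    · rw [this]; exact h0 k
    · simp only [elementMap_apply, this]

theorem isCompact_stdElement (d : ℕ) : IsCompact (stdElement d) := by
  have h := elementMap_image (Fin.cons 0 fun k : Fin d => EuclideanSpace.single k (1 : ℝ))
  have he : ∀ s : EuclideanSpace ℝ (Fin d),
      elementMap s (Fin.cons 0 fun k : Fin d => EuclideanSpace.single k (1 : ℝ)) = s := by
    intro s
    rw [elementMap_apply, Fin.sum_univ_succ]
    ext a
    simp [stdBary, Pi.single_apply]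
  simp only [he, Set.image_id'] at h
  rw [h]
  exact isCompact_simplex _

theorem elementMap_eq (y : Fin (d + 1) → EuclideanSpace ℝ (Fin d))
    (s : EuclideanSpace ℝ (Fin d)) :
    elementMap s y = y 0 + Matrix.toEuclideanCLM (n := Fin d) (𝕜 := ℝ) (edgeMatrix y) s := by
  rw [elementMap_apply, Fin.sum_univ_succ]
  ext a
  simp only [stdBary, Fin.cons_zero, Fin.cons_succ, PiLp.add_apply, PiLp.smul_apply, smul_eq_mul,
    WithLp.ofLp_sum, Finset.sum_apply, WithLp.ofLp_smul, Pi.smul_apply,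
    Matrix.ofLp_toEuclideanCLM, Matrix.mulVec, dotProduct, edgeMatrix, Matrix.of_apply]
  rw [sub_mul, one_mul, Finset.sum_mul, sub_add_eq_add_sub, add_sub_assoc,
    ← Finset.sum_sub_distrib]
  congr 1
  exact Finset.sum_congr rfl fun k _ => by ring

/-- The affine parametrization has constant Jacobian `orient y`. The new domain does not depend on
the vertices, which later permits differentiation in them. -/
theorem setIntegral_simplex {y : Fin (d + 1) → EuclideanSpace ℝ (Fin d)} (hy : orient y ≠ 0)
    (g : EuclideanSpace ℝ (Fin d) → ℝ) :
    ∫ z in simplex y, g z = |orient y| * ∫ s in stdElement d, g (elementMap s y) := by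
  rw [← elementMap_image y, integral_image_eq_integral_abs_det_fderiv_smul volume
    (isClosed_stdElement d).measurableSet
    (f' := fun _ => Matrix.toEuclideanCLM (n := Fin d) (𝕜 := ℝ) (edgeMatrix y))]
  · have hdet : (Matrix.toEuclideanCLM (n := Fin d) (𝕜 := ℝ) (edgeMatrix y)).det = orient y := by
      rw [orient_eq_det_edgeMatrix, ContinuousLinearMap.det,
        Matrix.coe_toEuclideanCLM_eq_toEuclideanLin]
      exact LinearMap.det_toLpLin _ _
    simp only [hdet, smul_eq_mul]
    rw [integral_const_mul]
  · intro s _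
    have he : (fun s => elementMap s y) = fun s =>
        y 0 + Matrix.toEuclideanCLM (n := Fin d) (𝕜 := ℝ) (edgeMatrix y) s :=
      funext (elementMap_eq y)
    rw [he]
    exact ((ContinuousLinearMap.hasFDerivAt _).const_add _).hasFDerivWithinAt
  · intro s _ s' _ h
    simp only [elementMap_apply] at h
    ext k
    have h1 := bary_sum hy (sum_stdBary s) k.succ
    rw [h, bary_sum hy (sum_stdBary s')] at h1
    simpa [stdBary] using h1.symm

theorem vol_eq {y : Fin (d + 1) → EuclideanSpace ℝ (Fin d)} (hy : orient y ≠ 0) :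
    vol y = |orient y| / d ! := by
  have h := setIntegral_simplex hy fun _ => 1
  simp only [integral_const, smul_eq_mul, mul_one, measureReal_restrict_apply_univ] at h
  rw [vol, h, volume_stdElement, mul_one_div]

theorem vol_pos {y : Fin (d + 1) → EuclideanSpace ℝ (Fin d)} (hy : orient y ≠ 0) : 0 < vol y := by
  rw [vol_eq hy]
  positivity

theorem averageMetric_eq (M : EuclideanSpace ℝ (Fin d) → Matrix (Fin d) (Fin d) ℝ)
    {y : Fin (d + 1) → EuclideanSpace ℝ (Fin d)} (hy : orient y ≠ 0) (a b : Fin d) :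
    averageMetric M y a b = d ! * ∫ s in stdElement d, M (elementMap s y) a b := by
  have hv : volume.real (simplex y) = |orient y| / d ! := vol_eq hy
  rw [averageMetric, Matrix.of_apply, setAverage_eq, setIntegral_simplex hy, hv, smul_eq_mul]
  have : |orient y| ≠ 0 := abs_ne_zero.2 hy
  field_simp

end ChangeOfVariables

/-! ### Eigenvalue and determinant bounds -/

section MatrixBounds

theorem posDef_of_sub_smul_posSemidef {n : Type*} [DecidableEq n] {A : Matrix n n ℝ} {m : ℝ} (hm : 0 < m)
    (hA : (A - m • (1 : Matrix n n ℝ)).PosSemidef) : A.PosDef := by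
  have : A = (A - m • 1) + m • (1 : Matrix n n ℝ) := by simp
  rw [this]
  exact Matrix.PosDef.posSemidef_add hA (Matrix.PosDef.one.smul hm)

variable {n : Type*} [Fintype n] [DecidableEq n]

theorem le_eigenvalues {A : Matrix n n ℝ} (hA : A.IsHermitian) {m : ℝ}
    (h : (A - m • (1 : Matrix n n ℝ)).PosSemidef) (i : n) : m ≤ hA.eigenvalues i := by
  have h1 := h.dotProduct_mulVec_nonneg (hA.eigenvectorBasis i)
  rw [Matrix.sub_mulVec, hA.mulVec_eigenvectorBasis, Matrix.smul_mulVec, Matrix.one_mulVec,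
    ← sub_smul, dotProduct_smul, dotProduct_comm, ← EuclideanSpace.inner_eq_star_dotProduct,
    real_inner_self_eq_norm_sq, hA.eigenvectorBasis.orthonormal.1 i] at h1
  simpa using h1

theorem eigenvalues_le {A : Matrix n n ℝ} (hA : A.IsHermitian) {m : ℝ}
    (h : (m • (1 : Matrix n n ℝ) - A).PosSemidef) (i : n) : hA.eigenvalues i ≤ m := by
  have h1 := h.dotProduct_mulVec_nonneg (hA.eigenvectorBasis i)
  rw [Matrix.sub_mulVec, hA.mulVec_eigenvectorBasis, Matrix.smul_mulVec, Matrix.one_mulVec,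
    ← sub_smul, dotProduct_smul, dotProduct_comm, ← EuclideanSpace.inner_eq_star_dotProduct,
    real_inner_self_eq_norm_sq, hA.eigenvectorBasis.orthonormal.1 i] at h1
  simpa using h1

theorem pow_le_det {A : Matrix n n ℝ} {m : ℝ} (hm : 0 ≤ m)
    (h : (A - m • (1 : Matrix n n ℝ)).PosSemidef) : m ^ Fintype.card n ≤ A.det := by
  have hA : A.IsHermitian := by
    have := h.isHermitian.add (Matrix.isHermitian_one.smul (k := m) (by simp [IsSelfAdjoint]))
    simpa using this
  rw [hA.det_eq_prod_eigenvalues, ← Finset.card_univ, ← Finset.prod_const]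
  exact Finset.prod_le_prod (fun _ _ => hm) fun i _ => le_eigenvalues hA h i

theorem det_le_pow {A : Matrix n n ℝ} {m : ℝ} (hA : A.PosSemidef)
    (h : (m • (1 : Matrix n n ℝ) - A).PosSemidef) : A.det ≤ m ^ Fintype.card n := by
  rw [hA.isHermitian.det_eq_prod_eigenvalues, ← Finset.card_univ, ← Finset.prod_const]
  exact Finset.prod_le_prod (fun i _ => hA.eigenvalues_nonneg i)
    fun i _ => eigenvalues_le hA.isHermitian h i

/-- The arithmetic-geometric mean inequality for the eigenvalues. -/
theorem det_le_trace_div_pow {A : Matrix n n ℝ} (hA : A.PosSemidef) :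
    A.det ≤ (A.trace / Fintype.card n) ^ Fintype.card n := by
  rw [hA.isHermitian.det_eq_prod_eigenvalues, hA.isHermitian.trace_eq_sum_eigenvalues]
  rcases isEmpty_or_nonempty n with h | h
  · simp
  have hc : (0 : ℝ) < Fintype.card n := by exact_mod_cast Fintype.card_pos
  have h1 := Real.geom_mean_le_arith_mean_weighted Finset.univ
    (fun _ : n => ((Fintype.card n : ℝ))⁻¹) hA.isHermitian.eigenvalues
    (fun _ _ => by positivity) (by simp [hc.ne']) (fun i _ => hA.eigenvalues_nonneg i)
  rw [Real.finsetProd_rpow _ _ (fun i _ => hA.eigenvalues_nonneg i), ← Finset.mul_sum] at h1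
  have h0 : 0 ≤ ∏ i, hA.isHermitian.eigenvalues i :=
    Finset.prod_nonneg fun i _ => hA.eigenvalues_nonneg i
  have h2 := pow_le_pow_left₀ (Real.rpow_nonneg h0 _) h1 (Fintype.card n)
  rw [← Real.rpow_natCast, ← Real.rpow_mul h0, inv_mul_cancel₀ hc.ne', Real.rpow_one] at h2
  simpa [div_eq_inv_mul] using h2

open scoped MatrixOrder in
theorem exists_eq_transpose_mul_self {A : Matrix n n ℝ} (hA : A.PosSemidef) :
    ∃ Q : Matrix n n ℝ, A = Q.transpose * Q := by
  obtain ⟨Q, hQ⟩ := CStarAlgebra.nonneg_iff_eq_star_mul_self.mp hA.nonneg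
  exact ⟨Q, hQ⟩

end MatrixBounds

/-! ### Bounds on the averaged metric -/

section AverageMetric

variable {d : ℕ} {Ω : Set (EuclideanSpace ℝ (Fin d))} {m mbar : ℝ}
  {M : EuclideanSpace ℝ (Fin d) → Matrix (Fin d) (Fin d) ℝ}

theorem IsMetricTensor.continuousOn (hM : IsMetricTensor Ω m mbar M) (a b : Fin d) :
    ContinuousOn (fun z => M z a b) (closure Ω) := fun y hy =>
  (hM.smooth y hy a b).continuousAt.continuousWithinAt

theorem continuousOn_quadForm (hM : IsMetricTensor Ω m mbar M) (v : Fin d → ℝ) :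
    ContinuousOn (fun z => v ⬝ᵥ (M z).mulVec v) (closure Ω) := by
  simp only [dotProduct, Matrix.mulVec]
  exact continuousOn_finsetSum _ fun a _ => continuousOn_const.mul
    (continuousOn_finsetSum _ fun b _ => (hM.continuousOn a b).mul continuousOn_const)

/-- The bounds are assumed on `Ω` only and pass by continuity to its closure, which is what the
elements cover. -/
theorem IsMetricTensor.le_quadForm (hM : IsMetricTensor Ω m mbar M)
    {y : EuclideanSpace ℝ (Fin d)} (hy : y ∈ closure Ω) (v : Fin d → ℝ) :
    m * (v ⬝ᵥ v) ≤ v ⬝ᵥ (M y).mulVec v := by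
  refine le_on_closure (f := fun _ => m * (v ⬝ᵥ v)) (fun z hz => ?_) continuousOn_const
    (continuousOn_quadForm hM v) hy
  have := (hM.lower z hz).dotProduct_mulVec_nonneg v
  rw [Matrix.sub_mulVec, Matrix.smul_mulVec, Matrix.one_mulVec, dotProduct_sub,
    dotProduct_smul] at this
  simpa using this

theorem IsMetricTensor.quadForm_le (hM : IsMetricTensor Ω m mbar M)
    {y : EuclideanSpace ℝ (Fin d)} (hy : y ∈ closure Ω) (v : Fin d → ℝ) :
    v ⬝ᵥ (M y).mulVec v ≤ mbar * (v ⬝ᵥ v) := by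
  refine le_on_closure (g := fun _ => mbar * (v ⬝ᵥ v)) (fun z hz => ?_)
    (continuousOn_quadForm hM v) continuousOn_const hy
  have := (hM.upper z hz).dotProduct_mulVec_nonneg v
  rw [Matrix.sub_mulVec, Matrix.smul_mulVec, Matrix.one_mulVec, dotProduct_sub,
    dotProduct_smul] at this
  simpa using this

theorem IsMetricTensor.symm_closure (hM : IsMetricTensor Ω m mbar M)
    {y : EuclideanSpace ℝ (Fin d)} (hy : y ∈ closure Ω) (a b : Fin d) : M y a b = M y b a := by
  have h1 : ∀ z ∈ Ω, M z a b = M z b a := fun z hz => (hM.symm z hz).apply b a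
  exact le_antisymm
    (le_on_closure (fun z hz => (h1 z hz).le) (hM.continuousOn a b) (hM.continuousOn b a) hy)
    (le_on_closure (fun z hz => (h1 z hz).ge) (hM.continuousOn b a) (hM.continuousOn a b) hy)

variable {y : Fin (d + 1) → EuclideanSpace ℝ (Fin d)}

theorem elementMap_mem_simplex {s : EuclideanSpace ℝ (Fin d)} (hs : s ∈ stdElement d)
    (y : Fin (d + 1) → EuclideanSpace ℝ (Fin d)) : elementMap s y ∈ simplex y :=
  elementMap_image y ▸ ⟨s, hs, rfl⟩

theorem continuousOn_comp_elementMap {g : EuclideanSpace ℝ (Fin d) → ℝ}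
    (hg : ContinuousOn g (closure Ω)) (hsub : simplex y ⊆ closure Ω) :
    ContinuousOn (fun s => g (elementMap s y)) (stdElement d) := by
  refine hg.comp (Continuous.continuousOn ?_) fun s hs => hsub (elementMap_mem_simplex hs y)
  exact continuous_elementMap.clm_apply continuous_const

theorem quadForm_averageMetric (hM : IsMetricTensor Ω m mbar M) (hy : orient y ≠ 0)
    (hsub : simplex y ⊆ closure Ω) (v : Fin d → ℝ) :
    v ⬝ᵥ (averageMetric M y).mulVec v =
      d ! * ∫ s in stdElement d, v ⬝ᵥ (M (elementMap s y)).mulVec v := by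
  have hint : ∀ a b, IntegrableOn (fun s => M (elementMap s y) a b) (stdElement d) := fun a b =>
    (continuousOn_comp_elementMap (hM.continuousOn a b) hsub).integrableOn_compact
      (isCompact_stdElement d)
  simp only [dotProduct, Matrix.mulVec, averageMetric_eq M hy]
  rw [integral_finsetSum _ fun a _ => (integrable_finsetSum _ fun b _ =>
    (hint a b).mul_const (v b)).const_mul (v a), Finset.mul_sum]
  refine Finset.sum_congr rfl fun a _ => ?_
  rw [integral_const_mul, integral_finsetSum _ fun b _ => (hint a b).mul_const (v b),
    mul_left_comm]
  congr 1
  rw [Finset.mul_sum]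
  refine Finset.sum_congr rfl fun b _ => ?_
  rw [integral_mul_const, mul_assoc]

theorem factorial_mul_integral_const (c : ℝ) : d ! * ∫ _ in stdElement d, c = c := by
  rw [setIntegral_const, volume_stdElement, smul_eq_mul]
  field_simp

theorem isHermitian_averageMetric (hM : IsMetricTensor Ω m mbar M) (hy : orient y ≠ 0)
    (hsub : simplex y ⊆ closure Ω) : (averageMetric M y).IsHermitian := by
  ext a b
  rw [Matrix.conjTranspose_apply, averageMetric_eq M hy, averageMetric_eq M hy, star_trivial]
  congr 1
  exact setIntegral_congr_fun (isClosed_stdElement d).measurableSet fun s hs =>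
    hM.symm_closure (hsub (elementMap_mem_simplex hs y)) b a

theorem averageMetric_lower (hM : IsMetricTensor Ω m mbar M) (hy : orient y ≠ 0)
    (hsub : simplex y ⊆ closure Ω) :
    (averageMetric M y - m • (1 : Matrix (Fin d) (Fin d) ℝ)).PosSemidef := by
  refine Matrix.PosSemidef.of_dotProduct_mulVec_nonneg ((isHermitian_averageMetric hM hy hsub).sub
    (Matrix.isHermitian_one.smul (by simp [IsSelfAdjoint]))) fun v => ?_
  rw [Matrix.sub_mulVec, Matrix.smul_mulVec, Matrix.one_mulVec, dotProduct_sub,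
    dotProduct_smul, star_trivial, quadForm_averageMetric hM hy hsub, sub_nonneg, smul_eq_mul,
    ← factorial_mul_integral_const (d := d) (m * _)]
  refine mul_le_mul_of_nonneg_left ?_ (by positivity)
  exact setIntegral_mono_on (continuousOn_const.integrableOn_compact (isCompact_stdElement d))
    ((continuousOn_comp_elementMap (continuousOn_quadForm hM v) hsub).integrableOn_compact
      (isCompact_stdElement d)) (isClosed_stdElement d).measurableSet
    fun s hs => hM.le_quadForm (hsub (elementMap_mem_simplex hs y)) v

theorem averageMetric_upper (hM : IsMetricTensor Ω m mbar M) (hy : orient y ≠ 0)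
    (hsub : simplex y ⊆ closure Ω) :
    (mbar • (1 : Matrix (Fin d) (Fin d) ℝ) - averageMetric M y).PosSemidef := by
  refine Matrix.PosSemidef.of_dotProduct_mulVec_nonneg ((Matrix.isHermitian_one.smul
    (by simp [IsSelfAdjoint])).sub (isHermitian_averageMetric hM hy hsub)) fun v => ?_
  rw [Matrix.sub_mulVec, Matrix.smul_mulVec, Matrix.one_mulVec, dotProduct_sub,
    dotProduct_smul, star_trivial, quadForm_averageMetric hM hy hsub, sub_nonneg, smul_eq_mul,
    ← factorial_mul_integral_const (d := d) (mbar * _)]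
  refine mul_le_mul_of_nonneg_left ?_ (by positivity)
  exact setIntegral_mono_on
    ((continuousOn_comp_elementMap (continuousOn_quadForm hM v) hsub).integrableOn_compact
      (isCompact_stdElement d))
    (continuousOn_const.integrableOn_compact (isCompact_stdElement d))
    (isClosed_stdElement d).measurableSet
    fun s hs => hM.quadForm_le (hsub (elementMap_mem_simplex hs y)) v

theorem pow_le_det_averageMetric (hM : IsMetricTensor Ω m mbar M) (hm : 0 < m)
    (hy : orient y ≠ 0) (hsub : simplex y ⊆ closure Ω) : m ^ d ≤ (averageMetric M y).det := by
  simpa using pow_le_det hm.le (averageMetric_lower hM hy hsub)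

theorem posDef_averageMetric (hM : IsMetricTensor Ω m mbar M) (hm : 0 < m)
    (hy : orient y ≠ 0) (hsub : simplex y ⊆ closure Ω) : (averageMetric M y).PosDef :=
  posDef_of_sub_smul_posSemidef hm (averageMetric_lower hM hy hsub)

theorem det_averageMetric_le_pow (hM : IsMetricTensor Ω m mbar M) (hm : 0 < m)
    (hy : orient y ≠ 0) (hsub : simplex y ⊆ closure Ω) : (averageMetric M y).det ≤ mbar ^ d := by
  simpa using det_le_pow (posDef_averageMetric hM hm hy hsub).posSemidef
    (averageMetric_upper hM hy hsub)

end AverageMetric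

/-! ### Gram matrix of the reference element -/

section ReferenceElement

variable {d : ℕ} {ξ : Fin (d + 1) → EuclideanSpace ℝ (Fin d)}

/-- Polarization: the inner products of the edges from `ξ 0` are ℓ² on the diagonal and ℓ²/2 off it.
-/
theorem gram_edgeMatrix_of_equilateral {ℓ : ℝ} (hℓ : ∀ i j, i ≠ j → dist (ξ i) (ξ j) = ℓ) :
    (edgeMatrix ξ).transpose * edgeMatrix ξ =
      (ℓ ^ 2 / 2) • (1 + Matrix.of fun _ _ => (1 : ℝ)) := by
  have hsq : ∀ i j, i ≠ j → ∑ a, (ξ i a - ξ j a) ^ 2 = ℓ ^ 2 := by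
    intro i j hij
    rw [← hℓ i j hij, EuclideanSpace.dist_eq, Real.sq_sqrt (by positivity)]
    simp [Real.dist_eq, sq_abs]
  ext j k
  rw [Matrix.mul_apply]
  simp only [Matrix.transpose_apply, edgeMatrix, Matrix.of_apply, Matrix.smul_apply,
    Matrix.add_apply, smul_eq_mul]
  have h1 := hsq j.succ 0 (Fin.succ_ne_zero j)
  by_cases hjk : j = k
  · subst hjk
    rw [Matrix.one_apply_eq, ← h1, Finset.sum_div, Finset.sum_mul]
    exact Finset.sum_congr rfl fun a _ => by ring
  · rw [Matrix.one_apply_ne hjk]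
    have h2 := hsq k.succ 0 (Fin.succ_ne_zero k)
    have h3 := hsq j.succ k.succ (fun h => hjk (Fin.succ_injective _ h))
    have h4 : ∑ a, (ξ j.succ a - ξ 0 a) * (ξ k.succ a - ξ 0 a) =
        (∑ a, (ξ j.succ a - ξ 0 a) ^ 2 + ∑ a, (ξ k.succ a - ξ 0 a) ^ 2 -
          ∑ a, (ξ j.succ a - ξ k.succ a) ^ 2) / 2 := by
      rw [← Finset.sum_add_distrib, ← Finset.sum_sub_distrib, Finset.sum_div]
      exact Finset.sum_congr rfl fun a _ => by ring
    rw [h4, h1, h2, h3]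
    ring

/-- The all-ones matrix is a column times a row, so Sylvester's identity reduces the determinant to
size one. -/
theorem det_one_add_ones (d : ℕ) :
    (1 + Matrix.of fun _ _ => (1 : ℝ) : Matrix (Fin d) (Fin d) ℝ).det = d + 1 := by
  have h := Matrix.det_one_add_mul_comm (Matrix.of fun (_ : Fin d) (_ : Unit) => (1 : ℝ))
    (Matrix.of fun (_ : Unit) (_ : Fin d) => (1 : ℝ))
  have h1 : (Matrix.of fun (_ : Fin d) (_ : Unit) => (1 : ℝ)) *
      (Matrix.of fun (_ : Unit) (_ : Fin d) => (1 : ℝ)) = Matrix.of fun _ _ => (1 : ℝ) := by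
    ext; simp [Matrix.mul_apply]
  rw [h1] at h
  rw [h, Matrix.det_unique]
  simp [Matrix.mul_apply, add_comm]

/-- Half of the squared edge length `r` of the equilateral simplex of unit volume. -/
theorem IsReferenceElement.exists_gram (hξ : IsReferenceElement ξ) :
    ∃ r : ℝ, 0 < r ∧ r ^ d * (d + 1) = (d ! : ℝ) ^ 2 ∧ orient ξ ≠ 0 ∧
      (edgeMatrix ξ).transpose * edgeMatrix ξ = r • (1 + Matrix.of fun _ _ => (1 : ℝ)) := by
  obtain ⟨⟨ℓ, hℓ0, hℓ⟩, hvol⟩ := hξ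
  have hg := gram_edgeMatrix_of_equilateral hℓ
  have hdet := congrArg Matrix.det hg
  rw [Matrix.det_mul, Matrix.det_transpose, Matrix.det_smul, det_one_add_ones, Fintype.card_fin,
    ← orient_eq_det_edgeMatrix] at hdet
  have hne : orient ξ ≠ 0 := by
    intro h
    rw [h, zero_mul] at hdet
    have : 0 < (ℓ ^ 2 / 2) ^ d * ((d : ℝ) + 1) := by positivity
    linarith
  refine ⟨ℓ ^ 2 / 2, by positivity, ?_, hne, hg⟩
  -- Unit volume means |orient ξ| = d!, which fixes the edge length.
  rw [vol_eq hne, div_eq_one_iff_eq (by positivity)] at hvol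
  rw [← hdet, ← hvol, sq_abs, pow_two]

end ReferenceElement

/-! ### Trace of the element matrix, altitudes and volume -/

section ElementEstimates

variable {d : ℕ} {ξ y : Fin (d + 1) → EuclideanSpace ℝ (Fin d)}

theorem bary_eq_stdBary (hy : orient y ≠ 0) (q : EuclideanSpace ℝ (Fin d)) (i : Fin (d + 1)) :
    bary y i q = stdBary (WithLp.toLp 2
      ((edgeMatrix y)⁻¹.mulVec (fun a => q a - y 0 a))) i := by
  have hdet : IsUnit (edgeMatrix y).det := by
    rw [← orient_eq_det_edgeMatrix]; exact isUnit_iff_ne_zero.2 hy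
  set c : EuclideanSpace ℝ (Fin d) := WithLp.toLp 2
    ((edgeMatrix y)⁻¹.mulVec (fun a => q a - y 0 a)) with hc
  have hq : ∑ k, stdBary c k • y k = q := by
    rw [← elementMap_apply, elementMap_eq, hc, Matrix.toEuclideanCLM_toLp, Matrix.mulVec_mulVec,
      Matrix.mul_nonsing_inv _ hdet, Matrix.one_mulVec]
    ext a
    simp
  rw [← bary_sum hy (sum_stdBary c) i, hq]

/-- The barycentric coordinate differences as dual pairings in the metric. -/
def dualRow (U : Matrix (Fin d) (Fin d) ℝ) : Fin (d + 1) → Fin d → ℝ :=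
  Fin.cons (fun a => -∑ j, U j a) (fun j a => U j a)

theorem dualRow_zero (U : Matrix (Fin d) (Fin d) ℝ) (a : Fin d) :
    dualRow U 0 a = -∑ j, U j a := rfl

theorem dualRow_succ (U : Matrix (Fin d) (Fin d) ℝ) (j a : Fin d) :
    dualRow U j.succ a = U j a := rfl

/-- In the coordinates Q x the metric QᵀQ is Euclidean, and `dualRow` lists the gradients of the
barycentric coordinates there. -/
theorem sum_dualRow_mul (hy : orient y ≠ 0) {Q : Matrix (Fin d) (Fin d) ℝ} (hQ : IsUnit Q.det)
    (q q' : EuclideanSpace ℝ (Fin d)) (i : Fin (d + 1)) :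
    ∑ a, dualRow (Q * edgeMatrix y)⁻¹ i a * Q.mulVec (fun a => q a - q' a) a =
      bary y i q - bary y i q' := by
  have hU : ∀ j, ∑ a, (Q * edgeMatrix y)⁻¹ j a * Q.mulVec (fun a => q a - q' a) a =
      (edgeMatrix y)⁻¹.mulVec (fun a => q a - q' a) j := by
    intro j
    have : (Q * edgeMatrix y)⁻¹.mulVec (Q.mulVec (fun a => q a - q' a)) =
        (edgeMatrix y)⁻¹.mulVec (fun a => q a - q' a) := by
      rw [Matrix.mul_inv_rev, Matrix.mulVec_mulVec, Matrix.mul_assoc, Matrix.nonsing_inv_mul _ hQ,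
        Matrix.mul_one]
    exact congrFun this j
  have hdiff : (edgeMatrix y)⁻¹.mulVec (fun a => q a - q' a) =
      (edgeMatrix y)⁻¹.mulVec (fun a => q a - y 0 a) -
        (edgeMatrix y)⁻¹.mulVec (fun a => q' a - y 0 a) := by
    rw [← Matrix.mulVec_sub]
    congr 1
    ext a
    simp
  rw [bary_eq_stdBary hy, bary_eq_stdBary hy]
  refine Fin.cases ?_ (fun j => ?_) i
  · simp only [dualRow_zero, stdBary, Fin.cons_zero, neg_mul, Finset.sum_neg_distrib, Finset.sum_mul]
    rw [Finset.sum_comm, Finset.sum_congr rfl fun j _ => hU j, hdiff]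
    simp only [Pi.sub_apply, Finset.sum_sub_distrib]
    ring
  · simp only [dualRow_succ, stdBary, Fin.cons_succ]
    rw [hU j, hdiff, Pi.sub_apply]

/-- The rows sum to zero, so Cauchy–Schwarz bounds each one by the d others; this gains a factor
d/(d+1) over the trivial bound. -/
theorem sum_dualRow_sq_le (U : Matrix (Fin d) (Fin d) ℝ) (i : Fin (d + 1)) :
    ((d : ℝ) + 1) * ∑ a, dualRow U i a ^ 2 ≤ d * ∑ k, ∑ a, dualRow U k a ^ 2 := by
  rw [Finset.sum_comm, Finset.mul_sum, Finset.mul_sum]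
  refine Finset.sum_le_sum fun a _ => ?_
  have h0 : ∑ k, dualRow U k a = 0 := by
    rw [Fin.sum_univ_succ]; simp [dualRow_zero, dualRow_succ]
  rw [← Finset.add_sum_erase _ _ (Finset.mem_univ i)] at h0
  have h1 : dualRow U i a = -∑ k ∈ Finset.univ.erase i, dualRow U k a := by linarith
  have h2 := sq_sum_le_card_mul_sum_sq (s := Finset.univ.erase i) (f := fun k => dualRow U k a)
  rw [Finset.card_erase_of_mem (Finset.mem_univ i), Finset.card_univ, Fintype.card_fin,
    Nat.add_sub_cancel] at h2
  have h3 : dualRow U i a ^ 2 = (∑ k ∈ Finset.univ.erase i, dualRow U k a) ^ 2 := by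
    rw [h1, neg_sq]
  rw [← Finset.add_sum_erase _ _ (Finset.mem_univ i)]
  linarith

/-- The matrix `(F')⁻¹ A⁻¹ (F')⁻ᵀ` of an element in the constant metric `A`. -/
def elementMatrix (ξ y : Fin (d + 1) → EuclideanSpace ℝ (Fin d)) (A : Matrix (Fin d) (Fin d) ℝ) :
    Matrix (Fin d) (Fin d) ℝ :=
  (jacobian ξ y)⁻¹ * A⁻¹ * ((jacobian ξ y)⁻¹).transpose

theorem elementMatrix_eq (hξ : orient ξ ≠ 0) (Q : Matrix (Fin d) (Fin d) ℝ) :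
    elementMatrix ξ y (Q.transpose * Q) =
      (edgeMatrix ξ * (Q * edgeMatrix y)⁻¹) * (edgeMatrix ξ * (Q * edgeMatrix y)⁻¹).transpose := by
  have hdet : IsUnit (edgeMatrix ξ).det := by
    rw [← orient_eq_det_edgeMatrix]; exact isUnit_iff_ne_zero.2 hξ
  rw [elementMatrix, jacobian, Matrix.mul_inv_rev, Matrix.nonsing_inv_nonsing_inv _ hdet,
    Matrix.mul_inv_rev, Matrix.mul_inv_rev, ← Matrix.transpose_nonsing_inv]
  simp only [Matrix.transpose_mul, Matrix.mul_assoc]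

/-- In the Gram matrix, the identity contributes the squared entries of the inverse of Q E, E the
edge matrix of y, and the all-ones matrix its squared column sums, which are the squares in row 0 of
`dualRow`. -/
theorem trace_elementMatrix (hξ : orient ξ ≠ 0) {r : ℝ}
    (hr : (edgeMatrix ξ).transpose * edgeMatrix ξ = r • (1 + Matrix.of fun _ _ => (1 : ℝ)))
    (Q : Matrix (Fin d) (Fin d) ℝ) :
    (elementMatrix ξ y (Q.transpose * Q)).trace =
      r * ∑ k, ∑ a, dualRow (Q * edgeMatrix y)⁻¹ k a ^ 2 := by
  set U := (Q * edgeMatrix y)⁻¹ with hU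
  rw [elementMatrix_eq hξ, Matrix.trace_mul_comm, Matrix.transpose_mul, Matrix.mul_assoc,
    ← Matrix.mul_assoc (edgeMatrix ξ).transpose, hr, Matrix.smul_mul, Matrix.mul_smul,
    Matrix.trace_smul, smul_eq_mul, ← hU]
  congr 1
  rw [Fin.sum_univ_succ, Matrix.add_mul, Matrix.one_mul, Matrix.mul_add, Matrix.trace_add]
  simp only [Matrix.trace, Matrix.diag_apply, Matrix.mul_apply, Matrix.transpose_apply,
    Matrix.of_apply, one_mul, dualRow_zero, dualRow_succ]
  rw [add_comm]
  congr 1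
  · refine Finset.sum_congr rfl fun a _ => ?_
    rw [← Finset.sum_mul]
    ring
  · rw [Finset.sum_comm]
    exact Finset.sum_congr rfl fun a _ => Finset.sum_congr rfl fun j _ => (pow_two _).symm

theorem posSemidef_elementMatrix (hξ : orient ξ ≠ 0) {A : Matrix (Fin d) (Fin d) ℝ}
    (hA : A.PosSemidef) : (elementMatrix ξ y A).PosSemidef := by
  obtain ⟨Q, rfl⟩ := exists_eq_transpose_mul_self hA
  rw [elementMatrix_eq hξ, ← Matrix.conjTranspose_eq_transpose_of_trivial]
  exact Matrix.posSemidef_self_mul_conjTranspose _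

theorem det_elementMatrix (hξ : orient ξ ≠ 0) (hvol : vol ξ = 1) (hy : orient y ≠ 0)
    {A : Matrix (Fin d) (Fin d) ℝ} (hA : A.det ≠ 0) :
    (elementMatrix ξ y A).det * (vol y ^ 2 * A.det) = 1 := by
  have h1 : vol y ^ 2 = (edgeMatrix y).det ^ 2 / (d ! : ℝ) ^ 2 := by
    rw [vol_eq hy, div_pow, sq_abs, orient_eq_det_edgeMatrix]
  have h2 : (edgeMatrix ξ).det ^ 2 = (d ! : ℝ) ^ 2 := by
    rw [vol_eq hξ, div_eq_one_iff_eq (by positivity)] at hvol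
    rw [← hvol, sq_abs, orient_eq_det_edgeMatrix]
  rw [orient_eq_det_edgeMatrix] at hξ hy
  have h3 : (d ! : ℝ) ≠ 0 := by positivity
  rw [h1, elementMatrix, jacobian]
  simp only [Matrix.det_mul, Matrix.det_transpose, Matrix.det_nonsing_inv, Ring.inverse_eq_inv']
  field_simp
  rw [h2]

/-- With the determinant of the element matrix in place of the power of its trace this is an
equality; the mean inequality does the rest. -/
theorem one_le_vol_sq_mul (hξ : orient ξ ≠ 0) (hvol : vol ξ = 1) (hy : orient y ≠ 0)
    {A : Matrix (Fin d) (Fin d) ℝ} (hA : A.PosDef) :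
    1 ≤ vol y ^ 2 * A.det * ((elementMatrix ξ y A).trace / d) ^ d := by
  have h1 := det_elementMatrix hξ hvol hy hA.det_pos.ne'
  have h2 := det_le_trace_div_pow (posSemidef_elementMatrix (y := y) hξ hA.posSemidef)
  rw [Fintype.card_fin] at h2
  have h3 : 0 ≤ vol y ^ 2 * A.det := mul_nonneg (sq_nonneg _) hA.det_pos.le
  rw [← h1, mul_comm]
  exact mul_le_mul_of_nonneg_left h2 h3

theorem metricDist_eq (Q : Matrix (Fin d) (Fin d) ℝ) (q q' : EuclideanSpace ℝ (Fin d)) :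
    metricDist (Q.transpose * Q) q q' = √(∑ a, (Q.mulVec fun a => q a - q' a) a ^ 2) := by
  rw [metricDist]
  congr 1
  have h : ∑ a, (Q.mulVec fun a => q a - q' a) a ^ 2 =
      (fun a => q a - q' a) ⬝ᵥ (Q.transpose * Q).mulVec (fun a => q a - q' a) := by
    rw [← Matrix.mulVec_mulVec, Matrix.dotProduct_mulVec, Matrix.vecMul_transpose, dotProduct]
    exact Finset.sum_congr rfl fun a _ => pow_two _
  rw [h, dotProduct]
  refine Finset.sum_congr rfl fun a _ => ?_
  rw [Matrix.mulVec, dotProduct, Finset.mul_sum]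
  exact Finset.sum_congr rfl fun b _ => mul_assoc _ _ _

/-- Lower bound of the altitudes by the trace of the element matrix. -/
theorem le_minAltitude (hd : 1 ≤ d) (hξ : orient ξ ≠ 0) {r : ℝ} (hr0 : 0 < r)
    (hr : (edgeMatrix ξ).transpose * edgeMatrix ξ = r • (1 + Matrix.of fun _ _ => (1 : ℝ)))
    (hy : orient y ≠ 0) {A : Matrix (Fin d) (Fin d) ℝ} (hA : A.PosDef) :
    0 < (elementMatrix ξ y A).trace ∧
    √(r * (d + 1) / d / (elementMatrix ξ y A).trace) ≤ minAltitude A y := by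
  obtain ⟨Q, rfl⟩ := exists_eq_transpose_mul_self hA.posSemidef
  have hQ : IsUnit Q.det := by
    have := hA.det_pos
    rw [Matrix.det_mul, Matrix.det_transpose] at this
    exact isUnit_iff_ne_zero.2 fun h => by simp [h] at this
  have hd0 : (0 : ℝ) < d := by exact_mod_cast hd
  rw [trace_elementMatrix hξ hr]
  set U := (Q * edgeMatrix y)⁻¹ with hU
  set T := ∑ k, ∑ a, dualRow U k a ^ 2 with hT
  -- The i-th barycentric coordinate falls from 1 at `y i` to 0 on the opposite facet; apply
  -- Cauchy–Schwarz to its gradient and the displacement.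
  have key : ∀ i, ∀ z ∈ affineSpan ℝ (y '' {i}ᶜ),
      1 ≤ (∑ a, dualRow U i a ^ 2) * ∑ a, (Q.mulVec fun a => y i a - z a) a ^ 2 := by
    intro i z hz
    have h1 := sum_dualRow_mul hy hQ (y i) z i
    have hz0 : bary y i z = 0 := by
      rw [bary, orient_update_eq_zero_of_mem_affineSpan hz, zero_div]
    rw [hz0, bary, Function.update_eq_self, div_self hy, sub_zero] at h1
    have h2 := Finset.sum_mul_sq_le_sq_mul_sq Finset.univ (dualRow U i)
      (Q.mulVec fun a => y i a - z a)
    rwa [h1, one_pow] at h2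
  have hne : ∀ i : Fin (d + 1), (y '' {i}ᶜ).Nonempty := by
    intro i
    have : Nontrivial (Fin (d + 1)) := Fin.nontrivial_iff_two_le.2 (by omega)
    obtain ⟨k, hk⟩ := exists_ne i
    exact ⟨y k, k, hk, rfl⟩
  have hTpos : 0 < T := by
    obtain ⟨z, hz⟩ := hne 0
    have h1 := key 0 z (subset_affineSpan ℝ _ hz)
    have h2 : ∑ a, dualRow U 0 a ^ 2 ≤ T := Finset.single_le_sum
      (f := fun k => ∑ a, dualRow U k a ^ 2) (fun k _ => by positivity) (Finset.mem_univ 0)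
    refine lt_of_lt_of_le (lt_of_le_of_ne (by positivity) fun h => ?_) h2
    rw [← h, zero_mul] at h1
    linarith
  refine ⟨by positivity, le_ciInf fun i => ?_⟩
  refine le_csInf (((affineSpan_nonempty ℝ).2 (hne i)).image _) ?_
  rintro _ ⟨z, hz, rfl⟩
  dsimp only
  rw [metricDist_eq]
  refine Real.sqrt_le_sqrt ?_
  have h1 := key i z hz
  have h2 := sum_dualRow_sq_le U i
  rw [← hT] at h2
  set w := ∑ a, (Q.mulVec fun a => y i a - z a) a ^ 2 with hw
  have hw0 : 0 ≤ w := by positivity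
  rw [div_div, div_le_iff₀ (by positivity)]
  have h3 : ((d : ℝ) + 1) * 1 ≤ ((d : ℝ) + 1) * ((∑ a, dualRow U i a ^ 2) * w) :=
    mul_le_mul_of_nonneg_left h1 (by positivity)
  have h4 := mul_le_mul_of_nonneg_right h2 hw0
  have h5 : (d : ℝ) + 1 ≤ d * T * w := by linarith
  calc r * ((d : ℝ) + 1) ≤ r * (d * T * w) := mul_le_mul_of_nonneg_left h5 hr0.le
    _ = w * (d * (r * T)) := by ring

end ElementEstimates

/-! ### Coercivity of the integrand -/

section Coercivity

variable {d : ℕ}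

theorem trace_le_sqrt_mul_frobenius (A : Matrix (Fin d) (Fin d) ℝ) :
    A.trace ≤ √d * frobenius A := by
  rw [frobenius, ← Real.sqrt_mul (Nat.cast_nonneg d)]
  refine Real.le_sqrt_of_sq_le ?_
  have h1 := sq_sum_le_card_mul_sum_sq (s := Finset.univ) (f := fun a => A a a)
  rw [Finset.card_univ, Fintype.card_fin] at h1
  refine h1.trans (mul_le_mul_of_nonneg_left (Finset.sum_le_sum fun a _ => ?_) (Nat.cast_nonneg d))
  exact Finset.single_le_sum (f := fun b => A a b ^ 2) (fun b _ => sq_nonneg _) (Finset.mem_univ a)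

theorem frobenius_nonneg (A : Matrix (Fin d) (Fin d) ℝ) : 0 ≤ frobenius A := Real.sqrt_nonneg _

theorem sqrt_rpow_two_mul {t : ℝ} (ht : 0 ≤ t) (p : ℝ) : √t ^ (2 * p) = t ^ p := by
  rw [Real.sqrt_eq_rpow, ← Real.rpow_mul ht]
  congr 1
  ring

theorem add_rpow_le_two_rpow_mul {a b q : ℝ} (ha : 0 ≤ a) (hb : 0 ≤ b) (hq : 1 ≤ q) :
    (a + b) ^ q ≤ 2 ^ (q - 1) * (a ^ q + b ^ q) := by
  have := NNReal.rpow_add_le_mul_rpow_add_rpow ⟨a, ha⟩ ⟨b, hb⟩ hq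
  exact_mod_cast this

/-- Coercivity of the integrand of the meshing functional. -/
theorem coercivity (hd : 1 ≤ d) {p : ℝ} (hp : 1 < p) {S : Matrix (Fin d) (Fin d) ℝ}
    (hS : 0 ≤ S.trace) {γ : ℝ} (hγ : 0 ≤ γ) :
    2 ^ (1 - 2 * p) / (d : ℝ) ^ p * S.trace ^ (2 * p) - (γ ^ 2 * d) ^ p ≤
      frobenius (S - γ • (1 : Matrix (Fin d) (Fin d) ℝ)) ^ (2 * p) := by
  have hd0 : (0 : ℝ) < d := by exact_mod_cast hd
  set X := frobenius (S - γ • (1 : Matrix (Fin d) (Fin d) ℝ)) with hX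
  -- Write tr S = tr(S - γI) + γd and bound the first trace by √d times the Frobenius norm.
  have h1 : S.trace / √d ≤ X + √(γ ^ 2 * d) := by
    have h := trace_le_sqrt_mul_frobenius (S - γ • (1 : Matrix (Fin d) (Fin d) ℝ))
    rw [Matrix.trace_sub, Matrix.trace_smul, Matrix.trace_one, Fintype.card_fin, smul_eq_mul,
      ← hX] at h
    rw [div_le_iff₀ (by positivity), Real.sqrt_mul (sq_nonneg γ), Real.sqrt_sq hγ, add_mul,
      mul_assoc, Real.mul_self_sqrt hd0.le]
    linarith
  have h2 : (S.trace / √d) ^ (2 * p) ≤ 2 ^ (2 * p - 1) * (X ^ (2 * p) + (γ ^ 2 * d) ^ p) := by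
    rw [← sqrt_rpow_two_mul (by positivity : 0 ≤ γ ^ 2 * d) p]
    exact (Real.rpow_le_rpow (by positivity) h1 (by linarith)).trans
      (add_rpow_le_two_rpow_mul (frobenius_nonneg _) (Real.sqrt_nonneg _) (by linarith))
  rw [Real.div_rpow hS (Real.sqrt_nonneg _), sqrt_rpow_two_mul hd0.le] at h2
  have h3 : (2 : ℝ) ^ (1 - 2 * p) * 2 ^ (2 * p - 1) = 1 := by
    rw [← Real.rpow_add two_pos]; simp
  have h4 := mul_le_mul_of_nonneg_left h2 (by positivity : 0 ≤ (2 : ℝ) ^ (1 - 2 * p))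
  rw [← mul_assoc, h3, one_mul] at h4
  have h5 : 2 ^ (1 - 2 * p) / (d : ℝ) ^ p * S.trace ^ (2 * p) =
      2 ^ (1 - 2 * p) * (S.trace ^ (2 * p) / (d : ℝ) ^ p) := by ring
  rw [h5]
  linarith

end Coercivity

/-! ### Explicit constants -/

section Numerics

/-- From n to n + 1 the right side grows by a factor of at least n + 1, since (1 + 1/(n+1))^(n+1) ≥
2 by Bernoulli. -/
theorem factorial_le_half_pow (n : ℕ) : (n ! : ℝ) ≤ (((n : ℝ) + 1) / 2) ^ n := by
  induction n with
  | zero => simp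
  | succ n ih =>
    rw [Nat.factorial_succ]
    push_cast
    have hn : (0 : ℝ) < (n : ℝ) + 1 := by positivity
    have hb := one_add_mul_le_pow (a := 1 / ((n : ℝ) + 1)) (by
      have : 0 ≤ 1 / ((n : ℝ) + 1) := by positivity
      linarith) (n + 1)
    have h2 : (2 : ℝ) ≤ (1 + 1 / ((n : ℝ) + 1)) ^ (n + 1) := by
      refine le_trans (le_of_eq ?_) hb
      push_cast
      field_simp
      norm_num
    calc ((n : ℝ) + 1) * (n ! : ℝ) ≤ ((n : ℝ) + 1) * (((n : ℝ) + 1) / 2) ^ n :=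
          mul_le_mul_of_nonneg_left ih hn.le
      _ = 2 * (((n : ℝ) + 1) / 2) ^ (n + 1) := by rw [pow_succ]; ring
      _ ≤ (1 + 1 / ((n : ℝ) + 1)) ^ (n + 1) * (((n : ℝ) + 1) / 2) ^ (n + 1) :=
          mul_le_mul_of_nonneg_right h2 (by positivity)
      _ = (((n : ℝ) + 1 + 1) / 2) ^ (n + 1) := by
          rw [← mul_pow]
          congr 1
          field_simp

/-- The altitude of the reference element, in logarithms. -/
theorem log_reference_altitude {d : ℕ} (hd : 1 ≤ d) {r : ℝ} (hr0 : 0 < r)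
    (hr : r ^ d * (d + 1) = (d ! : ℝ) ^ 2) :
    d * Real.log (r * (d + 1) / d) =
      2 * Real.log (d !) + (d - 1) * Real.log (d + 1) - d * Real.log d := by
  have hd0 : (0 : ℝ) < d := by exact_mod_cast hd
  have hd1 : (0 : ℝ) < (d : ℝ) + 1 := by positivity
  have h := congrArg Real.log hr
  rw [Real.log_mul (by positivity) hd1.ne', Real.log_pow, Real.log_pow] at h
  rw [Real.log_div (by positivity) hd0.ne', Real.log_mul hr0.ne' hd1.ne']
  push_cast at h
  linarith

/-- For d ≥ 2 this rests on d + 1 ≤ d². It serves to show h^(d/2) ≤ d! d^(d/2) for h = r(d+1)/d in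
`element_bounds`. -/
theorem log_dimension_bound {d : ℕ} (hd : 1 ≤ d) :
    ((d : ℝ) - 1) * Real.log (d + 1) ≤ 2 * d * Real.log d := by
  rcases hd.eq_or_lt with rfl | h
  · simp
  have hd2 : (2 : ℝ) ≤ d := by exact_mod_cast h
  have h1 : Real.log (d + 1) ≤ 2 * Real.log d := by
    rw [← Real.log_rpow (by linarith)]
    refine Real.log_le_log (by linarith) ?_
    norm_cast
    nlinarith
  have h2 : 0 ≤ Real.log d := Real.log_nonneg (by linarith)
  have := mul_le_mul_of_nonneg_left h1 (by linarith : (0 : ℝ) ≤ d - 1)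
  linarith

/-- This is the slack that the closed form of C₁ requires. For d ≥ 2 the powers of d and d + 1
suffice and the term in N is dropped; for d = 1 the inequality amounts to log 2 ≤ log N, whence N ≥
2. -/
theorem log_mesh_size_bound {d N : ℕ} (hd : 1 ≤ d) (hN : 1 ≤ N) (hdN : 2 ≤ d ∨ 2 ≤ N) {p : ℝ}
    (hp : 1 < p) (hpd : (d : ℝ) < 4 * p) :
    Real.log (d !) + 6 * p * Real.log 2 ≤ 2 * p * Real.log d +
      (6 * p - 4 * p / d) * Real.log (d + 1) + 4 * p / d * Real.log N := by
  have hn0 : 0 ≤ Real.log N := Real.log_nonneg (by exact_mod_cast hN)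
  by_cases h : 2 ≤ d
  · have hd2 : (2 : ℝ) ≤ d := by exact_mod_cast h
    have hb : Real.log 2 ≤ Real.log d := Real.log_le_log two_pos hd2
    have hc : Real.log 2 ≤ Real.log (d + 1) := Real.log_le_log two_pos (by linarith)
    have hfac : Real.log (d !) ≤ d * (Real.log (d + 1) - Real.log 2) := by
      have := Real.log_le_log (by positivity) (factorial_le_half_pow d)
      rwa [Real.log_pow, Real.log_div (by positivity) two_ne_zero] at this
    have h1 : (d : ℝ) * (Real.log (d + 1) - Real.log 2) ≤
        4 * p * (Real.log (d + 1) - Real.log 2) :=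
      mul_le_mul_of_nonneg_right hpd.le (by linarith)
    have h2 : 4 * p * Real.log (d + 1) ≤ (6 * p - 4 * p / d) * Real.log (d + 1) := by
      refine mul_le_mul_of_nonneg_right ?_ (Real.log_nonneg (by linarith))
      have : 4 * p / d ≤ 2 * p := by
        rw [div_le_iff₀ (by linarith)]; nlinarith
      linarith
    have h3 : 0 ≤ 4 * p / d * Real.log N := by positivity
    have h4 : 2 * p * Real.log 2 ≤ 2 * p * Real.log d :=
      mul_le_mul_of_nonneg_left hb (by linarith)
    linarith
  · obtain rfl : d = 1 := by omega
    have hN2 : 2 ≤ N := by omega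
    have h1 : Real.log 2 ≤ Real.log N := Real.log_le_log two_pos (by exact_mod_cast hN2)
    have h2 := mul_le_mul_of_nonneg_left h1 (by linarith : 0 ≤ 4 * p)
    norm_num
    linarith

/-- The altitude and volume bounds of one element follow from bounds on its volume `V`, the trace
`s` of its element matrix and the determinant `D` of its metric. -/
theorem element_bounds {d N : ℕ} (hd : 1 ≤ d) (hN : 1 ≤ N) (hdN : 2 ≤ d ∨ 2 ≤ N) {p : ℝ}
    (hp : 1 < p) (hpd : (d : ℝ) < 4 * p) {r : ℝ} (hr0 : 0 < r)
    (hr : r ^ d * (d + 1) = (d ! : ℝ) ^ 2) {mbar α B V s D : ℝ} (hmbar : 0 < mbar) (hα : 0 < α)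
    (hV : 0 < V) (hs : 0 < s) (hD : 0 < D) (hDle : D ≤ mbar ^ d)
    (h1 : 1 ≤ V ^ 2 * D * (s / d) ^ d) (h2 : α * (V * s ^ (2 * p)) ≤ B) :
    constC₁ d p α B * mbar ^ (-(d : ℝ) / (2 * (4 * p - d))) *
        (N : ℝ) ^ (-(4 * p) / (d * (4 * p - d))) ≤ √(r * (d + 1) / d / s) ∧
    constC₂ d p α B * mbar ^ (-(d : ℝ) ^ 2 / (2 * (4 * p - d)) - (d : ℝ) / 2) *
        (N : ℝ) ^ (-(4 * p) / (4 * p - d)) ≤ V := by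
  have hd0 : (0 : ℝ) < d := by exact_mod_cast hd
  have hd1 : (0 : ℝ) < (d : ℝ) + 1 := by positivity
  have hN0 : (0 : ℝ) < N := by exact_mod_cast hN
  have hδ : 0 < 4 * p - d := by linarith
  have hB : 0 < B := lt_of_lt_of_le (by positivity) h2
  have hfac : (0 : ℝ) < (d ! : ℝ) := by positivity
  -- In logarithms all estimates become linear, and the proof is an elimination.
  have L1 := Real.log_le_log one_pos h1
  rw [Real.log_one, Real.log_mul (by positivity) (by positivity),
    Real.log_mul (by positivity) hD.ne', Real.log_pow, Real.log_pow,
    Real.log_div hs.ne' hd0.ne'] at L1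
  have L2 := Real.log_le_log (by positivity) h2
  rw [Real.log_mul hα.ne' (by positivity), Real.log_mul hV.ne' (by positivity),
    Real.log_rpow hs] at L2
  have L3 := Real.log_le_log hD hDle
  rw [Real.log_pow] at L3
  have L4 := log_reference_altitude hd hr0 hr
  have L5 := log_dimension_bound hd
  have L6 := log_mesh_size_bound hd hN hdN hp hpd
  have hC₁ : 0 < constC₁ d p α B := by unfold constC₁; positivity
  have LC : (4 * p - d) * Real.log (constC₁ d p α B) =
      6 * p * Real.log 2 + 4 * p / d * Real.log (d !) + Real.log α -
        (4 * p * Real.log d + (4 * p - 2 * p / d) * Real.log (d + 1) + Real.log B) := by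
    rw [constC₁, Real.log_rpow (by positivity), Real.log_div (by positivity) (by positivity),
      Real.log_mul (by positivity) hα.ne', Real.log_mul (by positivity) (by positivity),
      Real.log_mul (by positivity) hB.ne', Real.log_mul (by positivity) (by positivity),
      Real.log_rpow two_pos, Real.log_rpow hfac, Real.log_rpow hd0, Real.log_rpow hd1,
      ← mul_assoc, mul_one_div_cancel hδ.ne', one_mul]
  set h := r * ((d : ℝ) + 1) / d with hh
  have hh0 : 0 < h := by positivity
  set lC := Real.log (constC₁ d p α B)
  set lm := Real.log mbar
  set a := Real.log (d ! : ℝ)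
  set b := Real.log (d : ℝ)
  set c := Real.log ((d : ℝ) + 1)
  set n := Real.log (N : ℝ)
  set lV := Real.log V
  set ls := Real.log s
  set lh := Real.log h
  push_cast at L1
  have hV' : (d : ℝ) / 2 * b - d / 2 * ls - d / 2 * lm ≤ lV := by linarith
  have hh2 : (d : ℝ) / 2 * lh ≤ a + d / 2 * b := by linarith
  have hlh : lh = 2 * a / d + (1 - 1 / d) * c - b := by
    field_simp; linarith
  have hmain : 6 * p * Real.log 2 + 4 * p / d * a - 4 * p * b - (4 * p - 2 * p / d) * c -
      4 * p / d * n ≤ 2 * p * lh - a := by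
    have e1 : 2 * p * lh = 4 * p / d * a + (2 * p - 2 * p / d) * c - 2 * p * b := by
      rw [hlh]; ring
    have e2 : (6 * p - 4 * p / d) * c = (4 * p - 2 * p / d) * c + (2 * p - 2 * p / d) * c := by
      ring
    rw [e1]
    linarith
  -- Inserting `hV'` into α V s^(2p) ≤ B leaves s with the exponent 2p - d/2, positive by 4p > d;
  -- hence the inequality is multiplied by 4p - d.
  have hg : lC + -(d : ℝ) / (2 * (4 * p - d)) * lm + -(4 * p) / (d * (4 * p - d)) * n ≤
      1 / 2 * (lh - ls) := by
    refine le_of_mul_le_mul_left ?_ hδ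
    have e1 : (4 * p - d) * (lC + -(d : ℝ) / (2 * (4 * p - d)) * lm +
        -(4 * p) / (d * (4 * p - d)) * n) =
        (4 * p - d) * lC - d / 2 * lm - 4 * p / d * n := by
      field_simp; ring
    rw [e1, LC]
    have e2 : (4 * p - d) * (1 / 2 * (lh - ls)) =
        2 * p * lh - d / 2 * lh - 2 * p * ls + d / 2 * ls := by ring
    rw [e2]
    linarith
  have hlog1 : Real.log (constC₁ d p α B * mbar ^ (-(d : ℝ) / (2 * (4 * p - d))) *
      (N : ℝ) ^ (-(4 * p) / (d * (4 * p - d)))) =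
      lC + -(d : ℝ) / (2 * (4 * p - d)) * lm + -(4 * p) / (d * (4 * p - d)) * n := by
    rw [Real.log_mul (by positivity) (by positivity), Real.log_mul hC₁.ne' (by positivity),
      Real.log_rpow hmbar, Real.log_rpow hN0]
  constructor
  · rw [← Real.log_le_log_iff (by positivity) (by positivity), hlog1,
      Real.log_sqrt (by positivity), Real.log_div hh0.ne' hs.ne']
    linarith
  · have hC₂ : 0 < constC₂ d p α B := by unfold constC₂; positivity
    rw [← Real.log_le_log_iff (by positivity) hV, Real.log_mul (by positivity) (by positivity),
      Real.log_mul hC₂.ne' (by positivity), Real.log_rpow hmbar, Real.log_rpow hN0, constC₂,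
      Real.log_div (by positivity) hfac.ne', Real.log_pow]
    have e1 : (d : ℝ) * lC - a + (-(d : ℝ) ^ 2 / (2 * (4 * p - d)) - (d : ℝ) / 2) * lm +
        -(4 * p) / (4 * p - d) * n =
        d * (lC + -(d : ℝ) / (2 * (4 * p - d)) * lm + -(4 * p) / (d * (4 * p - d)) * n) - a -
          d / 2 * lm := by
      field_simp
      ring
    refine (le_of_eq e1).trans ?_
    -- The d-th power of the altitude bound yields the volume bound through `hV'` and `hh2`; the
    -- latter costs the factor d!.
    have := mul_le_mul_of_nonneg_left hg hd0.le
    linarith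

/-- The quotient of the constants is (√d mbar)^(2p), so no separate coercivity estimate is needed
for `alphaJ`. -/
theorem alphaJ_le_alphaM {d : ℕ} (hd : 1 ≤ d) {p m mbar : ℝ} (hp : 1 < p) (hm : 0 < m)
    (hmbar : 0 < mbar) (h : 1 ≤ √(d : ℝ) * mbar) : alphaJ d p m mbar ≤ alphaM d p m := by
  have hd0 : (0 : ℝ) < d := by exact_mod_cast hd
  rw [alphaJ, alphaM]
  refine div_le_div_of_nonneg_left (by positivity) (by positivity) ?_
  have h1 : 1 ≤ (√(d : ℝ) * mbar) ^ (2 * p) := Real.one_le_rpow h (by linarith)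
  rw [Real.mul_rpow (by positivity) hmbar.le, sqrt_rpow_two_mul hd0.le] at h1
  have h2 : (d : ℝ) ^ (2 * p) = (d : ℝ) ^ p * (d : ℝ) ^ p := by
    rw [← Real.rpow_add hd0]; congr 1; ring
  rw [h2]
  have h3 : 0 < (d : ℝ) ^ p := by positivity
  nlinarith

end Numerics

/-! ### From the functional to bounds on the elements -/

section MeshBounds

variable {d N Nv : ℕ} {Ω : Set (EuclideanSpace ℝ (Fin d))} {conn : Fin N → Fin (d + 1) → Fin Nv}
  {x : Fin Nv → EuclideanSpace ℝ (Fin d)} {m mbar p : ℝ}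
  {M : EuclideanSpace ℝ (Fin d) → Matrix (Fin d) (Fin d) ℝ}
  {ξ : Fin (d + 1) → EuclideanSpace ℝ (Fin d)} {σ : (Fin Nv → EuclideanSpace ℝ (Fin d)) → ℝ}

theorem IsPolyhedralDomain.volume_closure (hΩ : IsPolyhedralDomain Ω) :
    volume.real (closure Ω) = volume.real Ω := by
  obtain ⟨H, hH, hsub⟩ := hΩ.frontier_subset
  have h0 : volume (frontier Ω) = 0 := by
    refine measure_mono_null hsub ((measure_biUnion_null_iff H.countable_toSet).2 fun h hh => ?_)
    refine Measure.addHaar_affineSubspace _ h fun htop => ?_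
    have := hH h hh
    rw [htop, AffineSubspace.direction_top, finrank_top, finrank_euclideanSpace_fin] at this
    omega
  rw [measureReal_def, measureReal_def]
  congr 1
  refine le_antisymm ?_ (measure_mono subset_closure)
  rw [closure_eq_self_union_frontier]
  exact (measure_union_le _ _).trans (by rw [h0, add_zero])

theorem IsPolyhedralDomain.volume_pos (hΩ : IsPolyhedralDomain Ω) : 0 < volume.real Ω :=
  ENNReal.toReal_pos (hΩ.isOpen.measure_pos _ hΩ.isConnected.nonempty).ne'
    hΩ.isBounded.measure_lt_top.ne

theorem IsNonsingularMesh.sum_vol (hx : IsNonsingularMesh Ω conn x) :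
    ∑ K, vol (elementVertices conn x K) = volume.real (closure Ω) := by
  have h := integral_congr_ae (ae_sum_indicator_of_isNonsingularMesh hx)
  rw [integral_indicator_one isClosed_closure.measurableSet, integral_finsetSum] at h
  · rw [← h]
    exact Finset.sum_congr rfl fun K _ =>
      (integral_indicator_one (isCompact_simplex _).isClosed.measurableSet).symm
  · intro K _
    exact (integrable_indicator_iff (isCompact_simplex _).isClosed.measurableSet).2
      (continuousOn_const.integrableOn_compact (isCompact_simplex _))

theorem IsMetricTensor.mbar_pos (hd : 1 ≤ d) (hM : IsMetricTensor Ω m mbar M) (hm : 0 < m)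
    (hne : Ω.Nonempty) : 0 < mbar := by
  obtain ⟨y, hy⟩ := hne
  have hy := subset_closure hy
  have h := (hM.le_quadForm hy fun _ => 1).trans (hM.quadForm_le hy fun _ => 1)
  have h1 : (0 : ℝ) < (fun _ : Fin d => (1 : ℝ)) ⬝ᵥ fun _ => 1 := by
    simpa [dotProduct] using (Nat.succ_le_iff.1 hd)
  exact hm.trans_le (le_of_mul_le_mul_right h h1)

theorem rpow_half_le_sqrt_det (hM : IsMetricTensor Ω m mbar M) (hm : 0 < m)
    (hx : IsNonsingularMesh Ω conn x) (K : Fin N) :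
    m ^ ((d : ℝ) / 2) ≤ √(averageMetric M (elementVertices conn x K)).det := by
  refine Real.le_sqrt_of_sq_le ?_
  rw [← Real.rpow_natCast, ← Real.rpow_mul hm.le]
  have := pow_le_det_averageMetric hM hm (hx.orient_ne_zero K) (hx.simplex_subset K)
  rw [← Real.rpow_natCast] at this
  convert this using 2
  push_cast
  ring

theorem le_sigma (hM : IsMetricTensor Ω m mbar M) (hm : 0 < m)
    (hx : IsNonsingularMesh Ω conn x) :
    m ^ ((d : ℝ) / 2) * volume.real (closure Ω) ≤ sigma conn M x := by
  rw [← hx.sum_vol, Finset.mul_sum]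
  refine Finset.sum_le_sum fun K _ => ?_
  rw [mul_comm]
  exact mul_le_mul_of_nonneg_left (rpow_half_le_sqrt_det hM hm hx K) measureReal_nonneg

/-- `σ` is bounded below by a positive constant on the nonsingular meshes. -/
theorem exists_lower_bound_sigma (hΩ : IsPolyhedralDomain Ω) (hM : IsMetricTensor Ω m mbar M)
    (hm : 0 < m) (hσ : σ = sigma conn M ∨ ∃ c : ℝ, 0 < c ∧ σ = fun _ => c) :
    ∃ c > 0, ∀ x, IsNonsingularMesh Ω conn x → c ≤ σ x := by
  rcases hσ with rfl | ⟨c, hc, rfl⟩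
  · refine ⟨m ^ ((d : ℝ) / 2) * volume.real (closure Ω), ?_, fun x hx => le_sigma hM hm hx⟩
    have := hΩ.volume_pos
    rw [hΩ.volume_closure]
    positivity
  · exact ⟨c, hc, fun _ _ => le_rfl⟩

theorem energy_nonneg (x : Fin Nv → EuclideanSpace ℝ (Fin d)) : 0 ≤ energy ξ conn M p σ x :=
  Finset.sum_nonneg fun _ _ => mul_nonneg (mul_nonneg measureReal_nonneg (Real.sqrt_nonneg _))
    (Real.rpow_nonneg (frobenius_nonneg _) _)

theorem IsNonsingularMesh.pos_card (hx : IsNonsingularMesh Ω conn x) (hne : Ω.Nonempty) :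
    1 ≤ N := by
  obtain ⟨y, hy⟩ := hne
  have := subset_closure hy
  rw [← hx.covers] at this
  obtain ⟨K, -⟩ := Set.mem_iUnion.1 this
  exact K.pos

/-- A bound on the functional controls each element. -/
theorem alphaM_mul_le (hd : 1 ≤ d) (hΩ : IsPolyhedralDomain Ω) (hm : 0 < m)
    (hM : IsMetricTensor Ω m mbar M) (hp : 1 < p) (hξ : IsReferenceElement ξ)
    (hx : IsNonsingularMesh Ω conn x) (hσ : 0 ≤ σ x) (K : Fin N) :
    alphaM d p m * (vol (elementVertices conn x K) *
      (elementMatrix ξ (elementVertices conn x K)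
        (averageMetric M (elementVertices conn x K))).trace ^ (2 * p)) ≤
      betaC d p m (gammaH d N (σ x)) * volume.real Ω + energy ξ conn M p σ x := by
  obtain ⟨r, -, -, hξ0, -⟩ := hξ.exists_gram
  set y := elementVertices conn x with hy
  set s : Fin N → ℝ := fun K => (elementMatrix ξ (y K) (averageMetric M (y K))).trace with hs
  have hγ : 0 ≤ gammaH d N (σ x) := Real.rpow_nonneg (by positivity) _
  have hs0 : ∀ K, 0 ≤ s K := fun K => (posSemidef_elementMatrix hξ0
    (posDef_averageMetric hM hm (hx.orient_ne_zero K) (hx.simplex_subset K)).posSemidef).trace_nonneg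
  have hv0 : ∀ K, 0 ≤ vol (y K) := fun K => measureReal_nonneg
  have hα0 : 0 ≤ alphaM d p m := by unfold alphaM; positivity
  have hterm : ∀ K, alphaM d p m * (vol (y K) * s K ^ (2 * p)) -
      vol (y K) * betaC d p m (gammaH d N (σ x)) ≤
      vol (y K) * √(averageMetric M (y K)).det *
        frobenius (elementMatrix ξ (y K) (averageMetric M (y K)) -
          gammaH d N (σ x) • (1 : Matrix (Fin d) (Fin d) ℝ)) ^ (2 * p) := by
    intro K
    have h1 := coercivity hd hp (hs0 K) hγ
    set X := frobenius (elementMatrix ξ (y K) (averageMetric M (y K)) -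
      gammaH d N (σ x) • (1 : Matrix (Fin d) (Fin d) ℝ)) ^ (2 * p) with hX
    have hX0 : 0 ≤ X := Real.rpow_nonneg (frobenius_nonneg _) _
    have h2 := mul_le_mul_of_nonneg_left h1 (by positivity : 0 ≤ m ^ ((d : ℝ) / 2))
    have h3 := mul_le_mul_of_nonneg_right (rpow_half_le_sqrt_det hM hm hx K) hX0
    have h4 := mul_le_mul_of_nonneg_left (h2.trans h3) (hv0 K)
    refine le_trans (le_of_eq ?_) (h4.trans (le_of_eq ?_))
    · rw [alphaM, betaC]; ring
    · rw [mul_assoc]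
  -- The negative terms share the factor β, and the volumes add up to |Ω|.
  have hsum := Finset.sum_le_sum fun K (_ : K ∈ Finset.univ) => hterm K
  rw [Finset.sum_sub_distrib, ← Finset.sum_mul, hx.sum_vol, hΩ.volume_closure] at hsum
  have henergy : ∑ K, vol (y K) * √(averageMetric M (y K)).det *
        frobenius (elementMatrix ξ (y K) (averageMetric M (y K)) -
          gammaH d N (σ x) • (1 : Matrix (Fin d) (Fin d) ℝ)) ^ (2 * p) =
      energy ξ conn M p σ x := rfl
  rw [henergy] at hsum
  have hsingle : alphaM d p m * (vol (y K) * s K ^ (2 * p)) ≤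
      ∑ K, alphaM d p m * (vol (y K) * s K ^ (2 * p)) :=
    Finset.single_le_sum (f := fun K => alphaM d p m * (vol (y K) * s K ^ (2 * p)))
      (fun K _ => mul_nonneg hα0 (mul_nonneg (hv0 K) (Real.rpow_nonneg (hs0 K) _)))
      (Finset.mem_univ K)
  linarith

/-- Bounds on the altitudes and volumes of the elements of a mesh with bounded functional. -/
theorem satisfiesBounds (hd : 1 ≤ d) (hdN : 2 ≤ d ∨ 2 ≤ N) (hΩ : IsPolyhedralDomain Ω)
    (hm : 0 < m) (hM : IsMetricTensor Ω m mbar M) (hp : 1 < p) (hpd : (d : ℝ) < 4 * p)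
    (hξ : IsReferenceElement ξ) (hx : IsNonsingularMesh Ω conn x) (hσ : 0 ≤ σ x) {α B : ℝ}
    (hα : 0 < α) (hαM : α ≤ alphaM d p m)
    (hB : betaC d p m (gammaH d N (σ x)) * volume.real Ω + energy ξ conn M p σ x ≤ B) :
    SatisfiesBounds conn M p mbar α B x := by
  intro K
  obtain ⟨r, hr0, hr, hξ0, hgram⟩ := hξ.exists_gram
  have hy := hx.orient_ne_zero K
  have hsub := hx.simplex_subset K
  have hA := posDef_averageMetric hM hm hy hsub
  obtain ⟨hs, halt⟩ := le_minAltitude hd hξ0 hr0 hgram hy hA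
  have h1 := one_le_vol_sq_mul hξ0 hξ.2 hy hA
  have h2 := (alphaM_mul_le hd hΩ hm hM hp hξ hx hσ K).trans hB
  have hV := vol_pos hy
  obtain ⟨hb1, hb2⟩ := element_bounds hd (hx.pos_card hΩ.isConnected.nonempty) hdN hp hpd hr0 hr
    (hM.mbar_pos hd hm hΩ.isConnected.nonempty) hα hV hs hA.det_pos
    (det_averageMetric_le_pow hM hm hy hsub) h1
    ((mul_le_mul_of_nonneg_right hαM (by positivity)).trans h2)
  exact ⟨hb1.trans halt, hb2⟩

/-- The elements of the meshes with bounded functional are uniformly nondegenerate. -/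
theorem exists_lower_bound_orient (hd : 1 ≤ d) (hdN : 2 ≤ d ∨ 2 ≤ N) (hΩ : IsPolyhedralDomain Ω)
    (hm : 0 < m) (hM : IsMetricTensor Ω m mbar M) (hp : 1 < p) (hpd : (d : ℝ) < 4 * p)
    (hξ : IsReferenceElement ξ) (hσ : σ = sigma conn M ∨ ∃ c : ℝ, 0 < c ∧ σ = fun _ => c)
    (hN : 1 ≤ N) (E₀ : ℝ) :
    ∃ c > 0, ∀ x, IsNonsingularMesh Ω conn x → energy ξ conn M p σ x ≤ E₀ →
      ∀ K, c ≤ |orient (elementVertices conn x K)| := by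
  obtain ⟨c, hc, hσc⟩ := exists_lower_bound_sigma hΩ hM hm hσ
  have hmbar := hM.mbar_pos hd hm hΩ.isConnected.nonempty
  have hd0 : (0 : ℝ) < d := by exact_mod_cast hd
  have hN0 : (0 : ℝ) < N := by exact_mod_cast hN
  have hvol := hΩ.volume_pos
  have hγ0 : 0 < gammaH d N c := by unfold gammaH; positivity
  have hβ0 : 0 < betaC d p m (gammaH d N c) := by unfold betaC; positivity
  -- γ decreases in σ, so its value at the lower bound `c` of σ serves all meshes; `|E₀|` keeps B
  -- positive whatever the sign of `E₀`.
  set B := betaC d p m (gammaH d N c) * volume.real Ω + |E₀| with hB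
  have hB0 : 0 < B := by positivity
  have hα0 : 0 < alphaM d p m := by unfold alphaM; positivity
  set v := constC₂ d p (alphaM d p m) B *
    mbar ^ (-(d : ℝ) ^ 2 / (2 * (4 * p - d)) - (d : ℝ) / 2) * (N : ℝ) ^ (-(4 * p) / (4 * p - d))
  have hv : 0 < v := by
    have : 0 < constC₂ d p (alphaM d p m) B := by unfold constC₂ constC₁; positivity
    positivity
  refine ⟨v * d !, by positivity, fun x hx hE K => ?_⟩
  have hσ0 := hc.trans_le (hσc x hx)
  have hγ : gammaH d N (σ x) ≤ gammaH d N c := by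
    unfold gammaH
    refine Real.rpow_le_rpow_of_nonpos (by positivity)
      (div_le_div_of_nonneg_right (hσc x hx) hN0.le) ?_
    rw [neg_div]
    exact neg_nonpos.2 (by positivity)
  have hγx : 0 ≤ gammaH d N (σ x) := Real.rpow_nonneg (by positivity) _
  have hβ : betaC d p m (gammaH d N (σ x)) ≤ betaC d p m (gammaH d N c) := by
    unfold betaC
    have : gammaH d N (σ x) ^ 2 ≤ gammaH d N c ^ 2 := pow_le_pow_left₀ hγx hγ 2
    gcongr
  have hb := satisfiesBounds hd hdN hΩ hm hM hp hpd hξ hx hσ0.le hα0 le_rfl (B := B) (by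
    have := mul_le_mul_of_nonneg_right hβ hvol.le
    have := le_abs_self E₀
    linarith) K
  have h2 := hb.2
  rw [vol_eq (hx.orient_ne_zero K), le_div_iff₀ (by positivity)] at h2
  exact h2

end MeshBounds

/-! ### Differentiation under the integral -/

section ParametricIntegral

variable {d : ℕ}

/-- The integral of a `C¹` function over a simplex, pulled back to the standard simplex, is `C¹` in
the vertices. -/
theorem contDiffAt_integral_elementMap {g : EuclideanSpace ℝ (Fin d) → ℝ}
    {y₀ : Fin (d + 1) → EuclideanSpace ℝ (Fin d)}
    (hg : ∀ z ∈ simplex y₀, ContDiffAt ℝ 1 g z) :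
    ContDiffAt ℝ 1 (fun y => ∫ s in stdElement d, g (elementMap s y)) y₀ := by
  set T := stdElement d with hT
  have hTc : IsCompact T := isCompact_stdElement d
  have hTm : MeasurableSet T := (isClosed_stdElement d).measurableSet
  set U : Set (EuclideanSpace ℝ (Fin d)) := {z | ContDiffAt ℝ 1 g z} with hU
  have hUo : IsOpen U := isOpen_iff_eventually.2 fun z (hz : ContDiffAt ℝ 1 g z) =>
    hz.eventually (by simp)
  have hev : Continuous fun q : (Fin (d + 1) → EuclideanSpace ℝ (Fin d)) ×
      EuclideanSpace ℝ (Fin d) => elementMap q.2 q.1 :=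
    (continuous_elementMap.comp continuous_snd).clm_apply continuous_fst
  -- A tube argument: `T` is compact and `U` open, so one neighbourhood of `y₀` works for all s.
  have hW : ∀ᶠ y in 𝓝 y₀, ∀ s ∈ T, elementMap s y ∈ U :=
    hTc.eventually_forall_of_forall_eventually fun s hs =>
      hev.continuousAt.eventually_mem (hUo.mem_nhds (hg _ (elementMap_mem_simplex hs y₀)))
  obtain ⟨ε, hε, hball⟩ := Metric.nhds_basis_closedBall.mem_iff.1 hW
  set F' : (Fin (d + 1) → EuclideanSpace ℝ (Fin d)) → EuclideanSpace ℝ (Fin d) →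
      (Fin (d + 1) → EuclideanSpace ℝ (Fin d)) →L[ℝ] ℝ :=
    fun y s => (fderiv ℝ g (elementMap s y)).comp (elementMap s) with hF'
  have hgd : ∀ z ∈ U, DifferentiableAt ℝ g z := fun z (hz : ContDiffAt ℝ 1 g z) =>
    hz.differentiableAt one_ne_zero
  have hgc : ∀ z ∈ U, ContinuousAt (fderiv ℝ g) z := fun z (hz : ContDiffAt ℝ 1 g z) =>
    (hz.fderiv_right (m := 0) (by simp)).continuousAt
  have hFc : ContinuousOn (fun q : (Fin (d + 1) → EuclideanSpace ℝ (Fin d)) ×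
      EuclideanSpace ℝ (Fin d) => F' q.1 q.2) (Metric.closedBall y₀ ε ×ˢ T) := by
    intro q hq
    refine ContinuousAt.continuousWithinAt ?_
    refine ContinuousAt.clm_comp ?_ (continuous_elementMap.comp continuous_snd).continuousAt
    exact ContinuousAt.comp (f := fun q : (Fin (d + 1) → EuclideanSpace ℝ (Fin d)) ×
      EuclideanSpace ℝ (Fin d) => elementMap q.2 q.1) (hgc _ (hball hq.1 q.2 hq.2))
      hev.continuousAt
  -- A constant on the set `T` of finite volume dominates, both for the derivative and for its
  -- continuity.
  obtain ⟨C, hC⟩ := ((isCompact_closedBall y₀ ε).prod hTc).exists_bound_of_continuousOn hFc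
  have hslice : ∀ y ∈ Metric.closedBall y₀ ε, ContinuousOn (F' y) T := fun y hy =>
    hFc.comp (f := fun s => (y, s)) (by fun_prop) fun s hs => ⟨hy, hs⟩
  have hgslice : ∀ y ∈ Metric.closedBall y₀ ε, ContinuousOn (fun s => g (elementMap s y)) T := by
    intro y hy s hs
    refine ContinuousAt.continuousWithinAt ?_
    exact ContinuousAt.comp (f := fun s => elementMap s y) (hgd _ (hball hy s hs)).continuousAt
      (continuous_elementMap.clm_apply continuous_const).continuousAt
  have hCint : Integrable (fun _ => C) (volume.restrict T) :=
    continuousOn_const.integrableOn_compact hTc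
  rw [contDiffAt_one_iff]
  refine ⟨fun y => ∫ s in T, F' y s, Metric.ball y₀ ε, Metric.ball_mem_nhds _ hε, ?_, ?_⟩
  · intro y hy
    refine ContinuousAt.continuousWithinAt ?_
    have hny : Metric.ball y₀ ε ∈ 𝓝 y := Metric.isOpen_ball.mem_nhds hy
    refine continuousAt_of_dominated (bound := fun _ => C) ?_ ?_ hCint ?_
    · filter_upwards [hny] with y' hy'
      exact (hslice y' (Metric.ball_subset_closedBall hy')).aestronglyMeasurable hTm
    · filter_upwards [hny] with y' hy'
      exact (ae_restrict_iff' hTm).2 (Eventually.of_forall fun s hs =>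
        hC (y', s) ⟨Metric.ball_subset_closedBall hy', hs⟩)
    · refine (ae_restrict_iff' hTm).2 (Eventually.of_forall fun s hs => ?_)
      refine ContinuousAt.clm_comp ?_ continuousAt_const
      exact ContinuousAt.comp (f := fun y => elementMap s y)
        (hgc _ (hball (Metric.ball_subset_closedBall hy) s hs)) (elementMap s).continuous.continuousAt
  · intro y hy
    have hny : Metric.ball y₀ ε ∈ 𝓝 y := Metric.isOpen_ball.mem_nhds hy
    refine hasFDerivAt_integral_of_dominated_of_fderiv_le (F' := F') (bound := fun _ => C) hny
      ?_ ?_ ?_ ?_ hCint ?_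
    · filter_upwards [hny] with y' hy'
      exact (hgslice y' (Metric.ball_subset_closedBall hy')).aestronglyMeasurable hTm
    · exact (hgslice y (Metric.ball_subset_closedBall hy)).integrableOn_compact hTc
    · exact (hslice y (Metric.ball_subset_closedBall hy)).aestronglyMeasurable hTm
    · exact (ae_restrict_iff' hTm).2 (Eventually.of_forall fun s hs y' hy' =>
        hC (y', s) ⟨Metric.ball_subset_closedBall hy', hs⟩)
    · refine (ae_restrict_iff' hTm).2 (Eventually.of_forall fun s hs y' hy' => ?_)
      exact (hgd _ (hball (Metric.ball_subset_closedBall hy') s hs)).hasFDerivAt.comp y'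
        (elementMap s).hasFDerivAt

end ParametricIntegral

/-! ### Differentiability of matrix operations -/

section MatrixCalculus

variable {E : Type*} [NormedAddCommGroup E] [NormedSpace ℝ E] {n : Type*} [Fintype n]
  {F G : E → Matrix n n ℝ} {z : E}

theorem contDiffAt_det [DecidableEq n] (hF : ∀ a b, ContDiffAt ℝ 1 (fun w => F w a b) z) :
    ContDiffAt ℝ 1 (fun w => (F w).det) z := by
  simp only [Matrix.det_apply']
  exact ContDiffAt.sum fun π _ => contDiffAt_const.mul (contDiffAt_prod fun i _ => hF _ _)

theorem contDiffAt_matrix_mul (hF : ∀ a b, ContDiffAt ℝ 1 (fun w => F w a b) z)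
    (hG : ∀ a b, ContDiffAt ℝ 1 (fun w => G w a b) z) (a b : n) :
    ContDiffAt ℝ 1 (fun w => (F w * G w) a b) z := by
  simp only [Matrix.mul_apply]
  exact ContDiffAt.sum fun c _ => (hF a c).mul (hG c b)

theorem contDiffAt_matrix_inv [DecidableEq n] (hF : ∀ a b, ContDiffAt ℝ 1 (fun w => F w a b) z)
    (h0 : (F z).det ≠ 0) (a b : n) : ContDiffAt ℝ 1 (fun w => (F w)⁻¹ a b) z := by
  simp only [Matrix.inv_def, Ring.inverse_eq_inv', Matrix.smul_apply, smul_eq_mul,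
    Matrix.adjugate_apply]
  refine ((contDiffAt_det hF).inv h0).mul (contDiffAt_det fun c e => ?_)
  by_cases hc : c = b
  · subst hc
    simpa using contDiffAt_const
  · simpa [hc] using hF c e

end MatrixCalculus

/-! ### The functional is C¹ at nonsingular meshes -/

section Energy

variable {d N Nv : ℕ} {Ω : Set (EuclideanSpace ℝ (Fin d))} {conn : Fin N → Fin (d + 1) → Fin Nv}
  {x : Fin Nv → EuclideanSpace ℝ (Fin d)} {m mbar p : ℝ}
  {M : EuclideanSpace ℝ (Fin d) → Matrix (Fin d) (Fin d) ℝ}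
  {ξ : Fin (d + 1) → EuclideanSpace ℝ (Fin d)} {σ : (Fin Nv → EuclideanSpace ℝ (Fin d)) → ℝ}

theorem contDiffAt_edgeMatrix (x : Fin Nv → EuclideanSpace ℝ (Fin d)) (K : Fin N) (a b : Fin d) :
    ContDiffAt ℝ 1 (fun z => edgeMatrix (elementVertices conn z K) a b) x := by
  simp only [edgeMatrix, Matrix.of_apply, elementVertices]
  fun_prop

theorem contDiffAt_orient (x : Fin Nv → EuclideanSpace ℝ (Fin d)) (K : Fin N) :
    ContDiffAt ℝ 1 (fun z => orient (elementVertices conn z K)) x := by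
  simp only [orient_eq_det_edgeMatrix]
  exact contDiffAt_det fun a b => contDiffAt_edgeMatrix x K a b

theorem continuous_elementVertices (K : Fin N) : Continuous fun
    z : Fin Nv → EuclideanSpace ℝ (Fin d) => elementVertices conn z K :=
  continuous_pi fun _ => continuous_apply _

theorem eventually_orient_ne_zero (hx : IsNonsingularMesh Ω conn x) (K : Fin N) :
    ∀ᶠ z in 𝓝 x, orient (elementVertices conn z K) ≠ 0 :=
  (continuous_orient.comp (continuous_elementVertices K)).continuousAt.eventually_ne
    (hx.orient_ne_zero K)

theorem contDiffAt_vol (hx : IsNonsingularMesh Ω conn x) (K : Fin N) :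
    ContDiffAt ℝ 1 (fun z => vol (elementVertices conn z K)) x := by
  refine (((contDiffAt_orient x K).abs (hx.orient_ne_zero K)).div_const
    (d ! : ℝ)).congr_of_eventuallyEq ?_
  filter_upwards [eventually_orient_ne_zero hx K] with z hz
  exact vol_eq hz

theorem contDiffAt_averageMetric (hM : IsMetricTensor Ω m mbar M)
    (hx : IsNonsingularMesh Ω conn x) (K : Fin N) (a b : Fin d) :
    ContDiffAt ℝ 1 (fun z => averageMetric M (elementVertices conn z K) a b) x := by
  have h1 : ContDiffAt ℝ 1 (fun y => ∫ s in stdElement d, M (elementMap s y) a b)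
      (elementVertices conn x K) :=
    contDiffAt_integral_elementMap (g := fun z => M z a b)
      fun z hz => hM.smooth z (hx.simplex_subset K hz) a b
  have h2 : ContDiffAt ℝ 1 (fun z => elementVertices conn z K) x := by
    unfold elementVertices
    fun_prop
  refine (contDiffAt_const (c := (d ! : ℝ)).mul (h1.comp x h2)).congr_of_eventuallyEq ?_
  filter_upwards [eventually_orient_ne_zero hx K] with z hz
  exact averageMetric_eq M hz a b

theorem IsNonsingularMesh.det_averageMetric_pos (hx : IsNonsingularMesh Ω conn x)
    (hM : IsMetricTensor Ω m mbar M) (hm : 0 < m) (K : Fin N) :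
    0 < (averageMetric M (elementVertices conn x K)).det :=
  (posDef_averageMetric hM hm (hx.orient_ne_zero K) (hx.simplex_subset K)).det_pos

theorem contDiffAt_volume_weight (hM : IsMetricTensor Ω m mbar M) (hm : 0 < m)
    (hx : IsNonsingularMesh Ω conn x) (K : Fin N) :
    ContDiffAt ℝ 1 (fun z => vol (elementVertices conn z K) *
      √(averageMetric M (elementVertices conn z K)).det) x :=
  (contDiffAt_vol hx K).mul ((contDiffAt_det fun a b => contDiffAt_averageMetric hM hx K a b).sqrt
    (hx.det_averageMetric_pos hM hm K).ne')

theorem contDiffAt_gammaH (hΩ : IsPolyhedralDomain Ω) (hM : IsMetricTensor Ω m mbar M)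
    (hm : 0 < m) (hx : IsNonsingularMesh Ω conn x)
    (hσ : σ = sigma conn M ∨ ∃ c : ℝ, 0 < c ∧ σ = fun _ => c) :
    ContDiffAt ℝ 1 (fun z => gammaH d N (σ z)) x := by
  have hN : (0 : ℝ) < N := by exact_mod_cast hx.pos_card hΩ.isConnected.nonempty
  obtain ⟨c, hc, hσc⟩ := exists_lower_bound_sigma hΩ hM hm hσ
  have hpos := hc.trans_le (hσc x hx)
  have h1 : ContDiffAt ℝ 1 σ x := by
    rcases hσ with rfl | ⟨c, _, rfl⟩
    · exact ContDiffAt.sum fun K _ => contDiffAt_volume_weight hM hm hx K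
    · exact contDiffAt_const
  exact (h1.div_const _).rpow_const_of_ne (by positivity)

theorem contDiffAt_elementMatrix (hM : IsMetricTensor Ω m mbar M) (hm : 0 < m)
    (hξ : orient ξ ≠ 0) (hx : IsNonsingularMesh Ω conn x) (K : Fin N) (a b : Fin d) :
    ContDiffAt ℝ 1 (fun z => elementMatrix ξ (elementVertices conn z K)
      (averageMetric M (elementVertices conn z K)) a b) x := by
  have hJ : ∀ a b, ContDiffAt ℝ 1 (fun z => jacobian ξ (elementVertices conn z K) a b) x :=
    contDiffAt_matrix_mul (contDiffAt_edgeMatrix x K) (fun _ _ => contDiffAt_const)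
  have hJ0 : (jacobian ξ (elementVertices conn x K)).det ≠ 0 := by
    rw [jacobian, Matrix.det_mul, Matrix.det_nonsing_inv, Ring.inverse_eq_inv',
      ← orient_eq_det_edgeMatrix, ← orient_eq_det_edgeMatrix]
    exact mul_ne_zero (hx.orient_ne_zero K) (inv_ne_zero hξ)
  have hJi := contDiffAt_matrix_inv hJ hJ0
  have hAi := contDiffAt_matrix_inv (contDiffAt_averageMetric hM hx K)
    (hx.det_averageMetric_pos hM hm K).ne'
  exact contDiffAt_matrix_mul (contDiffAt_matrix_mul hJi hAi) (fun a b => hJi b a) a b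

/-- The meshing functional is continuously differentiable at nonsingular meshes. -/
theorem contDiffAt_energy (hΩ : IsPolyhedralDomain Ω) (hM : IsMetricTensor Ω m mbar M)
    (hm : 0 < m) (hp : 1 < p) (hξ : IsReferenceElement ξ) (hx : IsNonsingularMesh Ω conn x)
    (hσ : σ = sigma conn M ∨ ∃ c : ℝ, 0 < c ∧ σ = fun _ => c) :
    ContDiffAt ℝ 1 (energy ξ conn M p σ) x := by
  obtain ⟨r, -, -, hξ0, -⟩ := hξ.exists_gram
  unfold energy
  refine ContDiffAt.sum fun K _ => (contDiffAt_volume_weight hM hm hx K).mul ?_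
  -- The p-th power of the sum of squares avoids the square root, which is not smooth at 0; since p
  -- > 1, there is no loss of differentiability at elements where S = γI.
  have hfrob : ∀ A : Matrix (Fin d) (Fin d) ℝ,
      frobenius A ^ (2 * p) = (∑ a, ∑ b, A a b ^ 2) ^ p := fun A =>
    sqrt_rpow_two_mul (by positivity) p
  simp only [hfrob]
  refine ContDiffAt.rpow_const_of_le (m := 1) ?_ (by exact_mod_cast hp.le)
  refine ContDiffAt.sum fun a _ => ContDiffAt.sum fun b _ => ContDiffAt.pow ?_ 2
  simp only [Matrix.sub_apply, Matrix.smul_apply, smul_eq_mul]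
  exact (contDiffAt_elementMatrix hM hm hξ0 hx K a b).sub
    ((contDiffAt_gammaH hΩ hM hm hx hσ).mul contDiffAt_const)

end Energy

/-! ### Partial gradients and dissipation -/

section Gradient

variable {d Nv : ℕ} {V : Fin Nv → Submodule ℝ (EuclideanSpace ℝ (Fin d))}
  {I : (Fin Nv → EuclideanSpace ℝ (Fin d)) → ℝ} {y : Fin Nv → EuclideanSpace ℝ (Fin d)}

theorem gradient_update (h : DifferentiableAt ℝ I y) (i : Fin Nv) :
    gradient (fun z => I (Function.update y i z)) (y i) =
      (InnerProductSpace.toDual ℝ (EuclideanSpace ℝ (Fin d))).symm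
        ((fderiv ℝ I y).comp (ContinuousLinearMap.single ℝ
          (fun _ : Fin Nv => EuclideanSpace ℝ (Fin d)) i)) := by
  have h1 : HasFDerivAt I (fderiv ℝ I y) (Function.update y i (y i)) := by
    simpa using h.hasFDerivAt
  have h2 := h1.comp (y i) (hasFDerivAt_update (𝕜 := ℝ) y (y i))
  rw [gradient, show (fun z => I (Function.update y i z)) = I ∘ Function.update y i from rfl,
    h2.fderiv]
  congr 2
  ext w j k
  by_cases hj : j = i
  · subst hj
    simp
  · simp [hj]

theorem sum_inner_gradient_update (h : DifferentiableAt ℝ I y)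
    (v : Fin Nv → EuclideanSpace ℝ (Fin d)) :
    ∑ i, inner ℝ (gradient (fun z => I (Function.update y i z)) (y i)) (v i) =
      fderiv ℝ I y v := by
  simp only [gradient_update h, InnerProductSpace.toDual_symm_apply,
    ContinuousLinearMap.comp_apply, ContinuousLinearMap.single_apply]
  rw [← map_sum, Finset.univ_sum_single]

theorem continuousAt_admissibleGradient (h : ContDiffAt ℝ 1 I y) (i : Fin Nv) :
    ContinuousAt (fun z => admissibleGradient V I z i) y := by
  have h1 : ∀ᶠ z in 𝓝 y, ContDiffAt ℝ 1 I z := h.eventually (by simp)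
  have h2 : ContinuousAt (fderiv ℝ I) y := (h.fderiv_right (m := 0) (by simp)).continuousAt
  have h3 : ContinuousAt (fun z => (V i).starProjection
      ((InnerProductSpace.toDual ℝ (EuclideanSpace ℝ (Fin d))).symm
        ((fderiv ℝ I z).comp (ContinuousLinearMap.single ℝ
          (fun _ : Fin Nv => EuclideanSpace ℝ (Fin d)) i)))) y := by
    refine (V i).starProjection.continuous.continuousAt.comp ?_
    refine (LinearIsometryEquiv.continuous _).continuousAt.comp ?_
    exact h2.clm_comp continuousAt_const
  refine h3.congr ?_
  filter_upwards [h1] with z hz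
  rw [admissibleGradient, gradient_update (hz.differentiableAt one_ne_zero)]

/-- The rate at which the moving mesh equation dissipates the functional `I`. -/
def dissipation (V : Fin Nv → Submodule ℝ (EuclideanSpace ℝ (Fin d)))
    (I : (Fin Nv → EuclideanSpace ℝ (Fin d)) → ℝ) (τ : ℝ)
    (P : Fin Nv → (Fin Nv → EuclideanSpace ℝ (Fin d)) → ℝ)
    (y : Fin Nv → EuclideanSpace ℝ (Fin d)) : ℝ :=
  ∑ i, P i y / τ * ‖admissibleGradient V I y i‖ ^ 2

end Gradient

/-! ### Energy identity and vanishing dissipation -/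

section Trajectory

variable {d Nv : ℕ} {V : Fin Nv → Submodule ℝ (EuclideanSpace ℝ (Fin d))}
  {I : (Fin Nv → EuclideanSpace ℝ (Fin d)) → ℝ} {τ : ℝ}
  {P : Fin Nv → (Fin Nv → EuclideanSpace ℝ (Fin d)) → ℝ}
  {x : ℝ → Fin Nv → EuclideanSpace ℝ (Fin d)}

theorem dissipation_nonneg {y : Fin Nv → EuclideanSpace ℝ (Fin d)} (hτ : 0 < τ)
    (hP : ∀ i, 0 < P i y) : 0 ≤ dissipation V I τ P y :=
  Finset.sum_nonneg fun i _ => mul_nonneg (div_pos (hP i) hτ).le (sq_nonneg _)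

theorem admissibleGradient_eq_zero_of_dissipation {y : Fin Nv → EuclideanSpace ℝ (Fin d)}
    (hτ : 0 < τ) (hP : ∀ i, 0 < P i y) (h : dissipation V I τ P y = 0) (i : Fin Nv) :
    admissibleGradient V I y i = 0 := by
  have h1 := (Finset.sum_eq_zero_iff_of_nonneg fun i _ =>
    mul_nonneg (div_pos (hP i) hτ).le (sq_nonneg _)).1 h i (Finset.mem_univ i)
  simpa [(hP i).ne', hτ.ne'] using h1

/-- Vertices are displaced in admissible directions only. -/
theorem IsMMPDETrajectory.sub_mem (hx : IsMMPDETrajectory V I τ P x) {t : ℝ} (ht : 0 ≤ t)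
    (i : Fin Nv) : x t i - x 0 i ∈ V i := by
  rcases ht.eq_or_lt with rfl | ht
  · simp
  -- Tested against `w` orthogonal to `V i`, the velocity vanishes at positive times; the mean value
  -- theorem needs only continuity at time 0.
  rw [← (V i).orthogonal_orthogonal, Submodule.mem_orthogonal]
  intro w hw
  have hc : ContinuousOn (fun s => inner ℝ w (x s i)) (Set.Icc 0 t) :=
    continuousOn_const.inner ((continuous_apply i).comp_continuousOn
      (hx.continuousOn.mono Set.Icc_subset_Ici_self))
  obtain ⟨c, -, h⟩ := exists_hasDerivAt_eq_slope (fun s => inner ℝ w (x s i)) (fun _ => 0) ht hc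
    fun s hs => by
      have h1 := (innerSL ℝ w).hasFDerivAt.comp_hasDerivAt s (hx.equation s hs.1 i)
      have h2 : inner ℝ w (admissibleGradient V I (x s) i) = 0 :=
        (Submodule.mem_orthogonal' _ _).1 hw _ ((V i).starProjection_apply_mem _)
      have h3 : (innerSL ℝ w) (-(P i (x s) / τ) • admissibleGradient V I (x s) i) = 0 := by
        rw [innerSL_apply_apply, inner_smul_right, h2, mul_zero]
      rwa [h3] at h1
  rw [inner_sub_right]
  have := ht.ne'
  field_simp at h
  linarith

theorem IsMMPDETrajectory.hasDerivAt (hx : IsMMPDETrajectory V I τ P x) {t : ℝ} (ht : 0 < t) :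
    HasDerivAt x (fun i => -(P i (x t) / τ) • admissibleGradient V I (x t) i) t :=
  hasDerivAt_pi.2 (hx.equation t ht)

/-- The chain rule pairs each partial gradient with its projection; as the projection is
self-adjoint and idempotent, this gives the squared norm of the projected gradient. -/
theorem IsMMPDETrajectory.hasDerivAt_comp (hx : IsMMPDETrajectory V I τ P x) {t : ℝ} (ht : 0 < t)
    (hI : DifferentiableAt ℝ I (x t)) :
    HasDerivAt (fun s => I (x s)) (-dissipation V I τ P (x t)) t := by
  have h := hI.hasFDerivAt.comp_hasDerivAt t (hx.hasDerivAt ht)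
  refine h.congr_deriv ?_
  rw [← sum_inner_gradient_update hI, dissipation, ← Finset.sum_neg_distrib]
  refine Finset.sum_congr rfl fun i _ => ?_
  have h1 : inner ℝ (gradient (fun z => I (Function.update (x t) i z)) (x t i))
      (admissibleGradient V I (x t) i) = ‖admissibleGradient V I (x t) i‖ ^ 2 := by
    rw [← real_inner_self_eq_norm_sq]
    unfold admissibleGradient
    rw [Submodule.inner_starProjection_left_eq_right,
      Submodule.starProjection_eq_self_iff.2 ((V i).starProjection_apply_mem _)]
  rw [inner_smul_right, h1]
  ring

theorem IsMMPDETrajectory.antitoneOn (hx : IsMMPDETrajectory V I τ P x) {S : Set ℝ}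
    (hS : Convex ℝ S) (hS0 : S ⊆ Set.Ici 0) (hI : ∀ t ∈ S, DifferentiableAt ℝ I (x t))
    (hD : ∀ t ∈ S, 0 ≤ dissipation V I τ P (x t)) : AntitoneOn (fun t => I (x t)) S := by
  have hint : ∀ t ∈ interior S, 0 < t := fun t ht => by
    simpa using interior_mono hS0 ht
  have hder : ∀ t ∈ interior S, HasDerivAt (fun s => I (x s)) (-dissipation V I τ P (x t)) t :=
    fun t ht => hx.hasDerivAt_comp (hint t ht) (hI t (interior_subset ht))
  refine antitoneOn_of_deriv_nonpos hS ?_ ?_ ?_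
  · exact fun t ht => (hI t ht).continuousAt.comp_continuousWithinAt
      ((hx.continuousOn t (hS0 ht)).mono hS0)
  · exact fun t ht => (hder t ht).differentiableAt.differentiableWithinAt
  · exact fun t ht => by
      rw [(hder t ht).deriv]
      exact neg_nonpos.2 (hD t (interior_subset ht))

/-- If the trajectory stays in a compact set on which the velocity and the dissipation are
continuous and the values of the functional converge, the dissipation vanishes at limit meshes. -/
theorem IsMMPDETrajectory.dissipation_eq_zero (hx : IsMMPDETrajectory V I τ P x)
    {Q : Set (Fin Nv → EuclideanSpace ℝ (Fin d))} (hQ : IsCompact Q)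
    (hxQ : ∀ t, 0 ≤ t → x t ∈ Q) (hI : ∀ y ∈ Q, ContDiffAt ℝ 1 I y)
    (hP : ∀ i, ContinuousOn (P i) Q) (hD : ∀ y ∈ Q, 0 ≤ dissipation V I τ P y) {L : ℝ}
    (hL : Tendsto (fun t => I (x t)) atTop (𝓝 L)) {xlim : Fin Nv → EuclideanSpace ℝ (Fin d)}
    (hlim : IsLimitMesh x xlim) : dissipation V I τ P xlim = 0 := by
  obtain ⟨t, ht, htx⟩ := hlim
  have ht0 : ∀ᶠ n in atTop, 0 < t n := ht.eventually_gt_atTop 0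
  have hxlim : xlim ∈ Q := hQ.isClosed.mem_of_tendsto htx (by
    filter_upwards [ht0] with n hn using hxQ _ hn.le)
  have hgc : ∀ i, ContinuousOn (fun z => admissibleGradient V I z i) Q := fun i y hy =>
    (continuousAt_admissibleGradient (hI y hy) i).continuousWithinAt
  have hvc : ContinuousOn (fun y i => -(P i y / τ) • admissibleGradient V I y i) Q :=
    continuousOn_pi.2 fun i => ((hP i).div_const τ).neg.smul (hgc i)
  have hDc : ContinuousOn (dissipation V I τ P) Q :=
    continuousOn_finsetSum _ fun i _ => ((hP i).div_const τ).mul ((hgc i).norm.pow 2)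
  obtain ⟨C, hC⟩ := hQ.exists_bound_of_continuousOn hvc
  by_contra hne
  have hpos : 0 < dissipation V I τ P xlim := (hD xlim hxlim).lt_of_ne' hne
  set δ := dissipation V I τ P xlim / 2 with hδ
  have hδ0 : 0 < δ := half_pos hpos
  have hnear : ∀ᶠ y in 𝓝[Q] xlim, δ < dissipation V I τ P y :=
    (hDc xlim hxlim).eventually_const_lt (half_lt_self hpos)
  obtain ⟨r, hr, hball⟩ := Metric.mem_nhdsWithin_iff.1 hnear
  have hC0 : 0 ≤ C := (norm_nonneg _).trans (hC xlim hxlim)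
  -- At speed at most `C` the trajectory moves by less than r/2 in time η, so it stays in the ball
  -- about `xlim` once it is within r/2 of the centre.
  set η := r / (2 * (C + 1)) with hη
  have hη0 : 0 < η := by positivity
  have hCη : C * η < r / 2 := by
    rw [hη, mul_div_assoc', div_lt_iff₀ (by positivity)]
    nlinarith
  have hdrop : ∀ᶠ n in atTop, I (x (t n + η)) ≤ I (x (t n)) - δ * η := by
    filter_upwards [ht0, htx.eventually (Metric.ball_mem_nhds xlim (half_pos hr))] with n hn hxn
    have hlow : ∀ s ∈ Set.Icc (t n) (t n + η), δ < dissipation V I τ P (x s) := by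
      intro s hs
      have hs0 : 0 < s := hn.trans_le hs.1
      refine hball ⟨?_, hxQ s hs0.le⟩
      have h1 : ‖x s - x (t n)‖ ≤ C * ‖s - t n‖ :=
        Convex.norm_image_sub_le_of_norm_hasDerivWithin_le (s := Set.Ioi 0)
          (fun u hu => (hx.hasDerivAt hu).hasDerivWithinAt)
          (fun u hu => hC (x u) (hxQ u (le_of_lt hu))) (convex_Ioi 0) hn hs0
      have h2 : ‖s - t n‖ ≤ η := by
        rw [Real.norm_of_nonneg (sub_nonneg.2 hs.1)]
        linarith [hs.2]
      have h3 : dist (x s) (x (t n)) < r / 2 := by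
        rw [dist_eq_norm]
        exact (h1.trans (mul_le_mul_of_nonneg_left h2 hC0)).trans_lt hCη
      rw [Metric.mem_ball]
      linarith [dist_triangle (x s) (x (t n)) xlim]
    have hder : ∀ s ∈ Set.Icc (t n) (t n + η),
        HasDerivAt (fun s => I (x s)) (-dissipation V I τ P (x s)) s := fun s hs =>
      hx.hasDerivAt_comp (hn.trans_le hs.1)
        ((hI _ (hxQ s (hn.trans_le hs.1).le)).differentiableAt one_ne_zero)
    have h := (convex_Icc (t n) (t n + η)).image_sub_le_mul_sub_of_deriv_le
      (f := fun s => I (x s)) (C := -δ)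
      (fun s hs => (hder s hs).continuousAt.continuousWithinAt)
      (fun s hs => (hder s (interior_subset hs)).differentiableAt.differentiableWithinAt)
      (fun s hs => by
        rw [(hder s (interior_subset hs)).deriv]
        exact neg_le_neg (hlow s (interior_subset hs)).le)
      (t n) (by simp [hη0.le]) (t n + η) (by simp [hη0.le]) (by linarith)
    simp only [add_sub_cancel_left] at h
    linarith
  -- Both values of the functional tend to L, which the fixed drop δη contradicts.
  have h1 : Tendsto (fun n => I (x (t n + η))) atTop (𝓝 L) :=
    hL.comp (tendsto_atTop_add_const_right _ η ht)
  have h2 : Tendsto (fun n => I (x (t n)) - δ * η) atTop (𝓝 (L - δ * η)) :=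
    (hL.comp ht).sub_const _
  have h3 := le_of_tendsto_of_tendsto h1 h2 hdrop
  have h4 : 0 < δ * η := by positivity
  linarith

end Trajectory

/-! ### No element loses its orientation -/

section Continuation

variable {d N Nv : ℕ} {Ω : Set (EuclideanSpace ℝ (Fin d))} {conn : Fin N → Fin (d + 1) → Fin Nv}
  {V : Fin Nv → Submodule ℝ (EuclideanSpace ℝ (Fin d))}
  {I : (Fin Nv → EuclideanSpace ℝ (Fin d)) → ℝ} {τ : ℝ}
  {P : Fin Nv → (Fin Nv → EuclideanSpace ℝ (Fin d)) → ℝ}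
  {x : ℝ → Fin Nv → EuclideanSpace ℝ (Fin d)}

/-- If a sublevel bound of the functional bounds the elements of nonsingular meshes away from
degeneracy, the elements never change their orientation along the trajectory. -/
theorem IsMMPDETrajectory.orient_mul_pos (hx : IsMMPDETrajectory V I τ P x) (hd : 1 ≤ d)
    (hΩ : IsOpen Ω) (hx₀ : IsNonsingularMesh Ω conn (x 0)) (hconf : IsConforming conn (x 0))
    (hV : IsBoundaryRule Ω conn (x 0) V)
    (hI : ∀ y, IsNonsingularMesh Ω conn y → DifferentiableAt ℝ I y)
    (hD : ∀ y, IsNonsingularMesh Ω conn y → 0 ≤ dissipation V I τ P y) {c : ℝ} (hc : 0 < c)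
    (hlow : ∀ y, IsNonsingularMesh Ω conn y → I y ≤ I (x 0) → ∀ K,
      c ≤ |orient (elementVertices conn y K)|) {t : ℝ} (ht : 0 ≤ t) (K : Fin N) :
    0 < orient (elementVertices conn (x 0) K) * orient (elementVertices conn (x t) K) := by
  set ω : Fin N → ℝ → ℝ := fun K s =>
    orient (elementVertices conn (x 0) K) * orient (elementVertices conn (x s) K) with hω
  have hωc : ∀ K, ContinuousOn (ω K) (Set.Ici 0) := fun K => continuousOn_const.mul
    ((continuous_orient.comp (continuous_elementVertices K)).comp_continuousOn hx.continuousOn)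
  by_contra hK
  -- The times up to `t` at which some element has lost its orientation; compactness provides a
  -- first one, `T`.
  set B : Set ℝ := ⋃ K, Set.Icc 0 t ∩ ω K ⁻¹' Set.Iic 0 with hB
  have hBc : IsCompact B := isCompact_iUnion fun K =>
    isCompact_Icc.of_isClosed_subset (((hωc K).mono
      Set.Icc_subset_Ici_self).preimage_isClosed_of_isClosed isClosed_Icc isClosed_Iic)
      Set.inter_subset_left
  obtain ⟨T, hTB, hTmin⟩ := hBc.exists_isLeast
    ⟨t, Set.mem_iUnion.2 ⟨K, ⟨ht, le_rfl⟩, not_lt.1 hK⟩⟩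
  obtain ⟨K', ⟨hT0, hTt⟩, hTK⟩ := Set.mem_iUnion.1 hTB
  have hω0 : 0 < ω K' 0 := mul_self_pos.2 (hx₀.orient_ne_zero K')
  have hTpos : 0 < T := hT0.lt_of_ne fun h => by
    rw [← h] at hTK
    exact absurd hTK (not_le.2 hω0)
  have hpos : ∀ s ∈ Set.Ico 0 T, ∀ K, 0 < ω K s := fun s hs K => by
    by_contra h
    exact absurd (hTmin (Set.mem_iUnion.2 ⟨K, ⟨hs.1, hs.2.le.trans hTt⟩, not_lt.1 h⟩))
      (not_le.2 hs.2)
  have hns : ∀ s ∈ Set.Ico 0 T, IsNonsingularMesh Ω conn (x s) := fun s hs =>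
    isNonsingularMesh_of_orient hd hΩ hx₀ hconf hV (hx.sub_mem hs.1) (hpos s hs)
  have hanti := hx.antitoneOn (convex_Ico 0 T) (fun s hs => hs.1) (fun s hs => hI _ (hns s hs))
    (fun s hs => hD _ (hns s hs))
  -- Before `T` the meshes are nonsingular and the functional has not grown, so `hlow` applies; its
  -- strictly positive bound survives the limit s → T.
  have hge : ∀ s ∈ Set.Ico 0 T, |orient (elementVertices conn (x 0) K')| * c ≤ ω K' s := by
    intro s hs
    rw [← abs_of_pos (hpos s hs K'), hω, abs_mul]
    exact mul_le_mul_of_nonneg_left (hlow _ (hns s hs)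
      (hanti ⟨le_rfl, hTpos⟩ hs hs.1) K') (abs_nonneg _)
  have hne : (𝓝[Set.Ico 0 T] T).NeBot := by
    rw [← mem_closure_iff_nhdsWithin_neBot, closure_Ico hTpos.ne]
    exact ⟨hTpos.le, le_rfl⟩
  have hlim : Tendsto (ω K') (𝓝[Set.Ico 0 T] T) (𝓝 (ω K' T)) :=
    (hωc K' T hT0).mono fun s hs => hs.1
  have h1 := ge_of_tendsto hlim (eventually_nhdsWithin_of_forall hge)
  have h2 : 0 < |orient (elementVertices conn (x 0) K')| * c :=
    mul_pos (abs_pos.2 (hx₀.orient_ne_zero K')) hc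
  exact absurd (h2.trans_le h1) (not_lt.2 hTK)

/-- The meshes that are reached from `x₀` by admissible displacements and whose elements keep their
orientation and a part `c` of their volume. -/
def admissibleMeshes (Ω : Set (EuclideanSpace ℝ (Fin d))) (conn : Fin N → Fin (d + 1) → Fin Nv)
    (V : Fin Nv → Submodule ℝ (EuclideanSpace ℝ (Fin d)))
    (x₀ : Fin Nv → EuclideanSpace ℝ (Fin d)) (c : ℝ) : Set (Fin Nv → EuclideanSpace ℝ (Fin d)) :=
  {y | (∀ i, y i ∈ closure Ω) ∧ (∀ i, y i - x₀ i ∈ V i) ∧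
    ∀ K, |orient (elementVertices conn x₀ K)| * c ≤
      orient (elementVertices conn x₀ K) * orient (elementVertices conn y K)}

theorem isCompact_admissibleMeshes (hΩ : Bornology.IsBounded Ω)
    (x₀ : Fin Nv → EuclideanSpace ℝ (Fin d)) (c : ℝ) :
    IsCompact (admissibleMeshes Ω conn V x₀ c) := by
  have h1 : IsCompact (Set.pi Set.univ fun _ : Fin Nv => closure Ω) :=
    isCompact_univ_pi fun _ => hΩ.isCompact_closure
  have h2 : IsClosed {y : Fin Nv → EuclideanSpace ℝ (Fin d) | ∀ i, y i - x₀ i ∈ V i} := by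
    rw [Set.ofPred_forall]
    exact isClosed_iInter fun i => (V i).closed_of_finiteDimensional.preimage
      ((continuous_apply i).sub continuous_const)
  have h3 : IsClosed {y : Fin Nv → EuclideanSpace ℝ (Fin d) |
      ∀ K, |orient (elementVertices conn x₀ K)| * c ≤
        orient (elementVertices conn x₀ K) * orient (elementVertices conn y K)} := by
    rw [Set.ofPred_forall]
    exact isClosed_iInter fun K => isClosed_le continuous_const
      (continuous_const.mul (continuous_orient.comp (continuous_elementVertices K)))
  refine (h1.inter_right (h2.inter h3)).of_isClosed_subset ?_ ?_
  · have h4 : IsClosed {y : Fin Nv → EuclideanSpace ℝ (Fin d) | ∀ i, y i ∈ closure Ω} := by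
      rw [Set.ofPred_forall]
      exact isClosed_iInter fun i => isClosed_closure.preimage (continuous_apply i)
    exact h4.inter (h2.inter h3)
  · exact fun y hy => ⟨fun i _ => hy.1 i, hy.2⟩

theorem isNonsingularMesh_of_mem_admissibleMeshes (hd : 1 ≤ d) (hΩ : IsOpen Ω)
    {x₀ y : Fin Nv → EuclideanSpace ℝ (Fin d)} (hx₀ : IsNonsingularMesh Ω conn x₀)
    (hconf : IsConforming conn x₀) (hV : IsBoundaryRule Ω conn x₀ V) {c : ℝ} (hc : 0 < c)
    (hy : y ∈ admissibleMeshes Ω conn V x₀ c) : IsNonsingularMesh Ω conn y :=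
  isNonsingularMesh_of_orient hd hΩ hx₀ hconf hV hy.2.1 fun K =>
    (mul_pos (abs_pos.2 (hx₀.orient_ne_zero K)) hc).trans_le (hy.2.2 K)

end Continuation

end MovingMesh

end

/-! ### The main theorem -/

theorem corollary4p2 {d N Nv : ℕ} (hd : 1 ≤ d) (hdN : 2 ≤ d ∨ 2 ≤ N)
    (Ω : Set (EuclideanSpace ℝ (Fin d))) (hΩ : MovingMesh.IsPolyhedralDomain Ω)
    (m mbar : ℝ) (hm : 0 < m)
    (M : EuclideanSpace ℝ (Fin d) → Matrix (Fin d) (Fin d) ℝ)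
    (hM : MovingMesh.IsMetricTensor Ω m mbar M)
    (p : ℝ) (hp : 1 < p) (hpd : (d : ℝ) < 4 * p)
    (ξ : Fin (d + 1) → EuclideanSpace ℝ (Fin d)) (hξ : MovingMesh.IsReferenceElement ξ)
    (conn : Fin N → Fin (d + 1) → Fin Nv)
    (σ : (Fin Nv → EuclideanSpace ℝ (Fin d)) → ℝ)
    -- `σ` is the mesh-dependent `σ_h`, or is frozen at a positive constant
    (hσ : σ = MovingMesh.sigma conn M ∨ ∃ c : ℝ, 0 < c ∧ σ = fun _ => c)
    (τ : ℝ) (hτ : 0 < τ)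
    (P : Fin Nv → (Fin Nv → EuclideanSpace ℝ (Fin d)) → ℝ)
    (hPpos : ∀ i y, MovingMesh.IsNonsingularMesh Ω conn y → 0 < P i y)
    (hPcont : ∀ i, ContinuousOn (P i) {y | MovingMesh.IsNonsingularMesh Ω conn y})
    (V : Fin Nv → Submodule ℝ (EuclideanSpace ℝ (Fin d)))
    (x : ℝ → Fin Nv → EuclideanSpace ℝ (Fin d))
    (hx₀ : MovingMesh.IsNonsingularMesh Ω conn (x 0))
    (hx₀conf : MovingMesh.IsConforming conn (x 0))
    (hV : MovingMesh.IsBoundaryRule Ω conn (x 0) V)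
    (hx : MovingMesh.IsMMPDETrajectory V (MovingMesh.energy ξ conn M p σ) τ P x) :
    -- the trajectory consists of nonsingular meshes
    (∀ t, 0 ≤ t → MovingMesh.IsNonsingularMesh Ω conn (x t)) ∧
    -- (a)
    (∃ L : ℝ, Tendsto (fun t => MovingMesh.energy ξ conn M p σ (x t)) atTop (𝓝 L)) ∧
    -- (b)
    (∃ xlim, MovingMesh.IsLimitMesh x xlim) ∧
    (∀ xlim, MovingMesh.IsLimitMesh x xlim →
      MovingMesh.IsNonsingularMesh Ω conn xlim ∧
      MovingMesh.SatisfiesBounds conn M p mbar (MovingMesh.alphaM d p m)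
        (MovingMesh.betaC d p m (MovingMesh.gammaH d N (σ xlim)) * volume.real Ω +
          MovingMesh.energy ξ conn M p σ (x 0)) xlim ∧
      (1 ≤ √(d : ℝ) * mbar →
        MovingMesh.SatisfiesBounds conn M p mbar (MovingMesh.alphaJ d p m mbar)
          (MovingMesh.betaC d p m (MovingMesh.gammaH d N (σ xlim)) * volume.real Ω +
            MovingMesh.energy ξ conn M p σ (x 0)) xlim)) ∧
    -- (c)
    (∀ xlim, MovingMesh.IsLimitMesh x xlim →
      MovingMesh.IsCriticalMesh V (MovingMesh.energy ξ conn M p σ) xlim) := by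
  have hne := hΩ.isConnected.nonempty
  have hsmooth : ∀ y, MovingMesh.IsNonsingularMesh Ω conn y →
      ContDiffAt ℝ 1 (MovingMesh.energy ξ conn M p σ) y := fun y hy =>
    MovingMesh.contDiffAt_energy hΩ hM hm hp hξ hy hσ
  have hdiff : ∀ y, MovingMesh.IsNonsingularMesh Ω conn y →
      DifferentiableAt ℝ (MovingMesh.energy ξ conn M p σ) y := fun y hy =>
    (hsmooth y hy).differentiableAt one_ne_zero
  have hdiss : ∀ y, MovingMesh.IsNonsingularMesh Ω conn y →
      0 ≤ MovingMesh.dissipation V (MovingMesh.energy ξ conn M p σ) τ P y := fun y hy =>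
    MovingMesh.dissipation_nonneg hτ fun i => hPpos i y hy
  obtain ⟨c, hc, hlow⟩ := MovingMesh.exists_lower_bound_orient hd hdN hΩ hm hM hp hpd hξ hσ
    (hx₀.pos_card hne) (MovingMesh.energy ξ conn M p σ (x 0))
  have horient : ∀ t, 0 ≤ t → ∀ K, 0 < MovingMesh.orient (MovingMesh.elementVertices conn (x 0) K) *
      MovingMesh.orient (MovingMesh.elementVertices conn (x t) K) := fun t ht =>
    hx.orient_mul_pos hd hΩ.isOpen hx₀ hx₀conf hV hdiff hdiss hc hlow ht
  have hns : ∀ t, 0 ≤ t → MovingMesh.IsNonsingularMesh Ω conn (x t) := fun t ht =>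
    MovingMesh.isNonsingularMesh_of_orient hd hΩ.isOpen hx₀ hx₀conf hV (hx.sub_mem ht)
      (horient t ht)
  have hanti : AntitoneOn (fun t => MovingMesh.energy ξ conn M p σ (x t)) (Set.Ici 0) :=
    hx.antitoneOn (convex_Ici 0) subset_rfl (fun t ht => hdiff _ (hns t ht))
      fun t ht => hdiss _ (hns t ht)
  have hle : ∀ t, 0 ≤ t → MovingMesh.energy ξ conn M p σ (x t) ≤
      MovingMesh.energy ξ conn M p σ (x 0) := fun t ht => hanti Set.self_mem_Ici ht ht
  have hQ : IsCompact (MovingMesh.admissibleMeshes Ω conn V (x 0) c) :=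
    MovingMesh.isCompact_admissibleMeshes hΩ.isBounded (x 0) c
  have hQns : ∀ y ∈ MovingMesh.admissibleMeshes Ω conn V (x 0) c,
      MovingMesh.IsNonsingularMesh Ω conn y := fun y hy =>
    MovingMesh.isNonsingularMesh_of_mem_admissibleMeshes hd hΩ.isOpen hx₀ hx₀conf hV hc hy
  have hxQ : ∀ t, 0 ≤ t → x t ∈ MovingMesh.admissibleMeshes Ω conn V (x 0) c := by
    refine fun t ht => ⟨fun i => ?_, hx.sub_mem ht, fun K => ?_⟩
    -- Each vertex belongs to an element and thus stays in the closure of `Ω`; this is what bounds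
    -- the trajectory.
    · obtain ⟨K, j, rfl⟩ := hx₀conf.vertex_mem i
      exact (hns t ht).simplex_subset K
        (MovingMesh.vertex_mem_simplex (MovingMesh.elementVertices conn (x t) K) j)
    · rw [← abs_of_pos (horient t ht K), abs_mul]
      exact mul_le_mul_of_nonneg_left (hlow _ (hns t ht) (hle t ht) K) (abs_nonneg _)
  have hlimQ : ∀ xlim, MovingMesh.IsLimitMesh x xlim →
      xlim ∈ MovingMesh.admissibleMeshes Ω conn V (x 0) c := by
    rintro xlim ⟨t, ht, htx⟩
    refine hQ.isClosed.mem_of_tendsto htx ?_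
    filter_upwards [ht.eventually_ge_atTop 0] with n hn using hxQ _ hn
  have hlimle : ∀ xlim, MovingMesh.IsLimitMesh x xlim →
      MovingMesh.energy ξ conn M p σ xlim ≤ MovingMesh.energy ξ conn M p σ (x 0) := by
    intro xlim hlim
    have hcont := (hdiff xlim (hQns xlim (hlimQ xlim hlim))).continuousAt
    obtain ⟨t, ht, htx⟩ := hlim
    refine le_of_tendsto (hcont.tendsto.comp htx) ?_
    filter_upwards [ht.eventually_ge_atTop 0] with n hn using hle _ hn
  have hconv : ∃ L : ℝ,
      Tendsto (fun t => MovingMesh.energy ξ conn M p σ (x t)) atTop (𝓝 L) := by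
    -- Truncation of the time at 0 extends the monotonicity to the whole line.
    have hanti' : Antitone fun t => MovingMesh.energy ξ conn M p σ (x (max t 0)) :=
      fun s t hst => hanti (le_max_right s 0) (le_max_right t 0) (max_le_max_right 0 hst)
    refine ⟨_, (tendsto_atTop_ciInf hanti' ⟨0, ?_⟩).congr' ?_⟩
    · rintro _ ⟨t, rfl⟩
      exact MovingMesh.energy_nonneg _
    · filter_upwards [eventually_ge_atTop 0] with t ht
      rw [max_eq_left ht]
  obtain ⟨σ₀, hσ₀, hσlow⟩ := MovingMesh.exists_lower_bound_sigma (conn := conn) hΩ hM hm hσ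
  have hmbar := hM.mbar_pos hd hm hne
  have hd0 : (0 : ℝ) < d := by exact_mod_cast hd
  have hbounds : ∀ xlim, MovingMesh.IsLimitMesh x xlim → ∀ α, 0 < α →
      α ≤ MovingMesh.alphaM d p m → MovingMesh.SatisfiesBounds conn M p mbar α
        (MovingMesh.betaC d p m (MovingMesh.gammaH d N (σ xlim)) * volume.real Ω +
          MovingMesh.energy ξ conn M p σ (x 0)) xlim := fun xlim hlim α hα hαM =>
    have hmesh := hQns xlim (hlimQ xlim hlim)
    MovingMesh.satisfiesBounds hd hdN hΩ hm hM hp hpd hξ hmesh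
      (hσ₀.le.trans (hσlow xlim hmesh)) hα hαM (by linarith [hlimle xlim hlim])
  refine ⟨hns, hconv, ?_, fun xlim hlim => ⟨hQns xlim (hlimQ xlim hlim), ?_, fun h => ?_⟩,
    fun xlim hlim => ?_⟩
  · obtain ⟨xlim, -, n, hn, hlim⟩ := hQ.tendsto_subseq (x := fun k : ℕ => x k)
      fun k => hxQ k k.cast_nonneg
    exact ⟨xlim, fun k => n k, tendsto_natCast_atTop_atTop.comp hn.tendsto_atTop, hlim⟩
  · exact hbounds xlim hlim _ (by unfold MovingMesh.alphaM; positivity) le_rfl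
  · exact hbounds xlim hlim _ (by unfold MovingMesh.alphaJ; positivity)
      (MovingMesh.alphaJ_le_alphaM hd hp hm hmbar h)
  · obtain ⟨L, hL⟩ := hconv
    have hmesh := hQns xlim (hlimQ xlim hlim)
    refine ⟨hdiff xlim hmesh, MovingMesh.admissibleGradient_eq_zero_of_dissipation hτ
      (fun i => hPpos i xlim hmesh) (hx.dissipation_eq_zero hQ hxQ
        (fun y hy => hsmooth y (hQns y hy)) (fun i => (hPcont i).mono hQns)
        (fun y hy => hdiss y (hQns y hy)) hL hlim)⟩
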